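/- Let $r\simeq 0.834$ and $s\simeq 0.651$ be the roots, in $[0.834,0.835]$ and $[0.651,0.652]$ respectively, of $$4x^8-36x^7-27x^6+162x^5+135x^4-88x^3-73x^2-14x+1,$$ $$89x^8+1344x^7+4008x^6-464x^5-2410x^4+176x^3+296x^2-96x+1 .$$ **Packings and triangles.** A packing is a set of circles of the plane with radii (sizes) in $\{1,r,s\}$ and pairwise disjoint interiors; it is saturated if no further circle of size $s$ can be added. The cell of a circle with center $A$ and size $a$ is the set of points $p$ at which $|pA|-a$ is minimal among all the circles of the packing. A triangle $T$ of an FM-triangulation of the packing (a triangulation dual to the cells) has as vertices the centers of three distinct circles whose cells have a common point $X$; then $X$ is the center of the support circle of $T$, which is tangent to the three circles and interior disjoint from all the circles of the packing. (If more than three cells meet at $X$, every triple of them is allowed.) A tight triangle is one whose three circles are mutually tangent. **Excess.** Let $\mathrm{area}(T)$ be the area of $T$ and $\mathrm{cov}(T)$ the area of the part of $T$ inside the three circles centered at its vertices. Let $\delta\simeq 0.9093$ be the density of the periodic compact packing by circles of sizes $1,r,s$ (the target packing), whose triangulation contains, per period, tight triangles with circle sizes $(1,r,s)$, $(1,1,s)$,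 $(1,r,r)$ in proportion $4:1:1$; that is, writing $T_{xyz}$ for the tight triangle with circles of sizes $x,y,z$, $$\delta=\frac{4\,\mathrm{cov}(T_{1rs})+\mathrm{cov}(T_{11s})+\mathrm{cov}(T_{1rr})}{4\,\mathrm{area}(T_{1rs})+\mathrm{area}(T_{11s})+\mathrm{area}(T_{1rr})}.$$ Put $E(T)=\delta\,\mathrm{area}(T)-\mathrm{cov}(T)$. **Vertex potential.** The numbers $V_{xqy}=V_{yqx}$, for $x,q,y\in\{1,r,s\}$, are the unique solution of the equations: $V_{yxz}+V_{xyz}+V_{xzy}=E(T_{xyz})$ for each of the ten tight triangles; $V_{xqx}=0$ for $x\neq q$; and $$V_{1s1}+4V_{1sr}=0,\qquad 2V_{1rr}+4V_{1rs}=0,\qquad V_{r1r}+2V_{11s}+4V_{r1s}=0 .$$ Let $m_1=0.12$ and $m_r=m_s=0.03$. If $v$ is a vertex of $T$, $q$ is the size of the circle centered at $v$, and $x,y$ are the sizes of the two other circles, put $$U_v(T)=V_{xqy}+m_q\,|\widehat v(T)-\widehat v(\check T)|,$$ where $\check T$ is the tight triangle with the same circle sizes and $\widehat v(\cdot)$ is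 the angle at $v$. **Edge potential.** Let $l_{xy}=l_{yx}$ and $q_{xy}=q_{yx}$ be given by $$l_{11}=2.78,\ l_{1r}=2.60,\ l_{1s}=2.32,\ l_{rr}=2.42,\ l_{rs}=2.14,\ l_{ss}=1.94,$$ $$q_{11}=0.39,\ q_{1r}=0.31,\ q_{1s}=0.30,\ q_{rr}=0.26,\ q_{rs}=0.26,\ q_{ss}=0.25.$$ If $e$ is an edge of $T$ whose endpoints are the centers of circles of sizes $x$ and $y$, put $U_e(T)=0$ if $e$ is shorter than $l_{xy}$, and $U_e(T)=q_{xy}\,d_e(T)$ otherwise, where $d_e(T)$ is the signed distance from the center $X$ of the support circle of $T$ to the line containing $e$, positive if $X$ and $T$ are on the same side of this line and negative if they are on opposite sides. The potential $U(T)$ is the sum of the three vertex potentials and the three edge potentials of $T$. **Proposition.** Every triangle $T$ of an FM-triangulation of a saturated packing by circles of sizes $1$, $r$ and $s$ satisfies $$E(T)\ge U(T).$$ -/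

import Mathlib

open scoped EuclideanGeometry

namespace TernaryPacking

/-- The Euclidean plane. -/
abbrev Plane : Type := EuclideanSpace ℝ (Fin 2)

/-! ### The three circle sizes -/

noncomputable def mediumPoly (x : ℝ) : ℝ :=
  4 * x ^ 8 - 36 * x ^ 7 - 27 * x ^ 6 + 162 * x ^ 5 + 135 * x ^ 4 - 88 * x ^ 3 - 73 * x ^ 2
    - 14 * x + 1

noncomputable def smallPoly (x : ℝ) : ℝ :=
  89 * x ^ 8 + 1344 * x ^ 7 + 4008 * x ^ 6 - 464 * x ^ 5 - 2410 * x ^ 4 + 176 * x ^ 3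
    + 296 * x ^ 2 - 96 * x + 1

theorem existsUnique_mediumRadius :
    ∃! x : ℝ, x ∈ Set.Icc (0.834 : ℝ) 0.835 ∧ mediumPoly x = 0 := by
  have hc : Continuous mediumPoly := by unfold mediumPoly; fun_prop
  have hm : StrictMonoOn mediumPoly (Set.Icc (0.834 : ℝ) 0.835) := by
    apply strictMonoOn_of_deriv_pos (convex_Icc _ _) hc.continuousOn
    intro x hx
    rw [interior_Icc] at hx
    have hd : deriv mediumPoly x = 4 * (8 * x ^ 7) - 36 * (7 * x ^ 6) - 27 * (6 * x ^ 5)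
        + 162 * (5 * x ^ 4) + 135 * (4 * x ^ 3) - 88 * (3 * x ^ 2) - 73 * (2 * x) - 14 := by
      have h : ∀ n : ℕ, HasDerivAt (fun x : ℝ => x ^ n) (n * x ^ (n - 1)) x :=
        fun n => hasDerivAt_pow n x
      have := ((((((((h 8).const_mul 4).sub ((h 7).const_mul 36)).sub ((h 6).const_mul 27)).add
        ((h 5).const_mul 162)).add ((h 4).const_mul 135)).sub ((h 3).const_mul 88)).sub
        ((h 2).const_mul 73)).sub ((hasDerivAt_id x).const_mul 14) |>.add_const 1
      refine Eq.trans (HasDerivAt.deriv this) ?_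
      norm_num
    rw [hd]
    have lo : ∀ n : ℕ, (0.834 : ℝ) ^ n ≤ x ^ n := fun n =>
      pow_le_pow_left₀ (by norm_num) hx.1.le n
    have hi : ∀ n : ℕ, x ^ n ≤ (0.835 : ℝ) ^ n := fun n =>
      pow_le_pow_left₀ (by linarith [hx.1]) hx.2.le n
    have l7 := lo 7
    have l4 := lo 4
    have l3 := lo 3
    have h6 := hi 6
    have h5 := hi 5
    have h2 := hi 2
    have h1 := hx.2
    norm_num at l7 l4 l3 h6 h5 h2 h1 ⊢
    linarith
  have h0 : (0 : ℝ) ∈ Set.Icc (mediumPoly 0.834) (mediumPoly 0.835) := by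
    constructor <;> norm_num [mediumPoly]
  obtain ⟨x, hx, hx0⟩ := intermediate_value_Icc (by norm_num) hc.continuousOn h0
  exact ⟨x, ⟨hx, hx0⟩, fun y hy => hm.injOn hy.1 hx (hy.2.trans hx0.symm)⟩

theorem existsUnique_smallRadius :
    ∃! x : ℝ, x ∈ Set.Icc (0.651 : ℝ) 0.652 ∧ smallPoly x = 0 := by
  have hc : Continuous smallPoly := by unfold smallPoly; fun_prop
  have hm : StrictMonoOn smallPoly (Set.Icc (0.651 : ℝ) 0.652) := by
    apply strictMonoOn_of_deriv_pos (convex_Icc _ _) hc.continuousOn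
    intro x hx
    rw [interior_Icc] at hx
    have hd : deriv smallPoly x = 89 * (8 * x ^ 7) + 1344 * (7 * x ^ 6) + 4008 * (6 * x ^ 5)
        - 464 * (5 * x ^ 4) - 2410 * (4 * x ^ 3) + 176 * (3 * x ^ 2) + 296 * (2 * x) - 96 := by
      have h : ∀ n : ℕ, HasDerivAt (fun x : ℝ => x ^ n) (n * x ^ (n - 1)) x :=
        fun n => hasDerivAt_pow n x
      have := ((((((((h 8).const_mul 89).add ((h 7).const_mul 1344)).add
        ((h 6).const_mul 4008)).sub ((h 5).const_mul 464)).sub ((h 4).const_mul 2410)).add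
        ((h 3).const_mul 176)).add ((h 2).const_mul 296)).sub
        ((hasDerivAt_id x).const_mul 96) |>.add_const 1
      refine Eq.trans (HasDerivAt.deriv this) ?_
      norm_num
    rw [hd]
    have lo : ∀ n : ℕ, (0.651 : ℝ) ^ n ≤ x ^ n := fun n =>
      pow_le_pow_left₀ (by norm_num) hx.1.le n
    have hi : ∀ n : ℕ, x ^ n ≤ (0.652 : ℝ) ^ n := fun n =>
      pow_le_pow_left₀ (by linarith [hx.1]) hx.2.le n
    have l7 := lo 7
    have l6 := lo 6
    have l5 := lo 5
    have l2 := lo 2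
    have h4 := hi 4
    have h3 := hi 3
    have l1 := hx.1
    norm_num at l7 l6 l5 l2 h4 h3 l1 ⊢
    nlinarith
  have h0 : (0 : ℝ) ∈ Set.Icc (smallPoly 0.651) (smallPoly 0.652) := by
    constructor <;> norm_num [smallPoly]
  obtain ⟨x, hx, hx0⟩ := intermediate_value_Icc (by norm_num) hc.continuousOn h0
  exact ⟨x, ⟨hx, hx0⟩, fun y hy => hm.injOn hy.1 hx (hy.2.trans hx0.symm)⟩

/-- `r ≃ 0.834`: the root of `mediumPoly` in `[0.834, 0.835]`. -/
noncomputable def mediumRadius : ℝ := existsUnique_mediumRadius.exists.choose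

/-- `s ≃ 0.651`: the root of `smallPoly` in `[0.651, 0.652]`. -/
noncomputable def smallRadius : ℝ := existsUnique_smallRadius.exists.choose

theorem mediumRadius_spec :
    mediumRadius ∈ Set.Icc (0.834 : ℝ) 0.835 ∧ mediumPoly mediumRadius = 0 :=
  existsUnique_mediumRadius.exists.choose_spec

theorem smallRadius_spec :
    smallRadius ∈ Set.Icc (0.651 : ℝ) 0.652 ∧ smallPoly smallRadius = 0 :=
  existsUnique_smallRadius.exists.choose_spec

/-- Names for the three sizes `1`, `r` and `s`. -/
inductive Size where
  | large
  | medium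
  | small
  deriving DecidableEq

open Size

/-- The size (radius) itself, a real number. -/
noncomputable def Size.radius : Size → ℝ
  | large => 1
  | medium => mediumRadius
  | small => smallRadius

theorem Size.radius_pos (x : Size) : 0 < x.radius := by
  have h1 := mediumRadius_spec.1.1
  have h2 := smallRadius_spec.1.1
  cases x <;> simp only [Size.radius] <;> norm_num at * <;> linarith

/-- A circle in the plane whose radius is `1`, `r` or `s`. -/
structure Circle where
  center : Plane
  size : Size

noncomputable def Circle.radius (c : Circle) : ℝ := c.size.radius

/-! ### Packings, cells, and triangles of FM-triangulations -/

/-- A packing by circles of sizes `1`, `r`, `s`: the circles have pairwise disjoint interiors. -/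
def IsPacking (P : Set Circle) : Prop :=
  P.Pairwise fun c d => Disjoint (Metric.ball c.center c.radius) (Metric.ball d.center d.radius)

/-- No further circle of size `s` can be added. -/
def IsSaturated (P : Set Circle) : Prop :=
  ∀ p : Plane, ∃ c ∈ P,
    ¬ Disjoint (Metric.ball p smallRadius) (Metric.ball c.center c.radius)

/-- Signed distance from a point to a circle (negative inside the circle). -/
noncomputable def Circle.distTo (c : Circle) (p : Plane) : ℝ := dist p c.center - c.radius

/-- The (closed) cell of the circle `c`: the points at least as close to `c` as to any other
circle of the packing. -/
def cell (P : Set Circle) (c : Circle) : Set Plane :=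
  {p | ∀ d ∈ P, c.distTo p ≤ d.distTo p}

/-- The centers of the three distinct circles `a`, `b`, `c` of the packing are the vertices of a
triangle of an FM-triangulation (dual of the decomposition into cells), and `X` is the point
common to the three cells to which this triangle is dual.

Equivalently, the circle with center `X` and radius `a.distTo X = b.distTo X = c.distTo X` is
tangent to `a`, `b`, `c` and interior disjoint from all the circles of the packing: `X` is the
center of the support circle of the triangle. When more than three cells meet in `X`, the dual
face can be triangulated in several ways; all the triples of circles are then allowed. -/
structure IsFMTriangle (P : Set Circle) (a b c : Circle) (X : Plane) : Prop where
  mem_a : a ∈ P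
  mem_b : b ∈ P
  mem_c : c ∈ P
  ne_ab : a ≠ b
  ne_bc : b ≠ c
  ne_ac : a ≠ c
  center_mem : X ∈ cell P a ∩ cell P b ∩ cell P c

/-! ### Area, covered area, tight triangles -/

/-- The triangle with vertices the centers of the three circles. -/
def triangle (a b c : Circle) : Set Plane :=
  convexHull ℝ {a.center, b.center, c.center}

noncomputable def area (a b c : Circle) : ℝ :=
  MeasureTheory.volume.real (triangle a b c)

/-- Area of the part of the triangle inside the circles centered on its vertices. -/
noncomputable def cov (a b c : Circle) : ℝ :=
  MeasureTheory.volume.real (triangle a b c ∩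
    (Metric.closedBall a.center a.radius ∪ Metric.closedBall b.center b.radius ∪
      Metric.closedBall c.center c.radius))

/-- First circle (of size `x`) of the model tight triangle with circles of sizes `x`, `y`, `z`. -/
noncomputable def tightFst (x : Size) : Circle := ⟨!₂[0, 0], x⟩

/-- Second circle (of size `y`) of the model tight triangle. -/
noncomputable def tightSnd (x y : Size) : Circle := ⟨!₂[x.radius + y.radius, 0], y⟩

/-- First coordinate of the third vertex of the model tight triangle. -/
noncomputable def apexX (x y z : Size) : ℝ :=
  ((x.radius + y.radius) ^ 2 + (x.radius + z.radius) ^ 2 - (y.radius + z.radius) ^ 2) /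
    (2 * (x.radius + y.radius))

/-- Third circle (of size `z`) of the model tight triangle. -/
noncomputable def tightThd (x y z : Size) : Circle :=
  ⟨!₂[apexX x y z, Real.sqrt ((x.radius + z.radius) ^ 2 - apexX x y z ^ 2)], z⟩

/-- The three circles of the model tight triangle are mutually tangent. -/
theorem tight_tangent (x y z : Size) :
    dist (tightFst x).center (tightSnd x y).center = x.radius + y.radius ∧
    dist (tightFst x).center (tightThd x y z).center = x.radius + z.radius ∧
    dist (tightSnd x y).center (tightThd x y z).center = y.radius + z.radius := by
  have hx := x.radius_pos
  have hy := y.radius_pos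
  have hz := z.radius_pos
  have key : 2 * (x.radius + y.radius) * apexX x y z =
      (x.radius + y.radius) ^ 2 + (x.radius + z.radius) ^ 2 - (y.radius + z.radius) ^ 2 := by
    unfold apexX
    field_simp
  have hnn : 0 ≤ (x.radius + z.radius) ^ 2 - apexX x y z ^ 2 := by
    have h4 : (2 * (x.radius + y.radius)) ^ 2 * ((x.radius + z.radius) ^ 2 - apexX x y z ^ 2) =
        16 * (x.radius * y.radius * z.radius * (x.radius + y.radius + z.radius)) := by
      have : (2 * (x.radius + y.radius)) ^ 2 * ((x.radius + z.radius) ^ 2 - apexX x y z ^ 2) =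
        (2 * (x.radius + y.radius)) ^ 2 * (x.radius + z.radius) ^ 2
          - (2 * (x.radius + y.radius) * apexX x y z) ^ 2 := by ring
      rw [this, key]
      ring
    by_contra hneg
    push Not at hneg
    have hp : 0 < (2 * (x.radius + y.radius)) ^ 2 := by positivity
    have hq : 0 < 16 * (x.radius * y.radius * z.radius * (x.radius + y.radius + z.radius)) := by
      positivity
    nlinarith [mul_neg_of_pos_of_neg hp hneg]
  refine ⟨?_, ?_, ?_⟩
  · rw [EuclideanSpace.dist_eq]
    simp only [tightFst, tightSnd, Fin.sum_univ_two]
    simp only [Real.dist_eq, sq_abs]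
    rw [Real.sqrt_eq_iff_mul_self_eq (by positivity) (by positivity)]
    simp
    ring
  · rw [EuclideanSpace.dist_eq]
    simp only [tightFst, tightThd, Fin.sum_univ_two]
    simp only [Real.dist_eq, sq_abs]
    rw [Real.sqrt_eq_iff_mul_self_eq (by positivity) (by positivity)]
    simp [Real.sq_sqrt hnn]
    ring
  · rw [EuclideanSpace.dist_eq]
    simp only [tightSnd, tightThd, Fin.sum_univ_two]
    simp only [Real.dist_eq, sq_abs]
    rw [Real.sqrt_eq_iff_mul_self_eq (by positivity) (by positivity)]
    simp [Real.sq_sqrt hnn]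
    nlinarith [key]

noncomputable def tightArea (x y z : Size) : ℝ :=
  area (tightFst x) (tightSnd x y) (tightThd x y z)

noncomputable def tightCov (x y z : Size) : ℝ :=
  cov (tightFst x) (tightSnd x y) (tightThd x y z)

/-- The angle, in the tight triangle with circles of sizes `q`, `x`, `y`, at the center of the
circle of size `q`. -/
noncomputable def tightAngle (q x y : Size) : ℝ :=
  ∠ (tightSnd q x).center (tightFst q).center (tightThd q x y).center

/-- The density `δ ≃ 0.9093` of the target packing, the periodic compact packing by circles of
sizes `1`, `r`, `s`. Its triangulation by tight triangles contains, per period, triangles with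
circle sizes `1, r, s`, triangles with sizes `1, 1, s` and triangles with sizes `1, r, r` in
proportion `4 : 1 : 1`; the density is the covered fraction of a period. -/
noncomputable def targetDensity : ℝ :=
  (4 * tightCov large medium small + tightCov large large small + tightCov medium medium large) /
    (4 * tightArea large medium small + tightArea large large small
      + tightArea medium medium large)

/-- The excess `E(T) = δ * area(T) - cov(T)`. -/
noncomputable def excess (a b c : Circle) : ℝ := targetDensity * area a b c - cov a b c

noncomputable def tightExcess (x y z : Size) : ℝ :=
  excess (tightFst x) (tightSnd x y) (tightThd x y z)

/-! ### The vertex potential -/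

/-- The equations imposed on the vertex potentials `V x q y` (the potential at the center of the
circle of size `q` in the tight triangle with circles of sizes `x`, `q`, `y`): the total potential
of each of the ten tight triangles is its excess; the potentials around each circle of the target
packing sum to zero; the apex potentials `V x q x`, `q ≠ x`, vanish. -/
structure IsTightPotential (V : Size → Size → Size → ℝ) : Prop where
  symm : ∀ x q y, V x q y = V y q x
  sum_equal : ∀ x, 3 * V x x x = tightExcess x x x
  sum_two : ∀ x y, x ≠ y → 2 * V x x y + V x y x = tightExcess x x y
  sum_distinct : V medium large small + V large medium small + V large small medium =
    tightExcess large medium small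
  around_small : V large small large + 4 * V large small medium = 0
  around_medium : 2 * V large medium medium + 4 * V large medium small = 0
  around_large :
    V medium large medium + 2 * V large large small + 4 * V medium large small = 0
  apex : ∀ x q, x ≠ q → V x q x = 0

/-- The vertex potentials of the tight triangles. -/
noncomputable def tightPotential (x q y : Size) : ℝ :=
  if x = q then
    if y = q then tightExcess q q q / 3 else tightExcess q q y / 2
  else if y = q then tightExcess q q x / 2
  else if x = y then 0
  else
    match q with
    | small => 0
    | medium => - tightExcess medium medium large / 4
    | large => tightExcess large medium small + tightExcess medium medium large / 4

/-- Over a period of the target packing, the excesses sum to zero. -/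
theorem tightExcess_period :
    4 * tightExcess large medium small + tightExcess large large small
      + tightExcess medium medium large = 0 := by
  have hfin : ∀ a b c : Circle, MeasureTheory.volume (triangle a b c) ≠ ⊤ := fun a b c =>
    (((Set.toFinite _).isCompact_convexHull (𝕜 := ℝ)).measure_lt_top).ne
  have hle : ∀ a b c : Circle, cov a b c ≤ area a b c := fun a b c =>
    MeasureTheory.measureReal_mono Set.inter_subset_left (hfin a b c)
  have hc : ∀ a b c : Circle, 0 ≤ cov a b c := fun a b c => MeasureTheory.measureReal_nonneg
  have ha : ∀ a b c : Circle, 0 ≤ area a b c := fun a b c => MeasureTheory.measureReal_nonneg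
  have hle' : ∀ x y z, tightCov x y z ≤ tightArea x y z := fun x y z => hle _ _ _
  have hc' : ∀ x y z, 0 ≤ tightCov x y z := fun x y z => hc _ _ _
  have ha' : ∀ x y z, 0 ≤ tightArea x y z := fun x y z => ha _ _ _
  have hE : ∀ x y z, tightExcess x y z = targetDensity * tightArea x y z - tightCov x y z :=
    fun x y z => rfl
  rw [hE, hE, hE]
  set A := 4 * tightArea large medium small + tightArea large large small
      + tightArea medium medium large with hA
  set C := 4 * tightCov large medium small + tightCov large large small
      + tightCov medium medium large with hC
  have hd : targetDensity * A = C := by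
    have : targetDensity = C / A := rfl
    rw [this]
    refine div_mul_cancel_of_imp fun h0 => ?_
    linarith [hle' large medium small, hle' large large small, hle' medium medium large,
      hc' large medium small, hc' large large small, hc' medium medium large]
  linear_combination hd

/-- The equations determine the vertex potentials of the tight triangles. -/
theorem isTightPotential_iff (V : Size → Size → Size → ℝ) :
    IsTightPotential V ↔ V = tightPotential := by
  constructor
  · intro h
    have e1 := h.sum_equal large
    have e2 := h.sum_equal medium
    have e3 := h.sum_equal small
    have t : ∀ x y, x ≠ y → V x x y = tightExcess x x y / 2 := fun x y hxy => by
      linarith [h.sum_two x y hxy, h.apex x y hxy]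
    have a := h.apex
    have d1 := h.sum_distinct
    have d2 := h.around_small
    have d3 := h.around_medium
    have s1 := h.symm
    have t1 := t medium large (by decide)
    have a1 := a large small (by decide)
    have s2 := s1 large medium medium
    have v1 : V large small medium = 0 := by linarith
    have v2 : V large medium small = - tightExcess medium medium large / 4 := by linarith
    have v3 : V medium large small =
        tightExcess large medium small + tightExcess medium medium large / 4 := by linarith
    funext x q y
    cases x <;> cases q <;> cases y <;> simp only [tightPotential, reduceCtorEq, if_true, if_false]
    all_goals first
      | linarith
      | exact t _ _ (by decide)
      | exact a _ _ (by decide)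
      | exact (s1 _ _ _).trans (t _ _ (by decide))
      | exact (s1 _ _ _).trans v1
      | exact (s1 _ _ _).trans v2
      | exact (s1 _ _ _).trans v3
  · rintro rfl
    have hp := tightExcess_period
    refine ⟨?_, ?_, ?_, ?_, ?_, ?_, ?_, ?_⟩
    · intro x q y
      cases x <;> cases q <;> cases y <;> simp [tightPotential]
    · intro x
      simp only [tightPotential, if_true]
      ring
    · intro x y hxy
      simp only [tightPotential, if_true, hxy, hxy.symm, if_false]
      ring
    · simp only [tightPotential, reduceCtorEq, if_false]
      ring
    · simp [tightPotential]
    · simp only [tightPotential, reduceCtorEq, if_true, if_false]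
      ring
    · simp only [tightPotential, reduceCtorEq, if_true, if_false]
      linarith
    · intro x q hxq
      simp [tightPotential, hxq]

/-- The constants `m_1 = 0.12` and `m_r = m_s = 0.03`. -/
noncomputable def mConst : Size → ℝ
  | large => 0.12
  | medium => 0.03
  | small => 0.03

/-- The potential `U_v(T)` of the vertex `v`, the two other circles being `x` and `y`. -/
noncomputable def vertexPotential (v x y : Circle) : ℝ :=
  tightPotential x.size v.size y.size +
    mConst v.size * |∠ x.center v.center y.center - tightAngle v.size x.size y.size|

/-! ### The edge potential -/

/-- The thresholds `l_xy`. -/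
noncomputable def lConst : Size → Size → ℝ
  | large, large => 2.78
  | large, medium => 2.60
  | medium, large => 2.60
  | large, small => 2.32
  | small, large => 2.32
  | medium, medium => 2.42
  | medium, small => 2.14
  | small, medium => 2.14
  | small, small => 1.94

/-- The coefficients `q_xy`. -/
noncomputable def qConst : Size → Size → ℝ
  | large, large => 0.39
  | large, medium => 0.31
  | medium, large => 0.31
  | large, small => 0.30
  | small, large => 0.30
  | medium, medium => 0.26
  | medium, small => 0.26
  | small, medium => 0.26
  | small, small => 0.25

open Classical in
/-- Signed distance of `X` to the line through `A` and `B`: nonnegative if `X` is on the same side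
of that line as `C`, nonpositive otherwise. -/
noncomputable def signedDist (A B C X : Plane) : ℝ :=
  if line[ℝ, A, B].SSameSide X C then Metric.infDist X line[ℝ, A, B]
  else - Metric.infDist X line[ℝ, A, B]

/-- The potential `U_e(T)` of the edge `e` with endpoints the centers of `x` and `y`; the third
circle of the triangle is `z`, and `X` is the center of the support circle. -/
noncomputable def edgePotential (x y z : Circle) (X : Plane) : ℝ :=
  if dist x.center y.center < lConst x.size y.size then 0
  else qConst x.size y.size * signedDist x.center y.center z.center X

/-- The potential `U(T)`: the sum of the potentials of the vertices and of the edges. -/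
noncomputable def potential (a b c : Circle) (X : Plane) : ℝ :=
  vertexPotential a b c + vertexPotential b a c + vertexPotential c a b +
    (edgePotential a b c X + edgePotential b c a X + edgePotential a c b X)

end TernaryPacking

/-! Fix the sizes of the three circles and regard everything as a function of the edge lengths a, b,
c. The covered area is at most the sum of the three sectors r²/2 · angle, with equality in tight
triangles. The numbers V of a tight triangle add up to its excess, so E(T) minus the vertex
potentials is at least an explicit function, `gain`, which vanishes at the tight triangle
(`gain_le_excess`). It remains to show that `gain` dominates the edge potentials.

Since r²/2 · d + m|d| is the larger of the two numbers (r²/2 ± m)d, `gain` is the minimum of eight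
functions of the form δ · area − k₁α − k₂β − k₃γ + constant. Along each edge such a function
increases, then decreases, under a mild inequality between the edges. A lower bound on a box of edge
lengths therefore reduces to its eight vertices (`le_gain_of_vertices`).

If every edge is shorter than its threshold, the edge potentials vanish, and one box per triple of
sizes suffices. One of its vertices is the tight triangle, with gain exactly 0; the seven others are
checked numerically.

Otherwise the support circle is used. Its radius ρ lies in [0, s), by saturation
(`support_of_isFMTriangle`). Seen from its center X, the vertices are at distances ρ + r, so ρ and
two edges b, c meeting at a well-chosen vertex, the apex, determine the third edge and the three
signed distances (`ApexConfig`, `exists_apexConfig`). The compact domain of (ρ, b, c) is subdivided.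
On each small box the edge potentials are bounded above and compared with the vertex bound for
`gain`; boxes that contain no admissible configuration are discarded (`leafCheck`).

The numerical part is interval arithmetic on natural numbers, in units of 10⁻⁶, evaluated by the
kernel for all 27 ordered triples of sizes (`typeCheck_eq_true`). Angles enter as arctangents of
half-angle tangents, bounded by rational functions. The remainder is plane geometry: areas of
triangles and sectors, signed distances as cross products, and the choice of the apex. -/

namespace TernaryPacking

open Size

/-! ### Fixed point interval arithmetic -/

/-- An interval of nonnegative reals; the endpoints are in units of `10⁻⁶`. -/
structure NI where
  lo : ℕ
  hi : ℕ

/-- `force n k = k n`; the kernel evaluates `n` to a numeral first. -/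
def force {α : Type} (n : ℕ) (k : ℕ → α) : α := Nat.rec (k 0) (fun m _ => k (Nat.succ m)) n

def NI.force {α : Type} (I : NI) (k : NI → α) : α :=
  TernaryPacking.force I.lo fun l => TernaryPacking.force I.hi fun h => k ⟨l, h⟩

def natMax (m n : ℕ) : ℕ := cond (Nat.ble m n) n m

def mulLo (m n : ℕ) : ℕ := Nat.div (Nat.mul m n) 1000000

def mulHi (m n : ℕ) : ℕ := Nat.succ (Nat.div (Nat.mul m n) 1000000)

def newtonStep (n x : ℕ) : ℕ := Nat.div (Nat.add x (Nat.div n x)) 2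

/-- A Newton approximation of the square root of `n`, for `n` around `10¹²`. -/
def newtonSqrt (n : ℕ) : ℕ :=
  Nat.succ (newtonStep n (newtonStep n (newtonStep n (newtonStep n (newtonStep n
    (newtonStep n 1000000))))))

/-- An upper bound of the square root of `n`. -/
def sqrtUp (n : ℕ) : ℕ :=
  -- The Newton value is tested, not trusted. If the test failed, n + 1 would serve, so soundness
  -- needs no convergence argument.
  cond (Nat.ble n (Nat.mul (newtonSqrt n) (newtonSqrt n))) (newtonSqrt n) (Nat.succ n)

namespace NI

def con (n : ℕ) : NI := ⟨n, n⟩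

def one : NI := ⟨1000000, 1000000⟩

def add (I J : NI) : NI := ⟨Nat.add I.lo J.lo, Nat.add I.hi J.hi⟩

/-- Truncation at 0 keeps the lower endpoint valid only when the true difference is nonnegative;
`Mem.sub` asks for this. -/
def sub (I J : NI) : NI := ⟨Nat.sub I.lo J.hi, Nat.sub I.hi J.lo⟩

def mul (I J : NI) : NI := ⟨mulLo I.lo J.lo, mulHi I.hi J.hi⟩

def smul (n : ℕ) (I : NI) : NI := ⟨Nat.mul n I.lo, Nat.mul n I.hi⟩

def half (I : NI) : NI := ⟨Nat.div I.lo 2, Nat.succ (Nat.div I.hi 2)⟩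

def div (I J : NI) : NI :=
  ⟨Nat.div (Nat.mul I.lo 1000000) J.hi, Nat.succ (Nat.div (Nat.mul I.hi 1000000) J.lo)⟩

/-- The radicand is rescaled because 10⁶√x = √(10⁶x · 10⁶). Dividing N by an upper bound of √N gives
a lower bound of √N, so only upper bounds need certification. -/
def sqrt (I : NI) : NI :=
  ⟨Nat.div (Nat.mul I.lo 1000000) (sqrtUp (Nat.mul I.lo 1000000)), sqrtUp (Nat.mul I.hi 1000000)⟩

/-- The absolute value of the difference. -/
def dist (I J : NI) : NI :=
  ⟨natMax (Nat.sub I.lo J.hi) (Nat.sub J.lo I.hi), natMax (Nat.sub I.hi J.lo) (Nat.sub J.hi I.lo)⟩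

end NI

open NI

/-! ### The checker -/

/-- An upper bound of the arctangent. -/
def atanHi (t : ℕ) : ℕ :=
  let t2 := mul (con t) (con t)
  let t4 := mul t2 t2
  (div (mul (con t) (add (con 945000000) (add (smul 735 t2) (smul 64 t4))))
    (add (con 945000000) (add (smul 1050 t2) (smul 225 t4)))).hi

/-- A lower bound of the arctangent. -/
def atanLo (t : ℕ) : ℕ :=
  let t2 := mul (con t) (con t)
  let t4 := mul t2 t2
  (div (mul (con t) (add (con 105000000) (smul 55 t2)))
    (add (con 105000000) (add (smul 90 t2) (smul 9 t4)))).lo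

def radNI : Size → NI
  | large => ⟨1000000, 1000000⟩
  | medium => ⟨834306, 834307⟩
  | small => ⟨651050, 651051⟩

def mNat : Size → ℕ
  | large => 120000
  | medium => 30000
  | small => 30000

def lNat : Size → Size → ℕ
  | large, large => 2780000
  | large, medium => 2600000
  | medium, large => 2600000
  | large, small => 2320000
  | small, large => 2320000
  | medium, medium => 2420000
  | medium, small => 2140000
  | small, medium => 2140000
  | small, small => 1940000

def qNat : Size → Size → ℕ
  | large, large => 390000
  | large, medium => 310000
  | medium, large => 310000
  | large, small => 300000
  | small, large => 300000
  | medium, medium => 260000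
  | medium, small => 260000
  | small, medium => 260000
  | small, small => 250000

/-- The area of the tight triangle. -/
def tightAreaNI (x y z : NI) : NI := sqrt (mul (add (add x y) z) (mul x (mul y z)))

/-- The angle of the tight triangle at the center of the circle of radius `x`. -/
def tightAngleNI (x y z : NI) : NI :=
  let t := div (mul y z) (tightAreaNI x y z)
  ⟨Nat.mul 2 (atanLo t.lo), Nat.mul 2 (atanHi t.hi)⟩

def sectorNI (x y z : NI) : NI := half (mul (mul x x) (tightAngleNI x y z))

def covNI (x y z : NI) : NI :=
  add (add (sectorNI x y z) (sectorNI y x z)) (sectorNI z x y)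

def densityNI : NI :=
  div (add (add (smul 4 (covNI (radNI large) (radNI medium) (radNI small)))
      (covNI (radNI large) (radNI large) (radNI small)))
      (covNI (radNI medium) (radNI medium) (radNI large)))
    (add (add (smul 4 (tightAreaNI (radNI large) (radNI medium) (radNI small)))
      (tightAreaNI (radNI large) (radNI large) (radNI small)))
      (tightAreaNI (radNI medium) (radNI medium) (radNI large)))

/-- The data attached to one vertex of a triangle: the radius, bounds of `radius ^ 2 / 2 + m` and
`radius ^ 2 / 2 - m`, a lower bound of the tight angle, and the constants of the opposite edge. -/
structure VertexData where
  rad : NI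
  kp : ℕ
  km : ℕ
  angle : ℕ
  l : ℕ
  q : ℕ
  diff : NI

def vertexData (x y z : Size) : VertexData where
  rad := radNI x
  kp := Nat.add (half (mul (radNI x) (radNI x))).hi (mNat x)
  km := Nat.sub (half (mul (radNI x) (radNI x))).lo (mNat x)
  angle := (tightAngleNI (radNI x) (radNI y) (radNI z)).lo
  l := lNat y z
  q := qNat y z
  diff := mul (NI.dist (radNI y) (radNI z)) (NI.dist (radNI y) (radNI z))

def VertexData.force {α : Type} (d : VertexData) (k : VertexData → α) : α :=
  d.rad.force fun r => TernaryPacking.force d.kp fun kp => TernaryPacking.force d.km fun km =>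
  TernaryPacking.force d.angle fun t => TernaryPacking.force d.l fun l =>
  TernaryPacking.force d.q fun q => d.diff.force fun d => k ⟨r, kp, km, t, l, q, d⟩

structure TypeData where
  vx : VertexData
  vy : VertexData
  vz : VertexData
  density : ℕ
  tight : ℕ

def typeData (x y z : Size) : TypeData where
  vx := vertexData x y z
  vy := vertexData y x z
  vz := vertexData z x y
  density := densityNI.lo
  tight := (mul densityNI (tightAreaNI (radNI x) (radNI y) (radNI z))).hi

def TypeData.force {α : Type} (d : TypeData) (k : TypeData → α) : α :=
  d.vx.force fun x => d.vy.force fun y => d.vz.force fun z =>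
  TernaryPacking.force d.density fun e => TernaryPacking.force d.tight fun t => k ⟨x, y, z, e, t⟩

/-- Sufficient condition for `gain + un ≥ up` at all the triangles with edges in `a`, `b`, `c`. -/
def pointCheck (T : TypeData) (up un : ℕ) (a b c : NI) : Bool :=
  let p := sub (add b c) a
  let q := sub (add a c) b
  let w := sub (add a b) c
  -- Here k is a lower bound of four times the area, so α, β, γ are upper bounds of the angles. The
  -- vertex terms increase with the angles, so no lower bounds of these are needed.
  force (sqrt (mul (mul (add (add a b) c) p) (mul q w))).lo fun k =>
  and (Nat.ble 1 k)
  (force (Nat.mul 2 (atanHi (div (mul q w) (con k)).hi)) fun α =>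
  force (Nat.mul 2 (atanHi (div (mul p w) (con k)).hi)) fun β =>
  force (Nat.mul 2 (atanHi (div (mul p q) (con k)).hi)) fun γ =>
  Nat.ble
    (Nat.add (Nat.add T.tight up) (Nat.add (mulHi T.vx.kp (Nat.sub α T.vx.angle))
      (Nat.add (mulHi T.vy.kp (Nat.sub β T.vy.angle))
        (mulHi T.vz.kp (Nat.sub γ T.vz.angle)))))
    (Nat.add (Nat.add (Nat.div (mulLo T.density k) 4) un)
      (Nat.add (mulLo T.vx.km (Nat.sub T.vx.angle α))
      (Nat.add (mulLo T.vy.km (Nat.sub T.vy.angle β))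
        (mulLo T.vz.km (Nat.sub T.vz.angle γ))))))

/-- Sufficient condition for the quasi-concavity in the edge `a`. -/
def edgeCheck (density : ℕ) (y z : VertexData) (a b c : NI) : Bool :=
  -- The first test is the strict triangle inequality over the box. The second is 2|k − k'||b² − c²|
  -- ≤ δa⁴, where the maximum covers every choice of signs in k = r²/2 ± m.
  and (Nat.blt a.hi (Nat.add b.lo c.lo))
  (Nat.ble
    (Nat.mul 2 (mulHi (natMax (Nat.sub y.kp z.km) (Nat.sub z.kp y.km))
      (NI.dist (mul b b) (mul c c)).hi))
    (mulLo density (mul (mul (con a.lo) (con a.lo)) (mul (con a.lo) (con a.lo))).lo))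

def edgesCheck (T : TypeData) (a b c : NI) : Bool :=
  and (edgeCheck T.density T.vy T.vz a b c)
    (and (edgeCheck T.density T.vx T.vz b a c) (edgeCheck T.density T.vx T.vy c a b))

/-- Sufficient condition for `gain + un ≥ up` at all the vertices of a box, but the first one. -/
def verticesCheck (T : TypeData) (up un : ℕ) (a a' b b' c c' : NI) : Bool :=
  and (and (and (pointCheck T up un a b c') (pointCheck T up un a b' c))
      (and (pointCheck T up un a b' c') (pointCheck T up un a' b c)))
    (and (and (pointCheck T up un a' b c') (pointCheck T up un a' b' c))
      (pointCheck T up un a' b' c'))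

/-- Sufficient condition for `gain ≥ 0` when the three edges are short. -/
def shortCheck (T : TypeData) : Bool :=
  let a := add T.vy.rad T.vz.rad
  let b := add T.vx.rad T.vz.rad
  let c := add T.vx.rad T.vy.rad
  and (edgesCheck T ⟨a.lo, T.vx.l⟩ ⟨b.lo, T.vy.l⟩ ⟨c.lo, T.vz.l⟩)
    -- The omitted vertex is the tight triangle: its gain is exactly 0, which rounded arithmetic
    -- could not certify.
    (verticesCheck T 0 0 a (con T.vx.l) b (con T.vy.l) c (con T.vz.l))

/-- Sufficient condition for `gain + un ≥ up` on a box. -/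
def boxCheck (T : TypeData) (up un : ℕ) (a b c : NI) : Bool :=
  and (pointCheck T up un (con a.lo) (con b.lo) (con c.lo))
    (verticesCheck T up un (con a.lo) (con a.hi) (con b.lo) (con b.hi) (con c.lo) (con c.hi))

/-! ### The check for triangles with a long edge -/

/-- Upper bound of the potential of an edge, `m` being the product of the distances from its
endpoints to the center of the support circle. -/
def sideUp (v : VertexData) (m b : NI) : ℕ :=
  cond (Nat.blt b.hi v.l) 0
    (mulHi v.q (sqrtUp (Nat.mul 1000000 (Nat.sub m.hi
      (Nat.div (sub (mul (con (natMax b.lo v.l)) (con (natMax b.lo v.l))) v.diff).lo 4)))))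

/-- Bounds of the potential of the edge opposite to the apex. -/
def baseUp (v : VertexData) (m a p q : NI) : ℕ :=
  cond (Nat.blt a.hi v.l) 0 (cond (Nat.ble q.hi p.lo) 0
    (mulHi v.q (mulHi (Nat.sub q.hi p.lo) (sqrt m).hi)))

def baseUn (v : VertexData) (m a p q : NI) : ℕ :=
  cond (Nat.ble v.l a.lo) (mulLo v.q (mulLo 980000 (mulLo (Nat.sub p.lo q.hi) (sqrt m).lo))) 0

def finalCheck (T : TypeData) (uv uw vw a b c p q : NI) : Bool :=
  and (edgesCheck T a b c)
  (force (Nat.add (baseUp T.vx vw a p q) (Nat.add (sideUp T.vy uw b) (sideUp T.vz uv c))) fun up =>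
  force (baseUn T.vx vw a p q) fun un => boxCheck T up un a b c)

/-- The circle of `T.vx` is the apex, and `sb`, `sc` enclose the squares of the half-sines. A box is
accepted if it holds nothing to prove (a sine exceeding 1, the angle at X facing `a` not the
largest, `a` too short for disjoint circles, or three short edges), or else if `finalCheck`
succeeds. -/
def leafCheck (T : TypeData) (ρ b c : NI) : Bool :=
  let u := add ρ T.vx.rad
  let v := add ρ T.vy.rad
  let w := add ρ T.vz.rad
  (mul u v).force fun uv => (mul u w).force fun uw => (mul v w).force fun vw =>
  (div (sub (mul b b) T.vy.diff) (smul 4 uw)).force fun sb =>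
  (div (sub (mul c c) T.vz.diff) (smul 4 uv)).force fun sc =>
  or (or (Nat.blt 1000000 sb.lo) (Nat.blt 1000000 sc.lo))
  ((sub one sb).force fun cb => (sub one sc).force fun cc =>
  (sqrt (mul cb cc)).force fun p => (sqrt (mul sb sc)).force fun q =>
  or (or (Nat.blt (Nat.add p.hi (sqrt cb).hi) q.lo) (Nat.blt (Nat.add p.hi (sqrt cc).hi) q.lo))
  ((sqrt (add T.vx.diff (mul (smul 4 vw)
    (sub one (mul (NI.dist p q) (NI.dist p q)))))).force fun a =>
  let a0 := Nat.add T.vy.rad.lo T.vz.rad.lo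
  or (or (Nat.blt a.hi a0)
    (and (Nat.blt a.hi T.vx.l) (and (Nat.blt b.hi T.vy.l) (Nat.blt c.hi T.vz.l))))
  ((NI.mk (natMax a.lo a0) a.hi).force fun a => finalCheck T uv uw vw a b c p q)))

def mid (I : NI) : ℕ := Nat.div (Nat.add I.lo I.hi) 2

def width (I : NI) : ℕ := Nat.sub I.hi I.lo

/-- Adaptive subdivision. -/
def longCheck (T : TypeData) (n : ℕ) : NI → NI → NI → Bool :=
  Nat.rec (fun _ _ _ => false) (fun _ ih ρ b c =>
    or (leafCheck T ρ b c)
    -- The factor 2 reflects the initial ranges: b and c vary by about 2s, and ρ by s.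
    (cond (and (Nat.ble (width b) (Nat.mul 2 (width ρ))) (Nat.ble (width c) (Nat.mul 2 (width ρ))))
      (force (mid ρ) fun m => and (ih ⟨ρ.lo, m⟩ b c) (ih ⟨m, ρ.hi⟩ b c))
    (cond (Nat.ble (width c) (width b))
      (force (mid b) fun m => and (ih ρ ⟨b.lo, m⟩ c) (ih ρ ⟨m, b.hi⟩ c))
      (force (mid c) fun m => and (ih ρ b ⟨c.lo, m⟩) (ih ρ b ⟨m, c.hi⟩))))) n

/-- An edge joining circles of radii x and z tangent to the support circle is at most x + z + 2ρ,
with ρ < s; hence 1302102 = 2 · 651051. The number 30 only limits the depth of the subdivision. -/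
def typeCheck (x y z : Size) : Bool :=
  (typeData x y z).force fun T =>
  and (shortCheck T) (longCheck T 30 ⟨0, 651051⟩
    ⟨Nat.add T.vx.rad.lo T.vz.rad.lo, Nat.add (Nat.add T.vx.rad.hi T.vz.rad.hi) 1302102⟩
    ⟨Nat.add T.vx.rad.lo T.vy.rad.lo, Nat.add (Nat.add T.vx.rad.hi T.vy.rad.hi) 1302102⟩)

end TernaryPacking

namespace TernaryPacking

open Size Real

/-! ### Triangles given by their edges -/

/-- The strict triangle inequalities. -/
structure IsTri (a b c : ℝ) : Prop where
  ha : 0 < b + c - a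
  hb : 0 < a + c - b
  hc : 0 < a + b - c

/-- The area of the triangle with edges `a`, `b`, `c`. -/
noncomputable def heron (a b c : ℝ) : ℝ :=
  √((a + b + c) * (b + c - a) * ((a + c - b) * (a + b - c))) / 4

/-- The angle opposite to the edge `a`. -/
noncomputable def lawAngle (a b c : ℝ) : ℝ := arccos ((b ^ 2 + c ^ 2 - a ^ 2) / (2 * b * c))

theorem heron_swap (a b c : ℝ) : heron a c b = heron a b c := by
  unfold heron; congr 2; ring

theorem heron_swap' (a b c : ℝ) : heron b a c = heron a b c := by
  unfold heron; congr 2; ring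

theorem lawAngle_swap (a b c : ℝ) : lawAngle a c b = lawAngle a b c := by
  unfold lawAngle; congr 1; ring

namespace IsTri

variable {a b c : ℝ}

theorem swap (h : IsTri a b c) : IsTri b a c := ⟨h.hb, h.ha, by linarith [h.hc]⟩

theorem swap' (h : IsTri a b c) : IsTri a c b := ⟨by linarith [h.ha], h.hc, h.hb⟩

theorem pos (h : IsTri a b c) : 0 < a := by linarith [h.hb, h.hc]

theorem heron_pos (h : IsTri a b c) : 0 < heron a b c := by
  have := h.pos
  have := h.swap.pos
  have := h.swap'.swap.pos
  have := mul_pos (mul_pos (show 0 < a + b + c by positivity) h.ha) (mul_pos h.hb h.hc)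
  unfold heron
  positivity

theorem heron_sq (h : IsTri a b c) :
    16 * heron a b c ^ 2 = 4 * b ^ 2 * c ^ 2 - (b ^ 2 + c ^ 2 - a ^ 2) ^ 2 := by
  have := h.pos
  have := h.swap.pos
  have := h.swap'.swap.pos
  have := mul_pos (mul_pos (show 0 < a + b + c by positivity) h.ha) (mul_pos h.hb h.hc)
  unfold heron
  rw [div_pow, sq_sqrt this.le]
  ring

theorem sin_lawAngle (h : IsTri a b c) :
    √(1 - ((b ^ 2 + c ^ 2 - a ^ 2) / (2 * b * c)) ^ 2) = 2 * heron a b c / (b * c) := by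
  have hb := h.swap.pos
  have hc := h.swap'.swap.pos
  have hp := h.heron_pos
  rw [sqrt_eq_iff_mul_self_eq_of_pos (by positivity)]
  have := h.heron_sq
  field_simp
  linarith

theorem cos_sq_lt (h : IsTri a b c) : ((b ^ 2 + c ^ 2 - a ^ 2) / (2 * b * c)) ^ 2 < 1 := by
  have hb := h.swap.pos
  have hc := h.swap'.swap.pos
  have hp := h.heron_pos
  have := h.heron_sq
  rw [div_pow, div_lt_one (by positivity)]
  nlinarith [sq_pos_of_pos hp]

theorem hasDerivAt_heron (h : IsTri a b c) :
    HasDerivAt (fun t => heron t b c) (a * (b ^ 2 + c ^ 2 - a ^ 2) / (8 * heron a b c)) a := by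
  have hb := h.swap.pos
  have hc := h.swap'.swap.pos
  have ha := h.pos
  have hp := h.heron_pos
  have h0 := mul_pos (mul_pos (show 0 < a + b + c by positivity) h.ha) (mul_pos h.hb h.hc)
  have hid := hasDerivAt_id a
  have h1 : HasDerivAt (fun t => 4 * b ^ 2 * c ^ 2 - (b ^ 2 + c ^ 2 - t ^ 2) ^ 2)
      (4 * a * (b ^ 2 + c ^ 2 - a ^ 2)) a := by
    have := (((hid.pow 2).const_sub (b ^ 2 + c ^ 2)).pow 2).const_sub (4 * b ^ 2 * c ^ 2)
    refine this.congr_deriv ?_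
    simp
    ring
  have h2 : (fun t => heron t b c) =
      fun t => √(4 * b ^ 2 * c ^ 2 - (b ^ 2 + c ^ 2 - t ^ 2) ^ 2) / 4 := by
    funext t; unfold heron; congr 2; ring
  have h3 := h.heron_sq
  have h4 : heron a b c = √(4 * b ^ 2 * c ^ 2 - (b ^ 2 + c ^ 2 - a ^ 2) ^ 2) / 4 := congrFun h2 a
  rw [h2]
  refine ((h1.sqrt (by nlinarith [sq_pos_of_pos hp])).div_const 4).congr_deriv ?_
  rw [h4] at hp ⊢
  set s := √(4 * b ^ 2 * c ^ 2 - (b ^ 2 + c ^ 2 - a ^ 2) ^ 2)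
  have : 0 < s := by linarith
  field_simp
  ring

theorem hasDerivAt_lawAngle (h : IsTri a b c) :
    HasDerivAt (fun t => lawAngle t b c) (a / (2 * heron a b c)) a := by
  have hb := h.swap.pos
  have hc := h.swap'.swap.pos
  have ha := h.pos
  have hp := h.heron_pos
  have hlt := abs_lt.1 ((sq_lt_one_iff_abs_lt_one _).1 h.cos_sq_lt)
  have h1 : HasDerivAt (fun t => (b ^ 2 + c ^ 2 - t ^ 2) / (2 * b * c)) (-(2 * a) / (2 * b * c)) a := by
    refine ((((hasDerivAt_id a).pow 2).const_sub (b ^ 2 + c ^ 2)).div_const _).congr_deriv ?_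
    simp
  refine ((hasDerivAt_arccos hlt.1.ne' hlt.2.ne).comp a h1).congr_deriv ?_
  rw [h.sin_lawAngle]
  field_simp

theorem hasDerivAt_lawAngle' (h : IsTri a b c) :
    HasDerivAt (fun t => lawAngle b t c)
      (-(a ^ 2 + b ^ 2 - c ^ 2) / (4 * a * heron a b c)) a := by
  have hb := h.swap.pos
  have hc := h.swap'.swap.pos
  have ha := h.pos
  have hp := h.heron_pos
  have hlt := abs_lt.1 ((sq_lt_one_iff_abs_lt_one _).1 h.swap.cos_sq_lt)
  have h1 : HasDerivAt (fun t => (t ^ 2 + c ^ 2 - b ^ 2) / (2 * t * c))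
      ((a ^ 2 + b ^ 2 - c ^ 2) / (2 * a ^ 2 * c)) a := by
    have hid := hasDerivAt_id a
    refine ((((hid.pow 2).add_const (c ^ 2)).sub_const (b ^ 2)).div
      ((hid.const_mul 2).mul_const c) (by simp [ha.ne', hc.ne'])).congr_deriv ?_
    simp
    field_simp
    ring
  refine ((hasDerivAt_arccos hlt.1.ne' hlt.2.ne).comp a h1).congr_deriv ?_
  rw [h.swap.sin_lawAngle, heron_swap']
  field_simp
  ring

end IsTri

/-! ### Quasi-concavity in each edge -/

/-- A linear combination of the area and of the angles. -/
noncomputable def combo (δ k₁ k₂ k₃ a b c : ℝ) : ℝ :=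
  δ * heron a b c - k₁ * lawAngle a b c - k₂ * lawAngle b a c - k₃ * lawAngle c a b

theorem combo_swap (δ k₁ k₂ k₃ a b c : ℝ) : combo δ k₂ k₁ k₃ b a c = combo δ k₁ k₂ k₃ a b c := by
  unfold combo
  rw [heron_swap', lawAngle_swap c]
  ring

theorem combo_swap' (δ k₁ k₂ k₃ a b c : ℝ) : combo δ k₁ k₃ k₂ a c b = combo δ k₁ k₂ k₃ a b c := by
  unfold combo
  rw [heron_swap, lawAngle_swap a]
  ring

/-- The positive factor a / (2 · area) is taken out so that the sign is that of the bracket, an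
elementary function of a². -/
theorem hasDerivAt_combo (δ k₁ k₂ k₃ : ℝ) {a b c : ℝ} (h : IsTri a b c) :
    HasDerivAt (fun t => combo δ k₁ k₂ k₃ t b c)
      (a / (2 * heron a b c) * (δ * (b ^ 2 + c ^ 2 - a ^ 2) / 4 - k₁ + (k₂ + k₃) / 2
        + (k₂ - k₃) * (b ^ 2 - c ^ 2) / (2 * a ^ 2))) a := by
  have hp := h.heron_pos
  have ha := h.pos
  have h3 : HasDerivAt (fun t => lawAngle c t b)
      (-(a ^ 2 + c ^ 2 - b ^ 2) / (4 * a * heron a b c)) a := by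
    have := h.swap'.hasDerivAt_lawAngle'
    rwa [heron_swap] at this
  refine ((((h.hasDerivAt_heron.const_mul δ).sub (h.hasDerivAt_lawAngle.const_mul k₁)).sub
    (h.hasDerivAt_lawAngle'.const_mul k₂)).sub (h3.const_mul k₃)).congr_deriv ?_
  field_simp
  ring

/-- A function whose derivative changes its sign at most once, from plus to minus, is at least
the minimum of its values at the endpoints. -/
theorem le_of_deriv_mul_antitone {f g p : ℝ → ℝ} {a₁ a₂ a t : ℝ} (h1 : a₁ ≤ a) (h2 : a ≤ a₂)
    (hf : ∀ x ∈ Set.Icc a₁ a₂, HasDerivAt f (p x * g x) x) (hp : ∀ x ∈ Set.Icc a₁ a₂, 0 ≤ p x)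
    (hg : AntitoneOn g (Set.Icc a₁ a₂)) (ht1 : t ≤ f a₁) (ht2 : t ≤ f a₂) : t ≤ f a := by
  have ha : a ∈ Set.Icc a₁ a₂ := ⟨h1, h2⟩
  rcases le_total 0 (g a) with h | h
  · have hm : MonotoneOn f (Set.Icc a₁ a) := by
      refine monotoneOn_of_hasDerivWithinAt_nonneg (f' := fun x => p x * g x) (convex_Icc _ _)
        (fun x hx => (hf x ⟨hx.1, hx.2.trans h2⟩).continuousAt.continuousWithinAt) ?_ ?_
      · intro x hx
        rw [interior_Icc] at hx
        exact (hf x ⟨hx.1.le, hx.2.le.trans h2⟩).hasDerivWithinAt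
      · intro x hx
        rw [interior_Icc] at hx
        have hx' : x ∈ Set.Icc a₁ a₂ := ⟨hx.1.le, hx.2.le.trans h2⟩
        exact mul_nonneg (hp x hx') (h.trans (hg hx' ha hx.2.le))
    exact ht1.trans (hm ⟨le_rfl, h1⟩ ⟨h1, le_rfl⟩ h1)
  · have hm : AntitoneOn f (Set.Icc a a₂) := by
      refine antitoneOn_of_hasDerivWithinAt_nonpos (f' := fun x => p x * g x) (convex_Icc _ _)
        (fun x hx => (hf x ⟨h1.trans hx.1, hx.2⟩).continuousAt.continuousWithinAt) ?_ ?_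
      · intro x hx
        rw [interior_Icc] at hx
        exact (hf x ⟨h1.trans hx.1.le, hx.2.le⟩).hasDerivWithinAt
      · intro x hx
        rw [interior_Icc] at hx
        have hx' : x ∈ Set.Icc a₁ a₂ := ⟨h1.trans hx.1.le, hx.2.le⟩
        exact mul_nonpos_of_nonneg_of_nonpos (hp x hx') ((hg ha hx' hx.1.le).trans h)
    exact ht2.trans (hm ⟨le_rfl, h2⟩ ⟨h2, le_rfl⟩ h2)

/-- With D = (k₂ − k₃)(b² − c²), the bracket of `hasDerivAt_combo` has derivative −δa/2 − D/a³,
which is nonpositive as soon as −2D ≤ δa⁴. This is where `hδ` comes from; it is enough to have it at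
the left endpoint. -/
theorem le_combo_of_endpoints {δ k₁ k₂ k₃ a₁ a₂ a b c t : ℝ} (h1 : a₁ ≤ a) (h2 : a ≤ a₂)
    (hδ : 2 * (|k₂ - k₃| * |b ^ 2 - c ^ 2|) ≤ δ * a₁ ^ 4) (hδ0 : 0 ≤ δ)
    (ht1 : IsTri a₁ b c) (ht2 : IsTri a₂ b c)
    (h3 : t ≤ combo δ k₁ k₂ k₃ a₁ b c) (h4 : t ≤ combo δ k₁ k₂ k₃ a₂ b c) :
    t ≤ combo δ k₁ k₂ k₃ a b c := by
  have htri : ∀ x ∈ Set.Icc a₁ a₂, IsTri x b c := fun x hx =>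
    ⟨by linarith [ht2.ha, hx.2], by linarith [ht1.hb, hx.1], by linarith [ht1.hc, hx.1]⟩
  refine le_of_deriv_mul_antitone (f := fun a => combo δ k₁ k₂ k₃ a b c) h1 h2
    (fun x hx => hasDerivAt_combo δ k₁ k₂ k₃ (htri x hx)) (fun x hx => ?_) ?_ h3 h4
  · have := (htri x hx).heron_pos
    have := (htri x hx).pos
    positivity
  · intro x hx y hy hxy
    have h0 := ht1.pos
    have hx0 := (htri x hx).pos
    have hy0 := (htri y hy).pos
    set D := (k₂ - k₃) * (b ^ 2 - c ^ 2) with hD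
    have hD1 : -(2 * D) ≤ δ * a₁ ^ 4 := by
      have := neg_abs_le D
      rw [hD, abs_mul] at this
      linarith
    have hm : a₁ ^ 4 ≤ x ^ 2 * y ^ 2 := by
      have e : a₁ ^ 4 = a₁ ^ 2 * a₁ ^ 2 := by ring
      rw [e]
      have := hx.1
      have := hy.1
      gcongr
    have hm2 : -(2 * D) ≤ δ * (x ^ 2 * y ^ 2) := hD1.trans (mul_le_mul_of_nonneg_left hm hδ0)
    have hs : 0 ≤ y ^ 2 - x ^ 2 := by nlinarith
    have key : D / (2 * y ^ 2) - D / (2 * x ^ 2) ≤ δ * (y ^ 2 - x ^ 2) / 4 := by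
      have : D / (2 * y ^ 2) - D / (2 * x ^ 2) = -(2 * D) * (y ^ 2 - x ^ 2) / (4 * (x ^ 2 * y ^ 2)) := by
        field_simp
        ring
      rw [this, div_le_div_iff₀ (by positivity) (by norm_num)]
      nlinarith [mul_le_mul_of_nonneg_right hm2 hs]
    have : δ * (b ^ 2 + c ^ 2 - x ^ 2) / 4 - δ * (b ^ 2 + c ^ 2 - y ^ 2) / 4
      = δ * (y ^ 2 - x ^ 2) / 4 := by ring
    show _ + D / (2 * y ^ 2) ≤ _ + D / (2 * x ^ 2)
    linarith

/-- The conditions for quasi-concavity in each edge on a box. -/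
structure BoxCond (δ k₁ k₂ k₃ a₁ a₂ b₁ b₂ c₁ c₂ : ℝ) : Prop where
  tri_a : a₂ < b₁ + c₁
  tri_b : b₂ < a₁ + c₁
  tri_c : c₂ < a₁ + b₁
  quasi_a : ∀ b ∈ Set.Icc b₁ b₂, ∀ c ∈ Set.Icc c₁ c₂,
    2 * (|k₂ - k₃| * |b ^ 2 - c ^ 2|) ≤ δ * a₁ ^ 4
  quasi_b : ∀ a ∈ Set.Icc a₁ a₂, ∀ c ∈ Set.Icc c₁ c₂,
    2 * (|k₁ - k₃| * |a ^ 2 - c ^ 2|) ≤ δ * b₁ ^ 4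
  quasi_c : ∀ a ∈ Set.Icc a₁ a₂, ∀ b ∈ Set.Icc b₁ b₂,
    2 * (|k₁ - k₂| * |a ^ 2 - b ^ 2|) ≤ δ * c₁ ^ 4

/-- The bound spreads from the vertices to the edges of the box parallel to the first axis, then to
rectangles, then to the whole box, by quasi-concavity in one variable at a time. -/
theorem le_combo_of_vertices {δ k₁ k₂ k₃ a₁ a₂ b₁ b₂ c₁ c₂ a b c t : ℝ}
    (h : BoxCond δ k₁ k₂ k₃ a₁ a₂ b₁ b₂ c₁ c₂) (hδ0 : 0 ≤ δ)
    (ha : a ∈ Set.Icc a₁ a₂) (hb : b ∈ Set.Icc b₁ b₂) (hc : c ∈ Set.Icc c₁ c₂)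
    (hv : ∀ a ∈ ({a₁, a₂} : Set ℝ), ∀ b ∈ ({b₁, b₂} : Set ℝ), ∀ c ∈ ({c₁, c₂} : Set ℝ),
      t ≤ combo δ k₁ k₂ k₃ a b c) :
    t ≤ combo δ k₁ k₂ k₃ a b c := by
  have htri : ∀ a ∈ Set.Icc a₁ a₂, ∀ b ∈ Set.Icc b₁ b₂, ∀ c ∈ Set.Icc c₁ c₂, IsTri a b c :=
    fun a ha b hb c hc => ⟨by linarith [h.tri_a, ha.2, hb.1, hc.1],
      by linarith [h.tri_b, ha.1, hb.2, hc.1], by linarith [h.tri_c, ha.1, hb.1, hc.2]⟩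
  have ha1 : a₁ ∈ Set.Icc a₁ a₂ := ⟨le_rfl, ha.1.trans ha.2⟩
  have ha2 : a₂ ∈ Set.Icc a₁ a₂ := ⟨ha.1.trans ha.2, le_rfl⟩
  have hb1 : b₁ ∈ Set.Icc b₁ b₂ := ⟨le_rfl, hb.1.trans hb.2⟩
  have hb2 : b₂ ∈ Set.Icc b₁ b₂ := ⟨hb.1.trans hb.2, le_rfl⟩
  have hc1 : c₁ ∈ Set.Icc c₁ c₂ := ⟨le_rfl, hc.1.trans hc.2⟩
  have hc2 : c₂ ∈ Set.Icc c₁ c₂ := ⟨hc.1.trans hc.2, le_rfl⟩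
  have stepA : ∀ b ∈ ({b₁, b₂} : Set ℝ), ∀ c ∈ ({c₁, c₂} : Set ℝ),
      t ≤ combo δ k₁ k₂ k₃ a b c := by
    intro b hb' c hc'
    have hb : b ∈ Set.Icc b₁ b₂ := by rcases hb' with rfl | rfl <;> assumption
    have hc : c ∈ Set.Icc c₁ c₂ := by rcases hc' with rfl | rfl <;> assumption
    exact le_combo_of_endpoints ha.1 ha.2 (h.quasi_a b hb c hc) hδ0 (htri _ ha1 _ hb _ hc)
      (htri _ ha2 _ hb _ hc) (hv _ (by simp) _ hb' _ hc') (hv _ (by simp) _ hb' _ hc')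
  have stepB : ∀ c ∈ ({c₁, c₂} : Set ℝ), t ≤ combo δ k₁ k₂ k₃ a b c := by
    intro c hc'
    have hc : c ∈ Set.Icc c₁ c₂ := by rcases hc' with rfl | rfl <;> assumption
    have e := stepA b₁ (by simp) c hc'
    have e' := stepA b₂ (by simp) c hc'
    rw [← combo_swap] at e e' ⊢
    exact le_combo_of_endpoints hb.1 hb.2 (h.quasi_b a ha c hc) hδ0 (htri _ ha _ hb1 _ hc).swap
      (htri _ ha _ hb2 _ hc).swap e e'
  have e := stepB c₁ (by simp)
  have e' := stepB c₂ (by simp)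
  rw [← combo_swap', ← combo_swap] at e e' ⊢
  exact le_combo_of_endpoints hc.1 hc.2 (h.quasi_c a ha b hb) hδ0 (htri _ ha _ hb _ hc1).swap'.swap
    (htri _ ha _ hb _ hc2).swap'.swap e e'

/-! ### The gain, a minimum of eight combinations -/

/-- The contribution of a vertex of size `x` to the gain. -/
noncomputable def vertexTerm (x y z : Size) (a b c : ℝ) : ℝ :=
  x.radius ^ 2 / 2 * (lawAngle a b c -
      lawAngle (y.radius + z.radius) (x.radius + z.radius) (x.radius + y.radius)) +
    mConst x * |lawAngle a b c -
      lawAngle (y.radius + z.radius) (x.radius + z.radius) (x.radius + y.radius)|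

noncomputable def tightHeron (x y z : Size) : ℝ :=
  heron (y.radius + z.radius) (x.radius + z.radius) (x.radius + y.radius)

/-- The excess minus the vertex potentials, as a function of the edges. -/
noncomputable def gain (x y z : Size) (a b c : ℝ) : ℝ :=
  targetDensity * (heron a b c - tightHeron x y z) - vertexTerm x y z a b c -
    vertexTerm y x z b a c - vertexTerm z x y c a b

theorem gain_swap (x y z : Size) (a b c : ℝ) : gain y x z b a c = gain x y z a b c := by
  unfold gain vertexTerm tightHeron
  rw [heron_swap' b, lawAngle_swap c, heron_swap' (x.radius + z.radius), lawAngle_swap (y.radius + x.radius)]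
  simp only [add_comm y.radius x.radius]
  ring

theorem gain_swap' (x y z : Size) (a b c : ℝ) : gain x z y a c b = gain x y z a b c := by
  unfold gain vertexTerm tightHeron
  rw [heron_swap a, lawAngle_swap a, add_comm z.radius y.radius,
    lawAngle_swap (y.radius + z.radius), heron_swap (y.radius + z.radius)]
  ring

theorem gain_tight (x y z : Size) :
    gain x y z (y.radius + z.radius) (x.radius + z.radius) (x.radius + y.radius) = 0 := by
  unfold gain vertexTerm tightHeron
  simp [add_comm]

theorem mConst_pos (x : Size) : 0 < mConst x := by
  cases x <;> norm_num [mConst]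

/-- Signs k = r²/2 ± m are chosen to be optimal at the given point, where the gain equals the
combination plus a constant. Elsewhere, in particular at the vertices, the gain is at most that
combination plus the constant, so the hypothesis `hv` transfers to it. -/
theorem le_gain_of_vertices {x y z : Size} {a₁ a₂ b₁ b₂ c₁ c₂ a b c t : ℝ}
    (h : ∀ k₁ k₂ k₃ : ℝ, |k₁ - x.radius ^ 2 / 2| = mConst x → |k₂ - y.radius ^ 2 / 2| = mConst y →
      |k₃ - z.radius ^ 2 / 2| = mConst z →
      BoxCond targetDensity k₁ k₂ k₃ a₁ a₂ b₁ b₂ c₁ c₂) (hδ0 : 0 ≤ targetDensity)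
    (ha : a ∈ Set.Icc a₁ a₂) (hb : b ∈ Set.Icc b₁ b₂) (hc : c ∈ Set.Icc c₁ c₂)
    (hv : ∀ a ∈ ({a₁, a₂} : Set ℝ), ∀ b ∈ ({b₁, b₂} : Set ℝ), ∀ c ∈ ({c₁, c₂} : Set ℝ),
      t ≤ gain x y z a b c) :
    t ≤ gain x y z a b c := by
  have hk : ∀ (v : Size) (d : ℝ), ∃ k : ℝ, |k - v.radius ^ 2 / 2| = mConst v ∧
      (v.radius ^ 2 / 2 * d + mConst v * |d| = k * d) ∧
      ∀ e, k * e ≤ v.radius ^ 2 / 2 * e + mConst v * |e| := by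
    intro v d
    have hm := mConst_pos v
    rcases le_total 0 d with hd | hd
    · refine ⟨v.radius ^ 2 / 2 + mConst v, ?_, ?_, fun e => ?_⟩
      · rw [add_sub_cancel_left, abs_of_pos hm]
      · rw [abs_of_nonneg hd]; ring
      · nlinarith [le_abs_self e]
    · refine ⟨v.radius ^ 2 / 2 - mConst v, ?_, ?_, fun e => ?_⟩
      · rw [sub_sub_cancel_left, abs_neg, abs_of_pos hm]
      · rw [abs_of_nonpos hd]; ring
      · nlinarith [neg_abs_le e]
  obtain ⟨k₁, e1, f1, g1⟩ := hk x (lawAngle a b c -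
      lawAngle (y.radius + z.radius) (x.radius + z.radius) (x.radius + y.radius))
  obtain ⟨k₂, e2, f2, g2⟩ := hk y (lawAngle b a c -
      lawAngle (x.radius + z.radius) (y.radius + z.radius) (y.radius + x.radius))
  obtain ⟨k₃, e3, f3, g3⟩ := hk z (lawAngle c a b -
      lawAngle (x.radius + y.radius) (z.radius + y.radius) (z.radius + x.radius))
  set s := k₁ * lawAngle (y.radius + z.radius) (x.radius + z.radius) (x.radius + y.radius) +
    k₂ * lawAngle (x.radius + z.radius) (y.radius + z.radius) (y.radius + x.radius) +
    k₃ * lawAngle (x.radius + y.radius) (z.radius + y.radius) (z.radius + x.radius) -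
    targetDensity * tightHeron x y z with hs
  have hle : ∀ a b c, gain x y z a b c ≤ combo targetDensity k₁ k₂ k₃ a b c + s := by
    intro a b c
    unfold gain vertexTerm combo
    linarith [g1 (lawAngle a b c -
      lawAngle (y.radius + z.radius) (x.radius + z.radius) (x.radius + y.radius)),
      g2 (lawAngle b a c -
      lawAngle (x.radius + z.radius) (y.radius + z.radius) (y.radius + x.radius)),
      g3 (lawAngle c a b -
      lawAngle (x.radius + y.radius) (z.radius + y.radius) (z.radius + x.radius))]
  have heq : gain x y z a b c = combo targetDensity k₁ k₂ k₃ a b c + s := by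
    unfold gain vertexTerm combo
    rw [f1, f2, f3]
    ring
  have := le_combo_of_vertices (t := t - s) (h k₁ k₂ k₃ e1 e2 e3) hδ0 ha hb hc
    fun a ha b hb c hc => by linarith [hv a ha b hb c hc, hle a b c]
  linarith

end TernaryPacking

namespace TernaryPacking

open Size Real

/-! ### Soundness of the interval arithmetic -/

/-- `x` lies in the interval `I`. -/
def NI.Mem (I : NI) (x : ℝ) : Prop := (I.lo : ℝ) ≤ 1000000 * x ∧ 1000000 * x ≤ (I.hi : ℝ)

theorem natMax_eq (m n : ℕ) : natMax m n = max m n := by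
  unfold natMax
  by_cases h : m ≤ n
  · rw [Nat.ble_eq_true_of_le h, max_eq_right h, cond_true]
  · rw [Bool.eq_false_iff.2 fun h' => h (Nat.le_of_ble_eq_true h'), max_eq_left (by omega), cond_false]

theorem force_eq {α : Type} (n : ℕ) (k : ℕ → α) : force n k = k n := by cases n <;> rfl

theorem NI.force_eq {α : Type} (I : NI) (k : NI → α) : I.force k = k I := by
  unfold NI.force; simp only [TernaryPacking.force_eq]

theorem natDiv_le (m n : ℕ) : ((Nat.div m n : ℕ) : ℝ) ≤ m / n := Nat.cast_div_le

theorem le_succ_natDiv (m : ℕ) {n : ℕ} (hn : 0 < n) :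
    (m : ℝ) / n ≤ ((Nat.succ (Nat.div m n) : ℕ) : ℝ) := by
  rw [div_le_iff₀ (by exact_mod_cast hn), mul_comm]
  exact_mod_cast (Nat.lt_mul_div_succ m hn).le

theorem mulLo_le {m n : ℕ} {x y : ℝ} (hm : (m : ℝ) ≤ 1000000 * x) (hn : (n : ℝ) ≤ 1000000 * y) :
    (mulLo m n : ℝ) ≤ 1000000 * (x * y) := by
  refine (natDiv_le _ _).trans ?_
  rw [div_le_iff₀ (by norm_num)]
  have : ((Nat.mul m n : ℕ) : ℝ) = m * n := Nat.cast_mul m n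
  have hx := (Nat.cast_nonneg m).trans hm
  have := mul_le_mul hm hn (Nat.cast_nonneg n) hx
  push_cast
  linarith

theorem le_mulHi {m n : ℕ} {x y : ℝ} (hm : 1000000 * x ≤ m) (hn : 1000000 * y ≤ n) (hy : 0 ≤ y) :
    1000000 * (x * y) ≤ mulHi m n := by
  refine le_trans ?_ (le_succ_natDiv _ (by norm_num))
  rw [le_div_iff₀ (by norm_num)]
  have : ((Nat.mul m n : ℕ) : ℝ) = m * n := Nat.cast_mul m n
  have := mul_le_mul hm hn (by positivity) (Nat.cast_nonneg m)
  push_cast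
  linarith

theorem natSub_le {m n : ℕ} {x y : ℝ} (hm : (m : ℝ) ≤ x) (hn : y ≤ n) (h : 0 ≤ x - y) :
    ((Nat.sub m n : ℕ) : ℝ) ≤ x - y := by
  rcases le_total n m with hnm | hnm
  · have : ((Nat.sub m n : ℕ) : ℝ) = m - n := Nat.cast_sub hnm
    linarith
  · have : Nat.sub m n = 0 := Nat.sub_eq_zero_of_le hnm
    rw [this]
    simpa using h

theorem le_natSub {m n : ℕ} {x y : ℝ} (hm : x ≤ m) (hn : (n : ℝ) ≤ y) :
    x - y ≤ ((Nat.sub m n : ℕ) : ℝ) := by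
  have : (m : ℝ) ≤ n + ((Nat.sub m n : ℕ) : ℝ) := by exact_mod_cast (le_add_tsub : m ≤ n + (m - n))
  linarith

theorem le_sqrtUp_sq (n : ℕ) : n ≤ sqrtUp n * sqrtUp n := by
  unfold sqrtUp
  cases h : Nat.ble n (Nat.mul (newtonSqrt n) (newtonSqrt n))
  · rw [cond_false]
    nlinarith [Nat.succ_eq_add_one n]
  · exact Nat.le_of_ble_eq_true h

theorem sqrt_le_sqrtUp {x : ℝ} {n : ℕ} (h : x ≤ n) : √x ≤ sqrtUp n := by
  have := le_sqrtUp_sq n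
  refine sqrt_le_iff.2 ⟨Nat.cast_nonneg _, h.trans ?_⟩
  rw [sq]
  exact_mod_cast this

namespace NI

variable {I J : NI} {x y : ℝ}

theorem mem_con (n : ℕ) : (con n).Mem (n / 1000000) := by
  unfold Mem con
  constructor <;> simp only <;> linarith

theorem mem_con_mul (n : ℕ) (h : (n : ℝ) = 1000000 * x) : (con n).Mem x := ⟨h.le, h.ge⟩

theorem mem_one : one.Mem 1 := by
  unfold Mem one
  norm_num

theorem Mem.add (hx : I.Mem x) (hy : J.Mem y) : (I.add J).Mem (x + y) := by
  unfold Mem NI.add at *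
  have e1 : ((Nat.add I.lo J.lo : ℕ) : ℝ) = I.lo + J.lo := Nat.cast_add _ _
  have e2 : ((Nat.add I.hi J.hi : ℕ) : ℝ) = I.hi + J.hi := Nat.cast_add _ _
  constructor <;> simp only [e1, e2] <;> linarith [hx.1, hx.2, hy.1, hy.2]

theorem Mem.sub (hx : I.Mem x) (hy : J.Mem y) (h : 0 ≤ x - y) : (I.sub J).Mem (x - y) := by
  have h1 := natSub_le hx.1 hy.2 (by linarith)
  have h2 := le_natSub hx.2 hy.1
  constructor <;> simp only [NI.sub] <;> linarith

theorem Mem.mul (hx : I.Mem x) (hy : J.Mem y) (h : 0 ≤ y) : (I.mul J).Mem (x * y) :=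
  ⟨mulLo_le hx.1 hy.1, le_mulHi hx.2 hy.2 h⟩

theorem Mem.smul (n : ℕ) (hx : I.Mem x) : (I.smul n).Mem (n * x) := by
  have e1 : ((Nat.mul n I.lo : ℕ) : ℝ) = n * I.lo := Nat.cast_mul _ _
  have e2 : ((Nat.mul n I.hi : ℕ) : ℝ) = n * I.hi := Nat.cast_mul _ _
  have hn : (0 : ℝ) ≤ n := Nat.cast_nonneg n
  constructor <;> simp only [NI.smul, e1, e2]
  · linarith [mul_le_mul_of_nonneg_left hx.1 hn]
  · linarith [mul_le_mul_of_nonneg_left hx.2 hn]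

theorem Mem.half (hx : I.Mem x) : I.half.Mem (x / 2) := by
  have h1 := natDiv_le I.lo 2
  have h2 := le_succ_natDiv I.hi (n := 2) (by norm_num)
  push_cast at h1
  rw [Nat.cast_ofNat] at h2
  constructor <;> simp only [NI.half] <;> linarith [hx.1, hx.2]

theorem Mem.div (hx : I.Mem x) (hy : J.Mem y) (h : 0 ≤ x) (hJ : 0 < J.lo) :
    (I.div J).Mem (x / y) := by
  have hJ' : (0 : ℝ) < J.lo := by exact_mod_cast hJ
  have hy0 : 0 < y := by linarith [hy.1]
  have hJh : (0 : ℝ) < J.hi := by linarith [hy.2]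
  have e1 : ((Nat.mul I.lo 1000000 : ℕ) : ℝ) = I.lo * 1000000 := by
    exact_mod_cast Nat.cast_mul I.lo 1000000
  have e2 : ((Nat.mul I.hi 1000000 : ℕ) : ℝ) = I.hi * 1000000 := by
    exact_mod_cast Nat.cast_mul I.hi 1000000
  constructor
  · refine (natDiv_le _ _).trans ?_
    rw [e1, div_le_iff₀ hJh]
    have : 1000000 * (x / y) * J.hi = 1000000 * x * (J.hi / y) := by ring
    rw [this]
    have h3 : (1000000 : ℝ) ≤ J.hi / y := by rw [le_div_iff₀ hy0]; exact hy.2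
    exact mul_le_mul hx.1 h3 (by norm_num) (by linarith)
  · refine le_trans ?_ (le_succ_natDiv _ hJ)
    rw [e2, le_div_iff₀ hJ']
    have : 1000000 * (x / y) * J.lo = 1000000 * x * (J.lo / y) := by ring
    rw [this]
    have h3 : J.lo / y ≤ (1000000 : ℝ) := by rw [div_le_iff₀ hy0]; exact hy.1
    exact mul_le_mul hx.2 h3 (by positivity) (Nat.cast_nonneg _)

theorem Mem.sqrt (hx : I.Mem x) : I.sqrt.Mem √x := by
  have e1 : ((Nat.mul I.lo 1000000 : ℕ) : ℝ) = I.lo * 1000000 := by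
    exact_mod_cast Nat.cast_mul I.lo 1000000
  have e2 : ((Nat.mul I.hi 1000000 : ℕ) : ℝ) = I.hi * 1000000 := by
    exact_mod_cast Nat.cast_mul I.hi 1000000
  have e3 : 1000000 * √x = √(1000000 * x * 1000000) := by
    rw [show 1000000 * x * 1000000 = 1000000 ^ 2 * x by ring, sqrt_mul (by norm_num),
      sqrt_sq (by norm_num)]
  unfold Mem
  rw [e3]
  constructor
  · refine (natDiv_le _ _).trans ?_
    have h1 : √((Nat.mul I.lo 1000000 : ℕ) : ℝ) ≤ _ := sqrt_le_sqrtUp le_rfl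
    refine le_trans (?_ : _ ≤ √((Nat.mul I.lo 1000000 : ℕ) : ℝ)) (sqrt_le_sqrt ?_)
    · refine div_le_of_le_mul₀ (Nat.cast_nonneg _) (sqrt_nonneg _) ?_
      nlinarith [mul_self_sqrt (Nat.cast_nonneg (α := ℝ) (Nat.mul I.lo 1000000)),
        sqrt_nonneg ((Nat.mul I.lo 1000000 : ℕ) : ℝ)]
    · rw [e1]
      linarith [hx.1]
  · refine sqrt_le_sqrtUp ?_
    rw [e2]
    linarith [hx.2]

theorem Mem.dist (hx : I.Mem x) (hy : J.Mem y) : (I.dist J).Mem |x - y| := by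
  have h1 := le_natSub hx.2 hy.1
  have h2 := le_natSub hy.2 hx.1
  have h5 := hx.1.trans hx.2
  have h6 := hy.1.trans hy.2
  unfold Mem NI.dist
  simp only [natMax_eq, Nat.cast_max]
  rcases le_total 0 (x - y) with h | h
  · have h3 := natSub_le hx.1 hy.2 (by linarith)
    have h4 : ((Nat.sub J.lo I.hi : ℕ) : ℝ) = 0 := by
      have : J.lo ≤ I.hi := by
        have : (J.lo : ℝ) ≤ I.hi := by linarith [hx.2, hy.1]
        exact_mod_cast this
      exact_mod_cast Nat.sub_eq_zero_of_le this
    rw [abs_of_nonneg h]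
    refine ⟨max_le (by linarith) (by rw [h4]; linarith), le_max_of_le_left (by linarith)⟩
  · have h3 := natSub_le hy.1 hx.2 (by linarith)
    have h4 : ((Nat.sub I.lo J.hi : ℕ) : ℝ) = 0 := by
      have : I.lo ≤ J.hi := by
        have : (I.lo : ℝ) ≤ J.hi := by linarith [hx.1, hy.2]
        exact_mod_cast this
      exact_mod_cast Nat.sub_eq_zero_of_le this
    rw [abs_of_nonpos h]
    refine ⟨max_le (by rw [h4]; linarith) (by linarith), le_max_of_le_right (by linarith)⟩

theorem mem_split {m : ℕ} (hx : I.Mem x) :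
    (NI.mk I.lo m).Mem x ∨ (NI.mk m I.hi).Mem x := by
  rcases le_total (1000000 * x) m with h | h
  · exact Or.inl ⟨hx.1, h⟩
  · exact Or.inr ⟨h, hx.2⟩

end NI

/-! ### The arctangent -/

/-- The right side is a convergent of the continued fraction of the arctangent. The difference
vanishes at 0 and its derivative is t¹⁰ times a positive function. The lower bound below is the
preceding convergent. -/
theorem arctan_le_of_nonneg {t : ℝ} (ht : 0 ≤ t) :
    arctan t ≤ t * (945 + (735 * t ^ 2 + 64 * (t ^ 2 * t ^ 2))) /
      (945 + (1050 * t ^ 2 + 225 * (t ^ 2 * t ^ 2))) := by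
  set f : ℝ → ℝ := fun t => t * (945 + (735 * t ^ 2 + 64 * (t ^ 2 * t ^ 2))) /
      (945 + (1050 * t ^ 2 + 225 * (t ^ 2 * t ^ 2))) - arctan t with hf
  have hd : ∀ t : ℝ, HasDerivAt f (14400 * t ^ 10 /
      ((945 + (1050 * t ^ 2 + 225 * (t ^ 2 * t ^ 2))) ^ 2 * (1 + t ^ 2))) t := by
    intro t
    have hid := hasDerivAt_id t
    have h2 := hid.pow 2
    have hq : (945 + (1050 * t ^ 2 + 225 * (t ^ 2 * t ^ 2))) ≠ 0 := by positivity
    have h3 : HasDerivAt (fun t : ℝ => t * (945 + (735 * t ^ 2 + 64 * (t ^ 2 * t ^ 2))))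
        (945 + 2205 * t ^ 2 + 320 * t ^ 4) t := by
      refine (hid.mul (((h2.const_mul 735).add ((h2.mul h2).const_mul 64)).const_add 945)).congr_deriv ?_
      simp
      ring
    have h4 : HasDerivAt (fun t : ℝ => 945 + (1050 * t ^ 2 + 225 * (t ^ 2 * t ^ 2)))
        (2100 * t + 900 * t ^ 3) t := by
      refine (((h2.const_mul 1050).add ((h2.mul h2).const_mul 225)).const_add 945).congr_deriv ?_
      simp
      ring
    refine ((h3.div h4 hq).sub (hasDerivAt_arctan t)).congr_deriv ?_
    have : 1 + t ^ 2 ≠ 0 := by positivity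
    field_simp
    ring
  have hm : MonotoneOn f (Set.Ici 0) := by
    refine monotoneOn_of_deriv_nonneg (convex_Ici 0)
      (fun t _ => (hd t).continuousAt.continuousWithinAt)
      (fun t _ => (hd t).differentiableAt.differentiableWithinAt) fun t _ => ?_
    rw [(hd t).deriv]
    positivity
  have h0 : f 0 = 0 := by simp [hf]
  have := hm Set.self_mem_Ici ht ht
  rw [h0] at this
  exact sub_nonneg.1 this

theorem le_arctan_of_nonneg {t : ℝ} (ht : 0 ≤ t) :
    t * (105 + 55 * t ^ 2) / (105 + (90 * t ^ 2 + 9 * (t ^ 2 * t ^ 2))) ≤ arctan t := by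
  set f : ℝ → ℝ := fun t => arctan t -
    t * (105 + 55 * t ^ 2) / (105 + (90 * t ^ 2 + 9 * (t ^ 2 * t ^ 2))) with hf
  have hd : ∀ t : ℝ, HasDerivAt f (576 * t ^ 8 /
      ((105 + (90 * t ^ 2 + 9 * (t ^ 2 * t ^ 2))) ^ 2 * (1 + t ^ 2))) t := by
    intro t
    have hid := hasDerivAt_id t
    have h2 := hid.pow 2
    have hq : (105 + (90 * t ^ 2 + 9 * (t ^ 2 * t ^ 2))) ≠ 0 := by positivity
    have h3 : HasDerivAt (fun t : ℝ => t * (105 + 55 * t ^ 2)) (105 + 165 * t ^ 2) t := by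
      refine (hid.mul ((h2.const_mul 55).const_add 105)).congr_deriv ?_
      simp
      ring
    have h4 : HasDerivAt (fun t : ℝ => 105 + (90 * t ^ 2 + 9 * (t ^ 2 * t ^ 2)))
        (180 * t + 36 * t ^ 3) t := by
      refine (((h2.const_mul 90).add ((h2.mul h2).const_mul 9)).const_add 105).congr_deriv ?_
      simp
      ring
    refine ((hasDerivAt_arctan t).sub (h3.div h4 hq)).congr_deriv ?_
    have : 1 + t ^ 2 ≠ 0 := by positivity
    field_simp
    ring
  have hm : MonotoneOn f (Set.Ici 0) := by
    refine monotoneOn_of_deriv_nonneg (convex_Ici 0)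
      (fun t _ => (hd t).continuousAt.continuousWithinAt)
      (fun t _ => (hd t).differentiableAt.differentiableWithinAt) fun t _ => ?_
    rw [(hd t).deriv]
    positivity
  have h0 : f 0 = 0 := by simp [hf]
  have := hm Set.self_mem_Ici ht ht
  rw [h0] at this
  exact sub_nonneg.1 this

theorem le_atanHi {x : ℝ} {t : ℕ} (h : 1000000 * x ≤ t) : 1000000 * arctan x ≤ atanHi t := by
  set y : ℝ := t / 1000000 with hy
  have hy0 : 0 ≤ y := by positivity
  have hxy : arctan x ≤ arctan y := arctan_strictMono.monotone (by rw [hy, le_div_iff₀] <;> linarith)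
  have h1 : (NI.con t).Mem y := NI.mem_con t
  have h2 := h1.mul h1 hy0
  have h4 := h2.mul h2 (mul_nonneg hy0 hy0)
  have hn := (NI.mem_con_mul 945000000 (x := 945) (by norm_num)).add ((h2.smul 735).add (h4.smul 64))
  have hd := (NI.mem_con_mul 945000000 (x := 945) (by norm_num)).add ((h2.smul 1050).add (h4.smul 225))
  have := ((h1.mul hn (by positivity)).div hd (by positivity) (by simp [NI.add, NI.con])).2
  have hle := arctan_le_of_nonneg hy0
  simp only [sq] at hle
  push_cast at this
  unfold atanHi
  exact (mul_le_mul_of_nonneg_left (hxy.trans hle) (by norm_num)).trans this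

theorem atanLo_le {x : ℝ} {t : ℕ} (h : (t : ℝ) ≤ 1000000 * x) : (atanLo t : ℝ) ≤ 1000000 * arctan x := by
  set y : ℝ := t / 1000000 with hy
  have hy0 : 0 ≤ y := by positivity
  have hxy : arctan y ≤ arctan x := arctan_strictMono.monotone (by rw [hy, div_le_iff₀] <;> linarith)
  have h1 : (NI.con t).Mem y := NI.mem_con t
  have h2 := h1.mul h1 hy0
  have h4 := h2.mul h2 (mul_nonneg hy0 hy0)
  have hn := (NI.mem_con_mul 105000000 (x := 105) (by norm_num)).add (h2.smul 55)
  have hd := (NI.mem_con_mul 105000000 (x := 105) (by norm_num)).add ((h2.smul 90).add (h4.smul 9))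
  have := ((h1.mul hn (by positivity)).div hd (by positivity) (by simp [NI.add, NI.con])).1
  have hle := le_arctan_of_nonneg hy0
  simp only [sq] at hle
  push_cast at this
  unfold atanLo
  exact this.trans (mul_le_mul_of_nonneg_left (hle.trans hxy) (by norm_num))

/-- Tangent of the half-angle: it trades the arccosine for an arctangent, for which rational bounds
are available. -/
theorem lawAngle_eq_arctan {a b c : ℝ} (h : IsTri a b c) :
    lawAngle a b c = 2 * arctan ((a + c - b) * (a + b - c) / (4 * heron a b c)) := by
  have hb := h.swap.pos
  have hc := h.swap'.swap.pos
  have hp := h.heron_pos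
  have h1 := h.heron_sq
  have h2 := h.hb
  have h3 := h.hc
  set t := (a + c - b) * (a + b - c) / (4 * heron a b c) with ht
  have ht0 : 0 < t := by positivity
  have ht2 : t ^ 2 * ((b + c) ^ 2 - a ^ 2) = a ^ 2 - (b - c) ^ 2 := by
    rw [ht, div_pow, mul_pow 4, show (4 : ℝ) ^ 2 = 16 by norm_num, h1, div_mul_eq_mul_div,
      div_eq_iff]
    · ring
    · nlinarith [sq_pos_of_pos hp]
  have hcos : (b ^ 2 + c ^ 2 - a ^ 2) / (2 * b * c) = cos (2 * arctan t) := by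
    rw [cos_two_mul, cos_sq_arctan, div_eq_iff (by positivity)]
    have : 1 + t ^ 2 ≠ 0 := by positivity
    field_simp
    linear_combination ht2
  unfold lawAngle
  rw [hcos, arccos_cos]
  · have := arctan_pos.2 ht0
    positivity
  · linarith [arctan_lt_pi_div_two t]

/-! ### The constants -/

/-- A sign change of the polynomial locates a root in the smaller interval; uniqueness in [0.834,
0.835] identifies it with r. -/
theorem mediumRadius_mem : mediumRadius ∈ Set.Icc (0.834306 : ℝ) 0.834307 := by
  have hc : Continuous mediumPoly := by unfold mediumPoly; fun_prop
  have h0 : (0 : ℝ) ∈ Set.Icc (mediumPoly 0.834306) (mediumPoly 0.834307) := by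
    constructor <;> norm_num [mediumPoly]
  obtain ⟨x, hx, hx0⟩ := intermediate_value_Icc (by norm_num) hc.continuousOn h0
  have := existsUnique_mediumRadius.unique mediumRadius_spec
    ⟨⟨by linarith [hx.1], by linarith [hx.2]⟩, hx0⟩
  rwa [this]

theorem smallRadius_mem : smallRadius ∈ Set.Icc (0.651050 : ℝ) 0.651051 := by
  have hc : Continuous smallPoly := by unfold smallPoly; fun_prop
  have h0 : (0 : ℝ) ∈ Set.Icc (smallPoly 0.651050) (smallPoly 0.651051) := by
    constructor <;> norm_num [smallPoly]
  obtain ⟨x, hx, hx0⟩ := intermediate_value_Icc (by norm_num) hc.continuousOn h0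
  have := existsUnique_smallRadius.unique smallRadius_spec
    ⟨⟨by linarith [hx.1], by linarith [hx.2]⟩, hx0⟩
  rwa [this]

theorem radNI_mem (x : Size) : (radNI x).Mem x.radius := by
  have h1 := mediumRadius_mem
  have h2 := smallRadius_mem
  cases x <;> simp only [NI.Mem, radNI, Size.radius] <;> push_cast
  · norm_num
  · constructor <;> linarith [h1.1, h1.2]
  · constructor <;> linarith [h2.1, h2.2]

theorem le_radNI_lo (x : Size) : 651050 ≤ (radNI x).lo := by
  cases x <;> simp [radNI]

theorem mNat_eq (x : Size) : (mNat x : ℝ) = 1000000 * mConst x := by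
  cases x <;> norm_num [mNat, mConst]

theorem lNat_eq (x y : Size) : (lNat x y : ℝ) = 1000000 * lConst x y := by
  cases x <;> cases y <;> norm_num [lNat, lConst]

theorem qNat_eq (x y : Size) : (qNat x y : ℝ) = 1000000 * qConst x y := by
  cases x <;> cases y <;> norm_num [qNat, qConst]

theorem isTri_tight {x y z : ℝ} (hx : 0 < x) (hy : 0 < y) (hz : 0 < z) :
    IsTri (y + z) (x + z) (x + y) := ⟨by linarith, by linarith, by linarith⟩

theorem heron_tight (x y z : ℝ) : heron (y + z) (x + z) (x + y) = √((x + y + z) * (x * (y * z))) := by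
  unfold heron
  rw [show (y + z + (x + z) + (x + y)) * (x + z + (x + y) - (y + z)) *
    ((y + z + (x + y) - (x + z)) * (y + z + (x + z) - (x + y))) =
      4 ^ 2 * ((x + y + z) * (x * (y * z))) by ring, sqrt_mul (by norm_num), sqrt_sq (by norm_num)]
  ring

theorem lawAngle_tight {x y z : ℝ} (hx : 0 < x) (hy : 0 < y) (hz : 0 < z) :
    lawAngle (y + z) (x + z) (x + y) = 2 * arctan (y * z / heron (y + z) (x + z) (x + y)) := by
  rw [lawAngle_eq_arctan (isTri_tight hx hy hz), show (y + z + (x + y) - (x + z)) *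
    (y + z + (x + z) - (x + y)) = 4 * (y * z) by ring, mul_div_mul_left _ _ (by norm_num)]

theorem tightAreaNI_mem (x y z : Size) :
    (tightAreaNI (radNI x) (radNI y) (radNI z)).Mem (tightHeron x y z) := by
  have hx := x.radius_pos
  have hy := y.radius_pos
  have hz := z.radius_pos
  unfold tightHeron
  rw [heron_tight]
  exact ((((radNI_mem x).add (radNI_mem y)).add (radNI_mem z)).mul ((radNI_mem x).mul
    ((radNI_mem y).mul (radNI_mem z) hz.le) (by positivity)) (by positivity)).sqrt

theorem tightAreaNI_pos (x y z : Size) : 0 < (tightAreaNI (radNI x) (radNI y) (radNI z)).lo := by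
  cases x <;> cases y <;> cases z <;> decide +kernel

theorem tightAngleNI_mem (x y z : Size) :
    (tightAngleNI (radNI x) (radNI y) (radNI z)).Mem
      (lawAngle (y.radius + z.radius) (x.radius + z.radius) (x.radius + y.radius)) := by
  have hx := x.radius_pos
  have hy := y.radius_pos
  have hz := z.radius_pos
  rw [lawAngle_tight hx hy hz]
  have h := ((radNI_mem y).mul (radNI_mem z) hz.le).div (tightAreaNI_mem x y z) (by positivity)
    (tightAreaNI_pos x y z)
  have h1 := atanLo_le h.1
  have h2 := le_atanHi h.2
  unfold tightHeron at h1 h2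
  unfold tightAngleNI NI.Mem
  have e : ∀ n : ℕ, ((Nat.mul 2 n : ℕ) : ℝ) = 2 * n := fun n => by exact_mod_cast Nat.cast_mul 2 n
  simp only [e]
  constructor <;> linarith

/-- The covered area of the tight triangle. -/
noncomputable def tightSectors (x y z : Size) : ℝ :=
  x.radius * x.radius * lawAngle (y.radius + z.radius) (x.radius + z.radius) (x.radius + y.radius) / 2
  + y.radius * y.radius * lawAngle (x.radius + z.radius) (y.radius + z.radius) (y.radius + x.radius) / 2
  + z.radius * z.radius * lawAngle (x.radius + y.radius) (z.radius + y.radius) (z.radius + x.radius) / 2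

theorem lawAngle_nonneg (a b c : ℝ) : 0 ≤ lawAngle a b c := arccos_nonneg _

theorem sectorNI_mem (x y z : Size) :
    (sectorNI (radNI x) (radNI y) (radNI z)).Mem (x.radius * x.radius *
      lawAngle (y.radius + z.radius) (x.radius + z.radius) (x.radius + y.radius) / 2) :=
  (((radNI_mem x).mul (radNI_mem x) x.radius_pos.le).mul (tightAngleNI_mem x y z)
    (lawAngle_nonneg _ _ _)).half

theorem covNI_mem (x y z : Size) :
    (covNI (radNI x) (radNI y) (radNI z)).Mem (tightSectors x y z) :=
  ((sectorNI_mem x y z).add (sectorNI_mem y x z)).add (sectorNI_mem z x y)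

/-- The quotient is the target density once the areas and covered areas of tight triangles are
computed (`tightArea_eq`, `tightCov_eq`). -/
theorem densityNI_mem :
    densityNI.Mem ((4 * tightSectors large medium small + tightSectors large large small +
      tightSectors medium medium large) / (4 * tightHeron large medium small +
        tightHeron large large small + tightHeron medium medium large)) := by
  have h : ∀ x y z, 0 ≤ tightSectors x y z := fun x y z => by
    unfold tightSectors
    have := lawAngle_nonneg (y.radius + z.radius) (x.radius + z.radius) (x.radius + y.radius)
    have := lawAngle_nonneg (x.radius + z.radius) (y.radius + z.radius) (y.radius + x.radius)
    have := lawAngle_nonneg (x.radius + y.radius) (z.radius + y.radius) (z.radius + x.radius)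
    have := x.radius_pos
    have := y.radius_pos
    have := z.radius_pos
    positivity
  have := ((((covNI_mem large medium small).smul 4).add (covNI_mem large large small)).add
    (covNI_mem medium medium large)).div ((((tightAreaNI_mem large medium small).smul 4).add
      (tightAreaNI_mem large large small)).add (tightAreaNI_mem medium medium large))
    (by
      have := h large medium small
      have := h large large small
      have := h medium medium large
      positivity) (by decide +kernel)
  push_cast at this
  exact this

end TernaryPacking

namespace TernaryPacking

open Size Real

/-! ### Soundness of the checker -/

structure VertexData.Sound (d : VertexData) (x y z : Size) : Prop where
  rad : d.rad.Mem x.radius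
  rad_lo : 651050 ≤ d.rad.lo
  kp : 1000000 * (x.radius ^ 2 / 2 + mConst x) ≤ d.kp
  km : d.km ≤ 1000000 * (x.radius ^ 2 / 2 - mConst x)
  angle : d.angle ≤ 1000000 *
    lawAngle (y.radius + z.radius) (x.radius + z.radius) (x.radius + y.radius)
  l : (d.l : ℝ) = 1000000 * lConst y z
  q : (d.q : ℝ) = 1000000 * qConst y z
  diff : d.diff.Mem ((y.radius - z.radius) ^ 2)

structure TypeData.Sound (T : TypeData) (x y z : Size) : Prop where
  vx : T.vx.Sound x y z
  vy : T.vy.Sound y x z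
  vz : T.vz.Sound z x y
  density : T.density ≤ 1000000 * targetDensity
  tight : 1000000 * (targetDensity * tightHeron x y z) ≤ T.tight

/-- Makes r²/2 − m positive, so that a vertex term increases with the angle. -/
theorem mConst_lt (x : Size) : mConst x < x.radius ^ 2 / 2 := by
  have h1 := mediumRadius_mem
  have h2 := smallRadius_mem
  cases x <;> simp only [mConst, Size.radius] <;> nlinarith [h1.1, h2.1]

theorem vertexData_sound (x y z : Size) : (vertexData x y z).Sound x y z where
  rad := radNI_mem x
  rad_lo := le_radNI_lo x
  kp := by
    have h := (((radNI_mem x).mul (radNI_mem x) x.radius_pos.le).half).2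
    have e : ∀ m n : ℕ, ((Nat.add m n : ℕ) : ℝ) = m + n := fun m n => Nat.cast_add m n
    simp only [vertexData, e, mNat_eq]
    linarith
  km := by
    have h := (((radNI_mem x).mul (radNI_mem x) x.radius_pos.le).half).1
    have := natSub_le h (mNat_eq x).ge (by nlinarith [mConst_lt x])
    simp only [vertexData]
    linarith
  angle := (tightAngleNI_mem x y z).1
  l := lNat_eq y z
  q := qNat_eq y z
  diff := by
    have h := (radNI_mem y).dist (radNI_mem z)
    have := h.mul h (abs_nonneg _)
    rwa [abs_mul_abs_self, ← sq] at this

theorem tightHeron_nonneg (x y z : Size) : 0 ≤ tightHeron x y z := by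
  unfold tightHeron heron
  positivity

theorem typeData_sound (hδ : densityNI.Mem targetDensity) (x y z : Size) :
    (typeData x y z).Sound x y z where
  vx := vertexData_sound x y z
  vy := vertexData_sound y x z
  vz := vertexData_sound z x y
  density := hδ.1
  tight := (hδ.mul (tightAreaNI_mem x y z) (tightHeron_nonneg x y z)).2

theorem TypeData.force_eq {α : Type} (T : TypeData) (k : TypeData → α) : T.force k = k T := by
  simp only [TypeData.force, VertexData.force, NI.force_eq, TernaryPacking.force_eq]

theorem natAdd_cast (m n : ℕ) : ((Nat.add m n : ℕ) : ℝ) = m + n := Nat.cast_add m n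

theorem natMul_cast (m n : ℕ) : ((Nat.mul m n : ℕ) : ℝ) = m * n := Nat.cast_mul m n

/-- The slope is r²/2 + m above the tight angle and r²/2 − m below it. Truncated subtraction leaves
only the relevant one of the two products, up to a rounding unit. -/
theorem vertexTerm_le {d : VertexData} {x y z : Size} (h : d.Sound x y z) {a b c : ℝ} {α : ℕ}
    (hα : 1000000 * lawAngle a b c ≤ α) :
    1000000 * vertexTerm x y z a b c ≤
      mulHi d.kp (Nat.sub α d.angle) - mulLo d.km (Nat.sub d.angle α) := by
  unfold vertexTerm
  set Δ := lawAngle a b c -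
      lawAngle (y.radius + z.radius) (x.radius + z.radius) (x.radius + y.radius) with hΔ
  have hm := mConst_pos x
  have hm' := mConst_lt x
  rcases le_total d.angle α with hle | hle
  · have h1 : mulLo d.km (Nat.sub d.angle α) = 0 := by
      have : Nat.sub d.angle α = 0 := Nat.sub_eq_zero_of_le hle
      rw [this, mulLo, Nat.mul_eq, mul_zero]
      rfl
    rw [h1, Nat.cast_zero, sub_zero]
    have h2 := le_natSub hα h.angle
    -- Since α bounds one angle from above and `d.angle` the other from below, their order does not
    -- determine the sign of Δ.
    have h3 : 1000000 * max Δ 0 ≤ ((Nat.sub α d.angle : ℕ) : ℝ) := by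
      rcases max_cases Δ 0 with ⟨e, -⟩ | ⟨e, -⟩ <;> rw [e]
      · linarith
      · simp
    have h4 := le_mulHi h.kp h3 (le_max_right _ _)
    refine le_trans ?_ h4
    rcases le_total 0 Δ with h0 | h0
    · rw [max_eq_left h0, abs_of_nonneg h0]; linarith
    · rw [max_eq_right h0, abs_of_nonpos h0]; nlinarith
  · have h2 : (d.angle : ℝ) = α + ((Nat.sub d.angle α : ℕ) : ℝ) := by
      exact_mod_cast (Nat.add_sub_cancel' hle).symm
    have h0 := Nat.cast_nonneg (α := ℝ) (Nat.sub d.angle α)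
    have h3 : ((Nat.sub d.angle α : ℕ) : ℝ) ≤ 1000000 * (-Δ) := by
      linarith [h.angle]
    have h4 := mulLo_le h.km h3
    have h5 := Nat.cast_nonneg (α := ℝ) (mulHi d.kp (Nat.sub α d.angle))
    have : Δ ≤ 0 := by linarith
    rw [abs_of_nonpos this]
    linarith

theorem four_heron (a b c : ℝ) :
    √((a + b + c) * (b + c - a) * ((a + c - b) * (a + b - c))) = 4 * heron a b c := by
  unfold heron
  ring

theorem lawAngle_le_atanHi {a b c : ℝ} (htri : IsTri a b c) {I K : NI}
    (hI : I.Mem ((a + c - b) * (a + b - c))) (hK : K.Mem (4 * heron a b c)) (hk : 1 ≤ K.lo) :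
    1000000 * lawAngle a b c ≤ (Nat.mul 2 (atanHi (I.div (NI.con K.lo)).hi) : ℕ) := by
  have : 1000000 * _ ≤ (atanHi (I.div (NI.con K.lo)).hi : ℝ) :=
    le_atanHi (hI.div hK (mul_nonneg htri.hb.le htri.hc.le) hk).2
  rw [natMul_cast, lawAngle_eq_arctan htri]
  push_cast
  linarith

theorem pointCheck_sound {T : TypeData} {x y z : Size} (hT : T.Sound x y z) {A B C : NI}
    {a b c : ℝ} (htri : IsTri a b c) (ha : A.Mem a) (hb : B.Mem b) (hc : C.Mem c) {up un : ℕ}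
    (h : pointCheck T up un A B C = true) : (up : ℝ) ≤ 1000000 * gain x y z a b c + un := by
  have hp := (hb.add hc).sub ha htri.ha.le
  have hq := (ha.add hc).sub hb htri.hb.le
  have hw := (ha.add hb).sub hc htri.hc.le
  have hk := ((((ha.add hb).add hc).mul hp htri.ha.le).mul (hq.mul hw htri.hc.le)
    (mul_nonneg htri.hb.le htri.hc.le)).sqrt
  rw [four_heron] at hk
  unfold pointCheck at h
  simp only [force_eq, Bool.and_eq_true] at h
  obtain ⟨hk0, h⟩ := h
  have hk0 := Nat.le_of_ble_eq_true hk0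
  have hα := lawAngle_le_atanHi htri (hq.mul hw htri.hc.le) hk hk0
  have hβ := lawAngle_le_atanHi htri.swap (by
    rw [add_comm b a]; exact hp.mul hw htri.hc.le) (by rw [heron_swap']; exact hk) hk0
  have hγ := lawAngle_le_atanHi htri.swap'.swap (by
    rw [add_comm c b, add_comm c a]; exact hp.mul hq htri.hb.le)
    (by rw [heron_swap', heron_swap]; exact hk) hk0
  have h1 := vertexTerm_le hT.vx hα
  have h2 := vertexTerm_le hT.vy hβ
  have h3 := vertexTerm_le hT.vz hγ
  have h4 := (natDiv_le _ 4).trans (div_le_div_of_nonneg_right (mulLo_le hT.density hk.1)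
    (Nat.cast_nonneg 4))
  have h5 := hT.tight
  have h6 := Nat.cast_le (α := ℝ).2 (Nat.le_of_ble_eq_true h)
  simp only [natAdd_cast] at h6
  push_cast at h4
  unfold gain
  have e : 1000000 * (targetDensity * (4 * heron a b c)) / 4 =
    1000000 * (targetDensity * heron a b c) := by ring
  rw [e] at h4
  linarith

theorem abs_sub_le_of_sound {d e : VertexData} {y z x x' w w' : Size} (hd : d.Sound y x x')
    (he : e.Sound z w w') {k l : ℝ} (hk : |k - y.radius ^ 2 / 2| = mConst y)
    (hl : |l - z.radius ^ 2 / 2| = mConst z) :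
    1000000 * |k - l| ≤ (natMax (Nat.sub d.kp e.km) (Nat.sub e.kp d.km) : ℕ) := by
  have hk' := abs_le.1 hk.le
  have hl' := abs_le.1 hl.le
  have k1 : 1000000 * k ≤ d.kp := by linarith [hd.kp]
  have k2 : d.km ≤ 1000000 * k := by linarith [hd.km]
  have l1 : 1000000 * l ≤ e.kp := by linarith [he.kp]
  have l2 : e.km ≤ 1000000 * l := by linarith [he.km]
  have h1 := le_natSub k1 l2
  have h2 := le_natSub l1 k2
  rw [natMax_eq, Nat.cast_max]
  rcases abs_cases (k - l) with ⟨e, -⟩ | ⟨e, -⟩ <;> rw [e]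
  · exact le_max_of_le_left (by linarith)
  · exact le_max_of_le_right (by linarith)

theorem edgeCheck_sound {D : ℕ} (hD : D ≤ 1000000 * targetDensity) {d e : VertexData}
    {y z x x' w w' : Size} (hd : d.Sound y x x') (he : e.Sound z w w') {A B C : NI}
    (h : edgeCheck D d e A B C = true) {a₁ a₂ b₁ b₂ c₁ c₂ : ℝ}
    (ha1 : A.lo ≤ 1000000 * a₁) (ha2 : 1000000 * a₂ ≤ A.hi)
    (hb1 : B.lo ≤ 1000000 * b₁) (hb2 : 1000000 * b₂ ≤ B.hi)
    (hc1 : C.lo ≤ 1000000 * c₁) (hc2 : 1000000 * c₂ ≤ C.hi) {k l : ℝ}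
    (hk : |k - y.radius ^ 2 / 2| = mConst y) (hl : |l - z.radius ^ 2 / 2| = mConst z) :
    a₂ < b₁ + c₁ ∧ ∀ b ∈ Set.Icc b₁ b₂, ∀ c ∈ Set.Icc c₁ c₂,
      2 * (|k - l| * |b ^ 2 - c ^ 2|) ≤ targetDensity * a₁ ^ 4 := by
  unfold edgeCheck at h
  rw [Bool.and_eq_true] at h
  constructor
  · have : A.hi + 1 ≤ B.lo + C.lo := Nat.le_of_ble_eq_true h.1
    have : (A.hi : ℝ) + 1 ≤ B.lo + C.lo := by exact_mod_cast this
    linarith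
  · intro b hb c hc
    have hb' : B.Mem b := ⟨by linarith [hb.1], by linarith [hb.2]⟩
    have hc' : C.Mem c := ⟨by linarith [hc.1], by linarith [hc.2]⟩
    have b0 : 0 ≤ b := by linarith [hb'.1, Nat.cast_nonneg (α := ℝ) B.lo]
    have c0 : 0 ≤ c := by linarith [hc'.1, Nat.cast_nonneg (α := ℝ) C.lo]
    have h1 := le_mulHi (abs_sub_le_of_sound hd he hk hl)
      ((hb'.mul hb' b0).dist (hc'.mul hc' c0)).2 (abs_nonneg _)
    have h2 := mulLo_le hD (mulLo_le (mulLo_le ha1 ha1) (mulLo_le ha1 ha1))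
    have h3 := Nat.cast_le (α := ℝ).2 (Nat.le_of_ble_eq_true h.2)
    rw [natMul_cast] at h3
    push_cast at h3
    have e1 : a₁ ^ 4 = a₁ * a₁ * (a₁ * a₁) := by ring
    rw [e1, sq, sq]
    simp only [NI.mul, NI.con] at h1 h2 h3
    linarith

theorem edgesCheck_sound {T : TypeData} {x y z : Size} (hT : T.Sound x y z) {A B C : NI}
    (h : edgesCheck T A B C = true) {a₁ a₂ b₁ b₂ c₁ c₂ : ℝ}
    (ha1 : A.lo ≤ 1000000 * a₁) (ha2 : 1000000 * a₂ ≤ A.hi)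
    (hb1 : B.lo ≤ 1000000 * b₁) (hb2 : 1000000 * b₂ ≤ B.hi)
    (hc1 : C.lo ≤ 1000000 * c₁) (hc2 : 1000000 * c₂ ≤ C.hi) {k₁ k₂ k₃ : ℝ}
    (h1 : |k₁ - x.radius ^ 2 / 2| = mConst x) (h2 : |k₂ - y.radius ^ 2 / 2| = mConst y)
    (h3 : |k₃ - z.radius ^ 2 / 2| = mConst z) :
    BoxCond targetDensity k₁ k₂ k₃ a₁ a₂ b₁ b₂ c₁ c₂ := by
  unfold edgesCheck at h
  simp only [Bool.and_eq_true] at h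
  have e1 := edgeCheck_sound hT.density hT.vy hT.vz h.1 ha1 ha2 hb1 hb2 hc1 hc2 h2 h3
  have e2 := edgeCheck_sound hT.density hT.vx hT.vz h.2.1 hb1 hb2 ha1 ha2 hc1 hc2 h1 h3
  have e3 := edgeCheck_sound hT.density hT.vx hT.vy h.2.2 hc1 hc2 ha1 ha2 hb1 hb2 h1 h2
  exact ⟨e1.1, e2.1, e3.1, e1.2, e2.2, e3.2⟩

theorem exists_kConst (x : Size) : ∃ k : ℝ, |k - x.radius ^ 2 / 2| = mConst x :=
  ⟨x.radius ^ 2 / 2 + mConst x, by rw [add_sub_cancel_left, abs_of_pos (mConst_pos x)]⟩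

/-- The checks at the vertices of a box imply a bound in the whole box. -/
theorem le_gain_of_checks {T : TypeData} {x y z : Size} (hT : T.Sound x y z)
    (hδ0 : 0 ≤ targetDensity) {A B C : NI} (h : edgesCheck T A B C = true)
    {a₁ a₂ b₁ b₂ c₁ c₂ a b c : ℝ} (ha : a ∈ Set.Icc a₁ a₂) (hb : b ∈ Set.Icc b₁ b₂)
    (hc : c ∈ Set.Icc c₁ c₂) (ha1 : A.lo ≤ 1000000 * a₁) (ha2 : 1000000 * a₂ ≤ A.hi)
    (hb1 : B.lo ≤ 1000000 * b₁) (hb2 : 1000000 * b₂ ≤ B.hi)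
    (hc1 : C.lo ≤ 1000000 * c₁) (hc2 : 1000000 * c₂ ≤ C.hi)
    {A₁ A₂ B₁ B₂ C₁ C₂ : NI} (hA₁ : A₁.Mem a₁) (hA₂ : A₂.Mem a₂) (hB₁ : B₁.Mem b₁)
    (hB₂ : B₂.Mem b₂) (hC₁ : C₁.Mem c₁) (hC₂ : C₂.Mem c₂) {up un : ℕ}
    (h0 : (up : ℝ) ≤ 1000000 * gain x y z a₁ b₁ c₁ + un)
    (hv : verticesCheck T up un A₁ A₂ B₁ B₂ C₁ C₂ = true) :
    (up : ℝ) ≤ 1000000 * gain x y z a b c + un := by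
  have hbox : ∀ k₁ k₂ k₃ : ℝ, |k₁ - x.radius ^ 2 / 2| = mConst x →
      |k₂ - y.radius ^ 2 / 2| = mConst y → |k₃ - z.radius ^ 2 / 2| = mConst z →
      BoxCond targetDensity k₁ k₂ k₃ a₁ a₂ b₁ b₂ c₁ c₂ := fun k₁ k₂ k₃ h1 h2 h3 =>
    edgesCheck_sound hT h ha1 ha2 hb1 hb2 hc1 hc2 h1 h2 h3
  obtain ⟨k₁, hk1⟩ := exists_kConst x
  obtain ⟨k₂, hk2⟩ := exists_kConst y
  obtain ⟨k₃, hk3⟩ := exists_kConst z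
  have hb0 := hbox k₁ k₂ k₃ hk1 hk2 hk3
  have htri : ∀ a ∈ Set.Icc a₁ a₂, ∀ b ∈ Set.Icc b₁ b₂, ∀ c ∈ Set.Icc c₁ c₂, IsTri a b c :=
    fun a ha b hb c hc => ⟨by linarith [hb0.tri_a, ha.2, hb.1, hc.1],
      by linarith [hb0.tri_b, ha.1, hb.2, hc.1], by linarith [hb0.tri_c, ha.1, hb.1, hc.2]⟩
  have ia1 : a₁ ∈ Set.Icc a₁ a₂ := ⟨le_rfl, ha.1.trans ha.2⟩
  have ia2 : a₂ ∈ Set.Icc a₁ a₂ := ⟨ha.1.trans ha.2, le_rfl⟩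
  have ib1 : b₁ ∈ Set.Icc b₁ b₂ := ⟨le_rfl, hb.1.trans hb.2⟩
  have ib2 : b₂ ∈ Set.Icc b₁ b₂ := ⟨hb.1.trans hb.2, le_rfl⟩
  have ic1 : c₁ ∈ Set.Icc c₁ c₂ := ⟨le_rfl, hc.1.trans hc.2⟩
  have ic2 : c₂ ∈ Set.Icc c₁ c₂ := ⟨hc.1.trans hc.2, le_rfl⟩
  unfold verticesCheck at hv
  simp only [Bool.and_eq_true] at hv
  obtain ⟨⟨⟨v1, v2⟩, v3, v4⟩, ⟨v5, v6⟩, v7⟩ := hv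
  have p1 := pointCheck_sound hT (htri _ ia1 _ ib1 _ ic2) hA₁ hB₁ hC₂ v1
  have p2 := pointCheck_sound hT (htri _ ia1 _ ib2 _ ic1) hA₁ hB₂ hC₁ v2
  have p3 := pointCheck_sound hT (htri _ ia1 _ ib2 _ ic2) hA₁ hB₂ hC₂ v3
  have p4 := pointCheck_sound hT (htri _ ia2 _ ib1 _ ic1) hA₂ hB₁ hC₁ v4
  have p5 := pointCheck_sound hT (htri _ ia2 _ ib1 _ ic2) hA₂ hB₁ hC₂ v5
  have p6 := pointCheck_sound hT (htri _ ia2 _ ib2 _ ic1) hA₂ hB₂ hC₁ v6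
  have p7 := pointCheck_sound hT (htri _ ia2 _ ib2 _ ic2) hA₂ hB₂ hC₂ v7
  have := le_gain_of_vertices (t := ((up : ℝ) - un) / 1000000) hbox hδ0 ha hb hc (by
    rintro a (rfl | rfl) b (rfl | rfl) c (rfl | rfl) <;> rw [div_le_iff₀ (by norm_num)] <;> linarith)
  rw [div_le_iff₀ (by norm_num)] at this
  linarith

theorem gain_nonneg_of_short {T : TypeData} {x y z : Size} (hT : T.Sound x y z)
    (hδ0 : 0 ≤ targetDensity) (h : shortCheck T = true) {a b c : ℝ}
    (ha : a ∈ Set.Icc (y.radius + z.radius) (lConst y z))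
    (hb : b ∈ Set.Icc (x.radius + z.radius) (lConst x z))
    (hc : c ∈ Set.Icc (x.radius + y.radius) (lConst x y)) : 0 ≤ gain x y z a b c := by
  unfold shortCheck at h
  simp only [Bool.and_eq_true] at h
  have ra := hT.vy.rad.add hT.vz.rad
  have rb := hT.vx.rad.add hT.vz.rad
  have rc := hT.vx.rad.add hT.vy.rad
  have := le_gain_of_checks hT hδ0 h.1 ha hb hc ra.1 hT.vx.l.ge rb.1 hT.vy.l.ge rc.1 hT.vz.l.ge
    ra (NI.mem_con_mul _ hT.vx.l) rb (NI.mem_con_mul _ hT.vy.l) rc (NI.mem_con_mul _ hT.vz.l)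
    (by rw [gain_tight]; simp) h.2
  simp only [Nat.cast_zero] at this
  linarith

theorem boxCheck_sound {T : TypeData} {x y z : Size} (hT : T.Sound x y z)
    (hδ0 : 0 ≤ targetDensity) {A B C : NI} (h : edgesCheck T A B C = true) {up un : ℕ}
    (hbox : boxCheck T up un A B C = true) {a b c : ℝ} (ha : A.Mem a) (hb : B.Mem b)
    (hc : C.Mem c) : (up : ℝ) ≤ 1000000 * gain x y z a b c + un := by
  have hI : ∀ {I : NI} {t : ℝ}, I.Mem t → t ∈ Set.Icc ((I.lo : ℝ) / 1000000) (I.hi / 1000000) :=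
    fun {I t} ht => ⟨by rw [div_le_iff₀] <;> linarith [ht.1], by rw [le_div_iff₀] <;> linarith [ht.2]⟩
  have e : ∀ n : ℕ, (n : ℝ) = 1000000 * (n / 1000000) := fun n => by ring
  unfold boxCheck at hbox
  rw [Bool.and_eq_true] at hbox
  obtain ⟨k₁, hk1⟩ := exists_kConst x
  obtain ⟨k₂, hk2⟩ := exists_kConst y
  obtain ⟨k₃, hk3⟩ := exists_kConst z
  have hb0 := edgesCheck_sound hT h (e A.lo).le (e A.hi).ge (e B.lo).le (e B.hi).ge (e C.lo).le
    (e C.hi).ge hk1 hk2 hk3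
  have ea := (hI ha).1.trans (hI ha).2
  have eb := (hI hb).1.trans (hI hb).2
  have ec := (hI hc).1.trans (hI hc).2
  refine le_gain_of_checks hT hδ0 h (hI ha) (hI hb) (hI hc) (e A.lo).le (e A.hi).ge (e B.lo).le
    (e B.hi).ge (e C.lo).le (e C.hi).ge (NI.mem_con _) (NI.mem_con _) (NI.mem_con _)
    (NI.mem_con _) (NI.mem_con _) (NI.mem_con _) ?_ hbox.2
  exact pointCheck_sound hT ⟨by linarith [hb0.tri_a], by linarith [hb0.tri_b],
    by linarith [hb0.tri_c]⟩ (NI.mem_con _) (NI.mem_con _) (NI.mem_con _) hbox.1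

end TernaryPacking

namespace TernaryPacking

open Size Real

/-! ### Triangles with a long edge -/

/-- The potential of an edge. -/
noncomputable def edgeTerm (x y : Size) (e d : ℝ) : ℝ :=
  if e < lConst x y then 0 else qConst x y * d

theorem qConst_pos (x y : Size) : 0 < qConst x y := by
  cases x <;> cases y <;> norm_num [qConst]

/-- Circles of radii `x`, `y`, `z` tangent to a circle of radius `ρ` whose center is seen from
the edges `b` and `c` at angles with half-sines `sb`, `sc` and half-cosines `cb`, `cc`. The signed
distances from this center to the edges are `da`, `db`, `dc`. -/
structure ApexConfig (x y z ρ a b c da db dc sb cb sc cc : ℝ) : Prop where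
  rho_nonneg : 0 ≤ ρ
  ha : y + z ≤ a
  hb : x + z ≤ b
  hc : x + y ≤ c
  sb_nonneg : 0 ≤ sb
  cb_nonneg : 0 ≤ cb
  sc_nonneg : 0 ≤ sc
  cc_nonneg : 0 ≤ cc
  unit_b : sb ^ 2 + cb ^ 2 = 1
  unit_c : sc ^ 2 + cc ^ 2 = 1
  sin_b : 4 * ((ρ + x) * (ρ + z)) * sb ^ 2 = b ^ 2 - (x - z) ^ 2
  sin_c : 4 * ((ρ + x) * (ρ + y)) * sc ^ 2 = c ^ 2 - (x - y) ^ 2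
  sq_a : a ^ 2 = (y - z) ^ 2 + 4 * ((ρ + y) * (ρ + z)) * (1 - (cb * cc - sb * sc) ^ 2)
  -- With half-angles β, γ this is cos(β + γ) ≥ −cos β, that is β ≤ π − β − γ: when X is inside the
  -- triangle, the angle at X facing the edge a is at least the one facing b.
  largest_b : sb * sc ≤ cb * cc + cb
  largest_c : sb * sc ≤ cb * cc + cc
  -- The right side is −(ρ + y)(ρ + z) sin 2(β + γ): negative when 0 < β + γ < π/2, where X lies
  -- beyond the edge a.
  dist_a : da * a = -(2 * ((ρ + y) * (ρ + z)) * (sb * cc + cb * sc) * (cb * cc - sb * sc))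
  dist_b : db * b = 2 * ((ρ + x) * (ρ + z)) * sb * cb
  dist_c : dc * c = 2 * ((ρ + x) * (ρ + y)) * sc * cc

/-- Bound of the distance to an edge of length `b`, the product of the distances to its endpoints
being `m`. -/
theorem sideDist_sq_le {m d b e s c : ℝ} (hm : 0 ≤ m) (hb : 0 < b) (hu : s ^ 2 + c ^ 2 = 1)
    (hs : 4 * m * s ^ 2 = b ^ 2 - e ^ 2) (hd : d * b = 2 * m * s * c) :
    d ^ 2 ≤ m - (b ^ 2 - e ^ 2) / 4 := by
  have h1 : d ^ 2 * b ^ 2 = (b ^ 2 - e ^ 2) * (m * c ^ 2) := by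
    rw [← hs, ← mul_pow, hd]
    ring
  have h2 : m * c ^ 2 = m - (b ^ 2 - e ^ 2) / 4 := by
    rw [← hs]
    linear_combination m * hu
  rw [h2] at h1
  have h3 : 0 ≤ m - (b ^ 2 - e ^ 2) / 4 := by rw [← h2]; positivity
  have hb2 : 0 < b ^ 2 := by positivity
  refine le_of_mul_le_mul_right ?_ hb2
  rw [h1]
  nlinarith [mul_nonneg (sq_nonneg e) h3]

theorem sideUp_sound {v : VertexData} {x y z : Size} (hv : v.Sound x y z) {M B : NI}
    {m b d : ℝ} (hM : M.Mem m) (hB : B.Mem b)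
    (hz : |y.radius - z.radius| ≤ lConst y z)
    (hd : d ^ 2 ≤ m - (b ^ 2 - (y.radius - z.radius) ^ 2) / 4) :
    1000000 * edgeTerm y z b d ≤ sideUp v M B := by
  unfold sideUp edgeTerm
  rcases h : Nat.blt B.hi v.l with _ | _
  · rw [cond_false]
    have hnn := Nat.cast_nonneg (α := ℝ) (mulHi v.q (sqrtUp (Nat.mul 1000000 (Nat.sub M.hi
      (Nat.div (NI.sub (NI.mul (NI.con (natMax B.lo v.l)) (NI.con (natMax B.lo v.l))) v.diff).lo 4)))))
    split_ifs with hl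
    · rw [mul_zero]
      exact hnn
    · push Not at hl
      -- The bound decreases with b and matters only for b at least the threshold, so the lower
      -- endpoint of `B` may be raised to the threshold.
      have hmax : ((natMax B.lo v.l : ℕ) : ℝ) ≤ 1000000 * b := by
        rw [natMax_eq, Nat.cast_max, hv.l]
        exact max_le hB.1 (by linarith)
      have h1 := mulLo_le hmax hmax
      have hsq : (y.radius - z.radius) ^ 2 ≤ b ^ 2 := by
        rw [← sq_abs (y.radius - z.radius)]
        exact pow_le_pow_left₀ (abs_nonneg _) (hz.trans hl) 2
      have h2 := natSub_le h1 hv.diff.2 (by nlinarith)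
      have h3 := (natDiv_le _ 4).trans (div_le_div_of_nonneg_right h2 (Nat.cast_nonneg 4))
      push_cast at h3
      have h4 := le_natSub hM.2 h3
      have h5 : (1000000 * |d|) ≤ sqrtUp (Nat.mul 1000000 (Nat.sub M.hi
          (Nat.div (NI.sub (NI.mul (NI.con (natMax B.lo v.l)) (NI.con (natMax B.lo v.l))) v.diff).lo 4))) := by
        refine le_trans ?_ (sqrt_le_sqrtUp le_rfl)
        refine le_sqrt_of_sq_le ?_
        rw [natMul_cast, mul_pow, sq_abs]
        push_cast
        refine le_trans ?_ (mul_le_mul_of_nonneg_left h4 (by norm_num))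
        rw [sq] at hd ⊢
        nlinarith
      have h6 := le_mulHi hv.q.ge h5 (abs_nonneg d)
      refine le_trans ?_ h6
      have := mul_le_mul_of_nonneg_left (le_abs_self d) (qConst_pos y z).le
      linarith
  · rw [cond_true]
    have h' : B.hi + 1 ≤ v.l := Nat.le_of_ble_eq_true h
    have h'' : (B.hi : ℝ) + 1 ≤ v.l := by exact_mod_cast h'
    rw [hv.l] at h''
    rw [if_pos (by linarith [hB.2])]
    simp

/-- Note 0.0396 = 1 − 0.98². For an edge a beyond its threshold, |d| = √(m(1 − e²/a²))|C| then lies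
between 0.98 and 1 times √m|C|; this is the factor 980000 in `baseUn`. -/
theorem diff_sq_le (y z : Size) : (y.radius - z.radius) ^ 2 ≤ 0.0396 * lConst y z ^ 2 := by
  have h1 := mediumRadius_mem
  have h2 := smallRadius_mem
  cases y <;> cases z <;> simp only [Size.radius, lConst] <;> nlinarith [h1.1, h1.2, h2.1, h2.2]

theorem lConst_pos (y z : Size) : 0 < lConst y z := by
  cases y <;> cases z <;> norm_num [lConst]

theorem abs_diff_le (y z : Size) : |y.radius - z.radius| ≤ lConst y z := by
  have h := diff_sq_le y z
  have h0 := lConst_pos y z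
  exact abs_le_of_sq_le_sq (by nlinarith) h0.le

/-- The signed distance to the edge opposite to the apex, up to a factor close to `1`. -/
theorem baseDist_bounds {m d a e s C : ℝ} (hm : 0 ≤ m) (ha : 0 < a)
    (hs0 : 0 ≤ s) (hs : a ^ 2 = e ^ 2 + 4 * m * s ^ 2) (he : e ^ 2 ≤ 0.0396 * a ^ 2)
    (hd : d * a = -(2 * m * s * C)) :
    (0 ≤ C → d ≤ -(0.98 * (C * √m))) ∧ (C ≤ 0 → d ≤ -C * √m) := by
  have h1 : d ^ 2 * a ^ 2 = (a ^ 2 - e ^ 2) * (m * C ^ 2) := by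
    rw [← mul_pow, hd, hs]
    ring
  have hsq : (C * √m) ^ 2 = m * C ^ 2 := by rw [mul_pow, sq_sqrt hm]; ring
  have ha2 : 0 < a ^ 2 := by positivity
  have hmC : 0 ≤ m * C ^ 2 := by positivity
  constructor
  · intro hC
    have hd0 : d ≤ 0 := by
      have : 0 ≤ 2 * m * s * C := by positivity
      by_contra h
      push Not at h
      nlinarith [mul_pos h ha]
    have : (0.98 * (C * √m)) ^ 2 ≤ (-d) ^ 2 := by
      rw [mul_pow, hsq, neg_sq]
      refine le_of_mul_le_mul_right ?_ ha2
      rw [h1]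
      nlinarith [mul_le_mul_of_nonneg_right he hmC]
    have := (le_abs_self _).trans (abs_le_of_sq_le_sq this (by linarith))
    linarith
  · intro hC
    have : d ^ 2 ≤ (-C * √m) ^ 2 := by
      rw [neg_mul, neg_sq, hsq]
      refine le_of_mul_le_mul_right ?_ ha2
      rw [h1]
      nlinarith [mul_nonneg (sq_nonneg e) hmC]
    exact (le_abs_self _).trans
      (abs_le_of_sq_le_sq this (mul_nonneg (by linarith) (sqrt_nonneg _)))

/-- Only the edge opposite to the apex can have a negative potential. As the bounds are natural
numbers, this negative part is carried separately, by `baseUn`; at most one of the two bounds is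
nonzero. -/
theorem base_sound {v : VertexData} {x y z : Size} (hv : v.Sound x y z) {M A P Q : NI}
    {m a d s p q : ℝ} (hM : M.Mem m) (hA : A.Mem a) (hP : P.Mem p) (hQ : Q.Mem q) (hm : 0 ≤ m)
    (ha : 0 < a) (hs0 : 0 ≤ s)
    (hs : a ^ 2 = (y.radius - z.radius) ^ 2 + 4 * m * s ^ 2)
    (hd : d * a = -(2 * m * s * (p - q))) :
    1000000 * edgeTerm y z a d + baseUn v M A P Q ≤ baseUp v M A P Q := by
  have hq0 := qConst_pos y z
  unfold edgeTerm
  have hup := Nat.cast_nonneg (α := ℝ) (baseUp v M A P Q)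
  by_cases hl : a < lConst y z
  · rw [if_pos hl]
    have : baseUn v M A P Q = 0 := by
      unfold baseUn
      rcases h : Nat.ble v.l A.lo with _ | _
      · rfl
      · exfalso
        have h' : (v.l : ℝ) ≤ A.lo := by exact_mod_cast Nat.le_of_ble_eq_true h
        rw [hv.l] at h'
        linarith [hA.1]
    rw [this, mul_zero, Nat.cast_zero, add_zero]
    exact hup
  · rw [if_neg hl]
    push Not at hl
    have he : (y.radius - z.radius) ^ 2 ≤ 0.0396 * a ^ 2 := by
      refine (diff_sq_le y z).trans ?_
      have := lConst_pos y z
      gcongr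
    obtain ⟨h1, h2⟩ := baseDist_bounds hm ha hs0 hs he hd
    have hsub : Nat.blt A.hi v.l = false := by
      rw [Bool.eq_false_iff]
      intro h
      have h' : A.hi + 1 ≤ v.l := Nat.le_of_ble_eq_true h
      have h'' : (A.hi : ℝ) + 1 ≤ v.l := by exact_mod_cast h'
      rw [hv.l] at h''
      linarith [hA.2]
    rcases le_total (p - q) 0 with hC | hC
    · have hun : baseUn v M A P Q = 0 := by
        unfold baseUn
        rcases Nat.ble v.l A.lo with _ | _
        · rfl
        · have : Nat.sub P.lo Q.hi = 0 := by
            refine Nat.sub_eq_zero_of_le ?_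
            have : (P.lo : ℝ) ≤ Q.hi := by linarith [hP.1, hQ.2]
            exact_mod_cast this
          have h0 : ∀ n, mulLo n 0 = 0 := fun n => by
            rw [mulLo, Nat.mul_eq, mul_zero]
            rfl
          have h0' : ∀ n, mulLo 0 n = 0 := fun n => by
            rw [mulLo, Nat.mul_eq, zero_mul]
            rfl
          rw [this, cond_true, h0', h0, h0]
      rw [hun, Nat.cast_zero, add_zero]
      have h3 := h2 hC
      unfold baseUp
      rw [hsub, cond_false]
      rcases h : Nat.ble Q.hi P.lo with _ | _
      · rw [cond_false]
        have h4 := le_natSub hQ.2 hP.1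
        have h5 := le_mulHi hv.q.ge (le_mulHi (x := q - p) (by linarith) hM.sqrt.2 (sqrt_nonneg _))
          (mul_nonneg (by linarith) (sqrt_nonneg _))
        refine le_trans ?_ h5
        have := mul_le_mul_of_nonneg_left h3 hq0.le
        rw [neg_sub] at this
        linarith
      · have h' : (Q.hi : ℝ) ≤ P.lo := by exact_mod_cast Nat.le_of_ble_eq_true h
        have : p - q = 0 := by linarith [hP.1, hQ.2]
        rw [this] at h3
        have : d ≤ 0 := by linarith
        rw [cond_true, Nat.cast_zero]
        nlinarith
    · have h3 := h1 hC
      have h5 : (baseUn v M A P Q : ℝ) ≤ 1000000 * (qConst y z * (0.98 * ((p - q) * √m))) := by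
        unfold baseUn
        rcases Nat.ble v.l A.lo with _ | _
        · rw [cond_false, Nat.cast_zero]
          have := sqrt_nonneg m
          positivity
        · rw [cond_true]
          have h4 := natSub_le hP.1 hQ.2 (by linarith)
          exact mulLo_le hv.q.le (mulLo_le (by norm_num) (mulLo_le (by linarith) hM.sqrt.1))
      have := mul_le_mul_of_nonneg_left h3 hq0.le
      linarith

theorem blt_le {m n : ℕ} (h : Nat.blt m n = true) : (m : ℝ) + 1 ≤ n := by
  have : m + 1 ≤ n := Nat.le_of_ble_eq_true h
  exact_mod_cast this

/-- The conclusion for triangles with a long edge. -/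
def LongBound (x y z : Size) (a b c da db dc : ℝ) : Prop :=
  edgeTerm y z a da + edgeTerm x z b db + edgeTerm x y c dc ≤ gain x y z a b c

theorem finalCheck_sound {T : TypeData} {x y z : Size} (hT : T.Sound x y z)
    (hδ0 : 0 ≤ targetDensity) {uv uw vw A B C P Q : NI}
    (h : finalCheck T uv uw vw A B C P Q = true) {ρ a b c da db dc sb cb sc cc : ℝ}
    (hc : ApexConfig x.radius y.radius z.radius ρ a b c da db dc sb cb sc cc)
    (huv : uv.Mem ((ρ + x.radius) * (ρ + y.radius)))
    (huw : uw.Mem ((ρ + x.radius) * (ρ + z.radius)))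
    (hvw : vw.Mem ((ρ + y.radius) * (ρ + z.radius))) (hA : A.Mem a) (hB : B.Mem b)
    (hC : C.Mem c) (hP : P.Mem (cb * cc)) (hQ : Q.Mem (sb * sc)) :
    LongBound x y z a b c da db dc := by
  have hx := x.radius_pos
  have hy := y.radius_pos
  have hz := z.radius_pos
  have hρ := hc.rho_nonneg
  have ha0 : 0 < a := by linarith [hc.ha]
  have hb0 : 0 < b := by linarith [hc.hb]
  have hc0 : 0 < c := by linarith [hc.hc]
  unfold finalCheck at h
  simp only [force_eq, Bool.and_eq_true] at h
  have h1 := boxCheck_sound hT hδ0 h.1 h.2 hA hB hC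
  have h2 := sideUp_sound hT.vy huw hB (abs_diff_le x z)
    (sideDist_sq_le (by positivity) hb0 hc.unit_b hc.sin_b hc.dist_b)
  have h3 := sideUp_sound hT.vz huv hC (abs_diff_le x y)
    (sideDist_sq_le (by positivity) hc0 hc.unit_c hc.sin_c hc.dist_c)
  have hu : (sb * cc + cb * sc) ^ 2 + (cb * cc - sb * sc) ^ 2 = 1 := by
    linear_combination (sc ^ 2 + cc ^ 2) * hc.unit_b + hc.unit_c
  have hs0 : 0 ≤ sb * cc + cb * sc := by
    have := hc.sb_nonneg
    have := hc.cb_nonneg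
    have := hc.sc_nonneg
    have := hc.cc_nonneg
    positivity
  have h4 := base_sound hT.vx hvw hA hP hQ (by positivity) ha0 hs0
    (by rw [hc.sq_a, ← hu]; ring) hc.dist_a
  simp only [natAdd_cast] at h1
  unfold LongBound
  linarith

theorem mem_halfSine {B D M : NI} {b e m s : ℝ} (hB : B.Mem b) (hD : D.Mem (e ^ 2))
    (hM : M.Mem m) (hb : 0 ≤ b) (hm : 0 < m) (hpos : 0 < (NI.smul 4 M).lo)
    (hs : 4 * m * s ^ 2 = b ^ 2 - e ^ 2) :
    (((B.mul B).sub D).div (NI.smul 4 M)).Mem (s ^ 2) := by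
  have e1 : s ^ 2 = (b * b - e ^ 2) / ((4 : ℕ) * m) := by
    rw [eq_div_iff (by positivity), ← sq b, ← hs]
    push_cast
    ring
  have hnn : 0 ≤ b * b - e ^ 2 := by
    rw [← sq b, ← hs]
    positivity
  rw [e1]
  exact ((hB.mul hB hb).sub hD hnn).div (hM.smul 4) hnn hpos

theorem mem_halfCosine {I : NI} {s c : ℝ} (hI : I.Mem (s ^ 2)) (hu : s ^ 2 + c ^ 2 = 1) :
    (NI.one.sub I).Mem (c ^ 2) := by
  have e : c ^ 2 = 1 - s ^ 2 := by linarith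
  rw [e]
  exact NI.mem_one.sub hI (by rw [← e]; positivity)

theorem mem_sqrt_mul {I J : NI} {s t : ℝ} (hI : I.Mem (s ^ 2)) (hJ : J.Mem (t ^ 2))
    (hs : 0 ≤ s) (ht : 0 ≤ t) : (I.mul J).sqrt.Mem (s * t) := by
  have := (hI.mul hJ (by positivity)).sqrt
  rwa [← mul_pow, sqrt_sq (by positivity)] at this

/-! ### Soundness of the subdivision -/

theorem leafCheck_sound {T : TypeData} {x y z : Size} (hT : T.Sound x y z)
    (hδ0 : 0 ≤ targetDensity) {R B C : NI} (h : leafCheck T R B C = true)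
    {ρ a b c da db dc sb cb sc cc : ℝ}
    (hc : ApexConfig x.radius y.radius z.radius ρ a b c da db dc sb cb sc cc)
    (hlong : ¬(a < lConst y z ∧ b < lConst x z ∧ c < lConst x y))
    (hR : R.Mem ρ) (hB : B.Mem b) (hC : C.Mem c) : LongBound x y z a b c da db dc := by
  have hx := x.radius_pos
  have hy := y.radius_pos
  have hz := z.radius_pos
  have hρ := hc.rho_nonneg
  have ha0 : 0 < a := by linarith [hc.ha]
  have hb0 : 0 < b := by linarith [hc.hb]
  have hc0 : 0 < c := by linarith [hc.hc]
  have sb0 := hc.sb_nonneg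
  have cb0 := hc.cb_nonneg
  have sc0 := hc.sc_nonneg
  have cc0 := hc.cc_nonneg
  have mu := hR.add hT.vx.rad
  have mv := hR.add hT.vy.rad
  have mw := hR.add hT.vz.rad
  have muv := mu.mul mv (by positivity)
  have muw := mu.mul mw (by positivity)
  have mvw := mv.mul mw (by positivity)
  have hpos : ∀ {v w : VertexData}, 651050 ≤ v.rad.lo → 651050 ≤ w.rad.lo →
      0 < (NI.smul 4 ((R.add v.rad).mul (R.add w.rad))).lo := by
    intro v w hv hw
    have : 0 < (R.lo + v.rad.lo) * (R.lo + w.rad.lo) / 1000000 :=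
      Nat.div_pos (by nlinarith [Nat.zero_le R.lo]) (by norm_num)
    exact Nat.mul_pos (by norm_num : 0 < 4) this
  have hsb := mem_halfSine hB hT.vy.diff muw hb0.le (by positivity)
    (hpos hT.vx.rad_lo hT.vz.rad_lo) hc.sin_b
  have hsc := mem_halfSine hC hT.vz.diff muv hc0.le (by positivity)
    (hpos hT.vx.rad_lo hT.vy.rad_lo) hc.sin_c
  have hcb := mem_halfCosine hsb hc.unit_b
  have hcc := mem_halfCosine hsc hc.unit_c
  have hP := mem_sqrt_mul hcb hcc cb0 cc0
  have hQ := mem_sqrt_mul hsb hsc sb0 sc0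
  have hcb' := hcb.sqrt
  have hcc' := hcc.sqrt
  rw [sqrt_sq (by positivity)] at hcb' hcc'
  have hu : (sb * cc + cb * sc) ^ 2 = 1 - (cb * cc - sb * sc) ^ 2 := by
    linear_combination (sc ^ 2 + cc ^ 2) * hc.unit_b + hc.unit_c
  have h0 : 0 ≤ 1 - (cb * cc - sb * sc) ^ 2 := by rw [← hu]; positivity
  have hd := hP.dist hQ
  have hd2 := hd.mul hd (abs_nonneg _)
  rw [abs_mul_abs_self, ← sq] at hd2
  have hA := (hT.vx.diff.add ((mvw.smul 4).mul (NI.mem_one.sub hd2 h0) h0)).sqrt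
  rw [Nat.cast_ofNat, ← hc.sq_a, sqrt_sq ha0.le] at hA
  unfold leafCheck at h
  simp only [NI.force_eq, Bool.or_eq_true, Bool.and_eq_true] at h
  -- Every alternative but the last contradicts the configuration or `hlong`.
  rcases h with (h | h) | (h | h) | (h | ⟨h1, h2, h3⟩) | h
  · exfalso
    have := blt_le h
    have h1 := hsb.1
    push_cast at this
    nlinarith [hc.unit_b]
  · exfalso
    have := blt_le h
    have h1 := hsc.1
    push_cast at this
    nlinarith [hc.unit_c]
  · exfalso
    have := blt_le h
    rw [natAdd_cast] at this
    linarith [hP.2, hcb'.2, hQ.1, hc.largest_b]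
  · exfalso
    have := blt_le h
    rw [natAdd_cast] at this
    linarith [hP.2, hcc'.2, hQ.1, hc.largest_c]
  · exfalso
    have := blt_le h
    rw [natAdd_cast] at this
    linarith [hA.2, hT.vy.rad.1, hT.vz.rad.1, hc.ha]
  · exfalso
    have h1 := blt_le h1
    have h2 := blt_le h2
    have h3 := blt_le h3
    rw [hT.vx.l] at h1
    rw [hT.vy.l] at h2
    rw [hT.vz.l] at h3
    exact hlong ⟨by linarith [hA.2], by linarith [hB.2], by linarith [hC.2]⟩
  · refine finalCheck_sound hT hδ0 h hc muv muw mvw ⟨?_, hA.2⟩ hB hC hP hQ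
    simp only [natMax_eq, Nat.cast_max, natAdd_cast]
    exact max_le hA.1 (by linarith [hT.vy.rad.1, hT.vz.rad.1, hc.ha])

theorem longCheck_sound {T : TypeData} {x y z : Size} (hT : T.Sound x y z)
    (hδ0 : 0 ≤ targetDensity) {ρ a b c da db dc sb cb sc cc : ℝ}
    (hc : ApexConfig x.radius y.radius z.radius ρ a b c da db dc sb cb sc cc)
    (hlong : ¬(a < lConst y z ∧ b < lConst x z ∧ c < lConst x y)) (n : ℕ) :
    ∀ R B C : NI, longCheck T n R B C = true → R.Mem ρ → B.Mem b → C.Mem c →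
      LongBound x y z a b c da db dc := by
  induction n with
  | zero => intro R B C h; exact absurd h (by simp [longCheck])
  | succ n ih =>
    intro R B C h hR hB hC
    have h' : or (leafCheck T R B C)
        (cond (and (Nat.ble (width B) (Nat.mul 2 (width R)))
          (Nat.ble (width C) (Nat.mul 2 (width R))))
        (force (mid R) fun m =>
          and (longCheck T n ⟨R.lo, m⟩ B C) (longCheck T n ⟨m, R.hi⟩ B C))
        (cond (Nat.ble (width C) (width B))
          (force (mid B) fun m =>
            and (longCheck T n R ⟨B.lo, m⟩ C) (longCheck T n R ⟨m, B.hi⟩ C))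
          (force (mid C) fun m =>
            and (longCheck T n R B ⟨C.lo, m⟩) (longCheck T n R B ⟨m, C.hi⟩)))) = true := h
    rw [Bool.or_eq_true] at h'
    rcases h' with h' | h'
    · exact leafCheck_sound hT hδ0 h' hc hlong hR hB hC
    · simp only [force_eq, Bool.cond_eq_ite] at h'
      split_ifs at h' <;> rw [Bool.and_eq_true] at h'
      · rcases NI.mem_split hR (m := mid R) with hm | hm
        · exact ih _ _ _ h'.1 hm hB hC
        · exact ih _ _ _ h'.2 hm hB hC
      · rcases NI.mem_split hB (m := mid B) with hm | hm
        · exact ih _ _ _ h'.1 hR hm hC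
        · exact ih _ _ _ h'.2 hR hm hC
      · rcases NI.mem_split hC (m := mid C) with hm | hm
        · exact ih _ _ _ h'.1 hR hB hm
        · exact ih _ _ _ h'.2 hR hB hm

/-- The edge terms of a triangle in a packing are bounded by the gain. -/
theorem longBound_of_typeCheck {x y z : Size} (hδ : densityNI.Mem targetDensity)
    (h : typeCheck x y z = true) {ρ a b c da db dc sb cb sc cc : ℝ}
    (hc : ApexConfig x.radius y.radius z.radius ρ a b c da db dc sb cb sc cc)
    (hρ : ρ ≤ smallRadius) : LongBound x y z a b c da db dc := by
  have hx := x.radius_pos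
  have hy := y.radius_pos
  have hz := z.radius_pos
  have hρ0 := hc.rho_nonneg
  have hs := smallRadius_mem
  have hδ0 : 0 ≤ targetDensity := by
    have := hδ.1
    have := Nat.cast_nonneg (α := ℝ) densityNI.lo
    linarith
  unfold typeCheck at h
  rw [TypeData.force_eq, Bool.and_eq_true] at h
  have hT := typeData_sound hδ x y z
  by_cases hlong : a < lConst y z ∧ b < lConst x z ∧ c < lConst x y
  · obtain ⟨h1, h2, h3⟩ := hlong
    unfold LongBound edgeTerm
    rw [if_pos h1, if_pos h2, if_pos h3, add_zero, add_zero]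
    exact gain_nonneg_of_short hT hδ0 h.1 ⟨hc.ha, h1.le⟩ ⟨hc.hb, h2.le⟩ ⟨hc.hc, h3.le⟩
  -- A sine is at most 1, so b² ≤ 4(ρ + x)(ρ + z) + (x − z)² = (x + z + 2ρ)², and likewise for c.
  · have hup : ∀ {m s t e : ℝ}, 0 ≤ m → s ^ 2 + t ^ 2 = 1 →
        4 * m * s ^ 2 = e → e ≤ 4 * m := by
      intro m s t e hm hu he
      rw [← he]
      nlinarith [mul_nonneg hm (sq_nonneg t)]
    have hb : b ≤ x.radius + z.radius + 2 * ρ := by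
      have := hup (by positivity) hc.unit_b hc.sin_b
      exact abs_le_of_sq_le_sq' (by nlinarith) (by positivity) |>.2
    have hc' : c ≤ x.radius + y.radius + 2 * ρ := by
      have := hup (by positivity) hc.unit_c hc.sin_c
      exact abs_le_of_sq_le_sq' (by nlinarith) (by positivity) |>.2
    refine longCheck_sound hT hδ0 hc hlong 30 _ _ _ h.2 ⟨?_, ?_⟩ ⟨?_, ?_⟩ ⟨?_, ?_⟩
    · simpa using hρ0
    · push_cast
      linarith [hs.2]
    · rw [natAdd_cast]
      linarith [hT.vx.rad.1, hT.vz.rad.1, hc.hb]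
    · simp only [natAdd_cast]
      push_cast
      linarith [hT.vx.rad.2, hT.vz.rad.2, hs.2]
    · rw [natAdd_cast]
      linarith [hT.vx.rad.1, hT.vy.rad.1, hc.hc]
    · simp only [natAdd_cast]
      push_cast
      linarith [hT.vx.rad.2, hT.vy.rad.2, hs.2]

end TernaryPacking

namespace TernaryPacking

open Size Real MeasureTheory

/-! ### Areas of triangles and sectors -/

/-- The triangle with vertices `0`, `v`, `w`. -/
def triSet {E : Type*} [AddCommGroup E] [Module ℝ E] (v w : E) : Set E :=
  {p | ∃ s t : ℝ, 0 ≤ s ∧ 0 ≤ t ∧ s + t ≤ 1 ∧ p = s • v + t • w}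

/-- The cone spanned by `v` and `w`. -/
def coneSet {E : Type*} [AddCommGroup E] [Module ℝ E] (v w : E) : Set E :=
  {p | ∃ s t : ℝ, 0 ≤ s ∧ 0 ≤ t ∧ p = s • v + t • w}

/-- In polar coordinates the sector is the rectangle (0, R] × [0, α]; α < π keeps it inside the
target of the chart. The maximum covers negative R, where both sides are 0. -/
theorem volume_sector {R α : ℝ} (hα : α < π) :
    volume {z : ℂ | ‖z‖ ≤ R ∧ 0 ≤ z.arg ∧ z.arg ≤ α} =
      ENNReal.ofReal (∫ x in (0 : ℝ)..max R 0, x) * ENNReal.ofReal α := by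
  set S := {z : ℂ | ‖z‖ ≤ R ∧ 0 ≤ z.arg ∧ z.arg ≤ α} with hS
  have hmS : MeasurableSet S := by
    refine (measurableSet_le measurable_norm measurable_const).inter
      ((measurableSet_le measurable_const Complex.measurable_arg).inter
        (measurableSet_le Complex.measurable_arg measurable_const))
  rw [← lintegral_indicator_one hmS, ← Complex.lintegral_comp_polarCoord_symm]
  set Q : Set (ℝ × ℝ) := Set.Ioc 0 R ×ˢ Set.Icc 0 α with hQ
  have hmQ : MeasurableSet Q := measurableSet_Ioc.prod measurableSet_Icc
  have hsub : Q ⊆ polarCoord.target := fun p hp =>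
    ⟨hp.1.1, by linarith [hp.2.1, pi_pos], by linarith [hp.2.2]⟩
  have hind : ∀ p ∈ polarCoord.target,
      ENNReal.ofReal p.1 • S.indicator (1 : ℂ → ENNReal) (Complex.polarCoord.symm p) =
        Q.indicator (fun p => ENNReal.ofReal p.1) p := by
    rintro ⟨r, θ⟩ ⟨hr, hθ⟩
    have hr : 0 < r := hr
    have hn : ‖Complex.polarCoord.symm (r, θ)‖ = r := by
      rw [Complex.norm_polarCoord_symm, abs_of_pos hr]
    have harg : (Complex.polarCoord.symm (r, θ)).arg = θ := by
      rw [Complex.polarCoord_symm_apply]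
      have := Complex.arg_mul_cos_add_sin_mul_I hr (θ := θ) ⟨hθ.1, hθ.2.le⟩
      simpa using this
    have hiff : Complex.polarCoord.symm (r, θ) ∈ S ↔ (r, θ) ∈ Q := by
      simp only [hS, hQ, Set.mem_ofPred_eq, hn, harg, Set.mem_prod, Set.mem_Ioc, Set.mem_Icc]
      tauto
    by_cases h : (r, θ) ∈ Q
    · rw [Set.indicator_of_mem h, Set.indicator_of_mem (hiff.2 h)]
      simp
    · rw [Set.indicator_of_notMem h, Set.indicator_of_notMem (mt hiff.1 h)]
      simp
  rw [setLIntegral_congr_fun (polarCoord.open_target.measurableSet) hind,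
    setLIntegral_indicator hmQ, Set.inter_eq_left.2 hsub, hQ, Measure.volume_eq_prod,
    ← Measure.prod_restrict]
  have h1 := lintegral_prod_mul (μ := volume.restrict (Set.Ioc 0 R))
    (ν := volume.restrict (Set.Icc 0 α)) (f := fun x : ℝ => ENNReal.ofReal x)
    (g := fun _ => 1) (by fun_prop) (by fun_prop)
  simp only [mul_one] at h1
  rw [h1]
  congr 1
  · rw [intervalIntegral.integral_of_le (le_max_right _ _),
      ofReal_integral_eq_lintegral_ofReal]
    · congr 2
      rcases le_total R 0 with h | h
      · rw [max_eq_right h, Set.Ioc_eq_empty (by linarith), Set.Ioc_eq_empty (by linarith)]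
      · rw [max_eq_left h]
    · exact (continuous_id.integrableOn_Icc (a := 0) (b := max R 0)).mono_set Set.Ioc_subset_Icc_self
    · filter_upwards [ae_restrict_mem measurableSet_Ioc] with x hx using hx.1.le
  · simp

theorem volume_real_sector {R α : ℝ} (hR : 0 ≤ R) (hα0 : 0 ≤ α) (hα : α < π) :
    volume.real {z : ℂ | ‖z‖ ≤ R ∧ 0 ≤ z.arg ∧ z.arg ≤ α} = R ^ 2 / 2 * α := by
  rw [measureReal_def, volume_sector hα, max_eq_left hR, integral_id, ENNReal.toReal_mul,
    ENNReal.toReal_ofReal (by linarith [sq_nonneg R]), ENNReal.toReal_ofReal hα0]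
  ring

theorem mem_coneSet_complex {c : ℝ} {w z : ℂ} (hc : 0 < c) (hw : 0 < w.im) :
    z ∈ coneSet (c : ℂ) w ↔ 0 ≤ z.arg ∧ z.arg ≤ w.arg := by
  have hw0 : 0 < ‖w‖ := norm_pos_iff.2 fun h => by simp [h] at hw
  have hα0 : 0 ≤ w.arg := Complex.arg_nonneg_iff.2 hw.le
  have hsin : 0 < sin w.arg := by
    rw [Complex.sin_arg]
    exact div_pos hw hw0
  have hre : ∀ z : ℂ, z.re = ‖z‖ * cos z.arg := fun z => (Complex.norm_mul_cos_arg z).symm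
  have him : ∀ z : ℂ, z.im = ‖z‖ * sin z.arg := fun z => (Complex.norm_mul_sin_arg z).symm
  constructor
  · rintro ⟨s, t, hs, ht, rfl⟩
    set z := s • (c : ℂ) + t • w with hz
    have e1 : z.re = s * c + t * w.re := by simp [hz]
    have e2 : z.im = t * w.im := by simp [hz]
    have h0 : 0 ≤ z.arg := Complex.arg_nonneg_iff.2 (by rw [e2]; positivity)
    refine ⟨h0, ?_⟩
    by_contra h
    push Not at h
    have hπ := Complex.arg_le_pi z
    have h1 : 0 < sin (z.arg - w.arg) := by
      refine sin_pos_of_pos_of_lt_pi (by linarith) ?_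
      rcases hα0.eq_or_lt with h' | h'
      · rw [← h', sin_zero] at hsin
        exact absurd hsin (lt_irrefl _)
      · linarith
    -- Both sides are the imaginary part of z · conj w divided by ‖w‖: the multiple of w contributes
    -- nothing.
    have h2 : ‖z‖ * sin (z.arg - w.arg) = -(s * c * sin w.arg) := by
      rw [sin_sub]
      have : ‖z‖ * (sin z.arg * cos w.arg - cos z.arg * sin w.arg) =
        (‖z‖ * sin z.arg) * cos w.arg - (‖z‖ * cos z.arg) * sin w.arg := by ring
      rw [this, ← him z, ← hre z, e1, e2, hre w, him w]
      ring
    have h3 : 0 ≤ s * c * sin w.arg := by positivity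
    rcases (norm_nonneg z).eq_or_lt with h4 | h4
    · have : z = 0 := norm_eq_zero.1 h4.symm
      rw [this, Complex.arg_zero] at h
      linarith
    · nlinarith [mul_pos h4 h1]
  · rintro ⟨h0, h1⟩
    have hwπ := Complex.arg_le_pi w
    -- The coefficients are given by the law of sines.
    refine ⟨‖z‖ * sin (w.arg - z.arg) / (c * sin w.arg), ‖z‖ * sin z.arg / (‖w‖ * sin w.arg),
      div_nonneg (mul_nonneg (norm_nonneg _)
        (sin_nonneg_of_nonneg_of_le_pi (by linarith) (by linarith))) (by positivity),
      div_nonneg (mul_nonneg (norm_nonneg _)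
        (sin_nonneg_of_nonneg_of_le_pi h0 (by linarith))) (by positivity), ?_⟩
    apply Complex.ext
    · simp only [Complex.add_re, Complex.smul_re, Complex.ofReal_re, smul_eq_mul]
      rw [hre w, hre z, sin_sub]
      field_simp
      ring
    · simp only [Complex.add_im, Complex.smul_im, Complex.ofReal_im, smul_eq_mul]
      rw [him w, him z]
      field_simp
      ring

theorem volume_real_cone_complex {c R : ℝ} {w : ℂ} (hc : 0 < c) (hw : 0 < w.im) (hR : 0 ≤ R) :
    volume.real (coneSet (c : ℂ) w ∩ Metric.closedBall 0 R) = R ^ 2 / 2 * w.arg := by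
  have h0 : 0 ≤ w.arg := Complex.arg_nonneg_iff.2 hw.le
  have hπ : w.arg < π := by
    refine (Complex.arg_le_pi w).lt_of_ne fun h => ?_
    exact hw.ne' (Complex.arg_eq_pi_iff.1 h).2
  rw [← volume_real_sector hR h0 hπ]
  congr 1
  ext z
  simp only [Set.mem_inter_iff, mem_coneSet_complex hc hw, mem_closedBall_zero_iff,
    Set.mem_ofPred_eq]
  tauto

/-- Horizontal slices: at height y the section is a segment of length c(1 − y / Im w). -/
theorem volume_real_tri_complex {c : ℝ} {w : ℂ} (hc : 0 < c) (hw : 0 < w.im) :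
    volume.real (triSet (c : ℂ) w) = c * w.im / 2 := by
  set T : Set (ℝ × ℝ) := {p | p.2 ∈ Set.Icc 0 w.im ∧
    p.1 ∈ Set.Icc (p.2 / w.im * w.re) (p.2 / w.im * w.re + c * (1 - p.2 / w.im))} with hT
  have hpre : triSet (c : ℂ) w = Complex.measurableEquivRealProd ⁻¹' T := by
    ext z
    simp only [triSet, Set.mem_ofPred_eq, hT, Set.mem_preimage, Complex.measurableEquivRealProd_apply,
      Set.mem_Icc]
    constructor
    · rintro ⟨s, t, hs, ht, hst, rfl⟩
      have e1 : (s • (c : ℂ) + t • w).re = s * c + t * w.re := by simp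
      have e2 : (s • (c : ℂ) + t • w).im = t * w.im := by simp
      rw [e1, e2, mul_div_cancel_right₀ _ hw.ne']
      refine ⟨⟨by positivity, by nlinarith⟩, by nlinarith, ?_⟩
      nlinarith
    · rintro ⟨⟨h1, h2⟩, h3, h4⟩
      refine ⟨(z.re - z.im / w.im * w.re) / c, z.im / w.im, div_nonneg (by linarith) hc.le,
        by positivity, ?_, ?_⟩
      · have : (z.re - z.im / w.im * w.re) / c ≤ 1 - z.im / w.im := by
          rw [div_le_iff₀ hc]
          linarith
        linarith
      · apply Complex.ext
        · simp
          field_simp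
          ring
        · simp
          field_simp
  have hmT : MeasurableSet T := by
    have : T = {p : ℝ × ℝ | (0 ≤ p.2 ∧ p.2 ≤ w.im) ∧ p.2 / w.im * w.re ≤ p.1 ∧
      p.1 ≤ p.2 / w.im * w.re + c * (1 - p.2 / w.im)} := rfl
    rw [this]
    measurability
  rw [measureReal_def, hpre,
    Complex.volume_preserving_equiv_real_prod.measure_preimage hmT.nullMeasurableSet,
    Measure.volume_eq_prod, Measure.prod_apply_symm hmT]
  have hs : ∀ y : ℝ, volume ((fun x => (x, y)) ⁻¹' T) =
      (Set.Icc 0 w.im).indicator (fun y => ENNReal.ofReal (c * (1 - y / w.im))) y := by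
    intro y
    by_cases hy : y ∈ Set.Icc 0 w.im
    · have : (fun x => (x, y)) ⁻¹' T =
          Set.Icc (y / w.im * w.re) (y / w.im * w.re + c * (1 - y / w.im)) := by
        ext x
        simp only [hT, Set.mem_preimage, Set.mem_ofPred_eq]
        exact and_iff_right hy
      rw [this, Set.indicator_of_mem hy, Real.volume_Icc]
      congr 1
      ring
    · have : (fun x => (x, y)) ⁻¹' T = ∅ := by
        ext x
        simp only [hT, Set.mem_preimage, Set.mem_ofPred_eq, Set.mem_empty_iff_false, iff_false]
        exact fun h => hy h.1
      rw [this, Set.indicator_of_notMem hy, measure_empty]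
  simp_rw [hs]
  rw [lintegral_indicator measurableSet_Icc, ← ofReal_integral_eq_lintegral_ofReal,
    integral_Icc_eq_integral_Ioc, ← intervalIntegral.integral_of_le hw.le]
  · have hd : ∀ y ∈ Set.uIcc 0 w.im, HasDerivAt (fun y => c * (y - y ^ 2 / (2 * w.im)))
        (c * (1 - y / w.im)) y := by
      intro y _
      refine (((hasDerivAt_id y).sub (((hasDerivAt_id y).pow 2).div_const _)).const_mul c).congr_deriv ?_
      simp only [id_eq, Nat.cast_ofNat, Nat.add_one_sub_one, pow_one, mul_one]
      rw [mul_div_mul_left _ _ two_ne_zero]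
    rw [intervalIntegral.integral_eq_sub_of_hasDerivAt hd
      (Continuous.intervalIntegrable (by fun_prop) _ _), ENNReal.toReal_ofReal]
    · field_simp
      ring
    · have : c * (w.im - w.im ^ 2 / (2 * w.im)) - c * (0 - 0 ^ 2 / (2 * w.im)) = c * w.im / 2 := by
        field_simp
        ring
      rw [this]
      positivity
  · exact (Continuous.integrableOn_Icc (by fun_prop))
  · filter_upwards [ae_restrict_mem measurableSet_Icc] with y hy
    have : y / w.im ≤ 1 := (div_le_one hw).2 hy.2
    exact mul_nonneg hc.le (by linarith)

/-- Two independent vectors of the plane in normal position. -/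
theorem exists_isometry_complex {v w : Plane} (h : inner ℝ v w ^ 2 < ‖v‖ ^ 2 * ‖w‖ ^ 2) :
    ∃ L : Plane ≃ₗᵢ[ℝ] ℂ, L v = (‖v‖ : ℂ) ∧ 0 < (L w).im := by
  have hv : v ≠ 0 := fun h0 => by simp [h0] at h
  set e : Plane ≃ₗᵢ[ℝ] ℂ := Complex.orthonormalBasisOneI.repr.symm
  have hn : ‖e v‖ = ‖v‖ := e.norm_map v
  have hv0 : 0 < ‖v‖ := norm_pos_iff.2 hv
  let u : _root_.Circle := ⟨(starRingEnd ℂ) (e v) / ‖v‖, by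
    simp [Submonoid.unitSphere, hn, hv0.ne']⟩
  set L₀ : Plane ≃ₗᵢ[ℝ] ℂ := e.trans (rotation u)
  have hL₀v : L₀ v = (‖v‖ : ℂ) := by
    have : L₀ v = (starRingEnd ℂ) (e v) / ‖v‖ * e v := rfl
    rw [this, div_mul_eq_mul_div, mul_comm, Complex.mul_conj, Complex.normSq_eq_norm_sq, hn]
    have : (‖v‖ : ℂ) ≠ 0 := by exact_mod_cast hv0.ne'
    push_cast
    field_simp
  have him : (L₀ w).im ≠ 0 := by
    intro h0
    have h1 : inner ℝ v w = inner ℝ (L₀ v) (L₀ w) := (L₀.inner_map_map v w).symm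
    have h2 : ‖w‖ ^ 2 = (L₀ w).re ^ 2 := by
      rw [← L₀.norm_map w, ← Complex.normSq_eq_norm_sq, Complex.normSq_apply, h0]
      ring
    rw [hL₀v, Complex.inner] at h1
    simp at h1
    rw [h1, h2] at h
    nlinarith
  -- If w lands below the real axis, complex conjugation brings it above and fixes the image of v.
  rcases lt_or_gt_of_ne him with h1 | h1
  · refine ⟨L₀.trans Complex.conjLIE, ?_, ?_⟩
    · simp [hL₀v]
    · simpa using h1
  · exact ⟨L₀, hL₀v, h1⟩

theorem preimage_coneSet {E F : Type*} [NormedAddCommGroup E] [NormedSpace ℝ E]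
    [NormedAddCommGroup F] [NormedSpace ℝ F] (L : E ≃ₗᵢ[ℝ] F) (v w : E) :
    L ⁻¹' coneSet (L v) (L w) = coneSet v w := by
  ext p
  simp only [coneSet, Set.mem_preimage, Set.mem_ofPred_eq, ← map_smul, ← map_add, L.injective.eq_iff]

theorem preimage_triSet {E F : Type*} [NormedAddCommGroup E] [NormedSpace ℝ E]
    [NormedAddCommGroup F] [NormedSpace ℝ F] (L : E ≃ₗᵢ[ℝ] F) (v w : E) :
    L ⁻¹' triSet (L v) (L w) = triSet v w := by
  ext p
  simp only [triSet, Set.mem_preimage, Set.mem_ofPred_eq, ← map_smul, ← map_add, L.injective.eq_iff]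

theorem volume_real_preimage_isometry (L : Plane ≃ₗᵢ[ℝ] ℂ) (S : Set ℂ) :
    volume.real (L ⁻¹' S) = volume.real S := by
  rw [measureReal_def, measureReal_def,
    L.measurePreserving.measure_preimage_emb L.toHomeomorph.measurableEmbedding]

theorem volume_real_cone {v w : Plane} (h : inner ℝ v w ^ 2 < ‖v‖ ^ 2 * ‖w‖ ^ 2) {R : ℝ}
    (hR : 0 ≤ R) : volume.real (coneSet v w ∩ Metric.closedBall 0 R) =
      R ^ 2 / 2 * InnerProductGeometry.angle v w := by
  obtain ⟨L, hv, hw⟩ := exists_isometry_complex h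
  have hv0 : 0 < ‖v‖ := norm_pos_iff.2 fun h0 => by simp [h0] at h
  have hw0 : L w ≠ 0 := fun h0 => by simp [h0] at hw
  have hpre : coneSet v w ∩ Metric.closedBall 0 R =
      L ⁻¹' (coneSet ((‖v‖ : ℝ) : ℂ) (L w) ∩ Metric.closedBall 0 R) := by
    rw [Set.preimage_inter, ← hv, preimage_coneSet, L.preimage_closedBall, map_zero]
  rw [hpre, volume_real_preimage_isometry, volume_real_cone_complex hv0 hw hR,
    ← L.toLinearIsometry.angle_map]
  simp only [LinearIsometryEquiv.coe_toLinearIsometry]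
  have harg : (L w / (‖v‖ : ℂ)).arg = (L w).arg := by
    rw [div_eq_mul_inv, ← Complex.ofReal_inv, Complex.arg_mul_real (by positivity)]
  rw [hv, InnerProductGeometry.angle_comm,
    Complex.angle_eq_abs_arg hw0 (by exact_mod_cast hv0.ne'), harg,
    abs_of_nonneg (Complex.arg_nonneg_iff.2 hw.le)]

theorem volume_real_tri {v w : Plane} (h : inner ℝ v w ^ 2 < ‖v‖ ^ 2 * ‖w‖ ^ 2) :
    volume.real (triSet v w) = √(‖v‖ ^ 2 * ‖w‖ ^ 2 - inner ℝ v w ^ 2) / 2 := by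
  obtain ⟨L, hv, hw⟩ := exists_isometry_complex h
  have hv0 : 0 < ‖v‖ := norm_pos_iff.2 fun h0 => by simp [h0] at h
  rw [← preimage_triSet L, volume_real_preimage_isometry, hv, volume_real_tri_complex hv0 hw]
  congr 1
  symm
  rw [sqrt_eq_iff_mul_self_eq_of_pos (by positivity), ← L.inner_map_map v w, hv, Complex.inner,
    ← L.norm_map w, ← Complex.normSq_eq_norm_sq, Complex.normSq_apply]
  simp
  ring

end TernaryPacking

/-! ### The numerical verification -/

namespace TernaryPacking

open Size

-- All ordered triples are needed, since the first size is that of the apex.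
set_option maxRecDepth 100000 in
set_option maxHeartbeats 0 in
theorem typeCheck_eq_true (x y z : Size) : typeCheck x y z = true := by
  cases x <;> cases y <;> cases z <;> decide +kernel

end TernaryPacking

namespace TernaryPacking

open Size Real MeasureTheory EuclideanGeometry

/-! ### Areas and angles of triangles of the plane -/

theorem inner_plane (v w : Plane) : inner ℝ v w = v 0 * w 0 + v 1 * w 1 := by
  simp [PiLp.inner_apply, Fin.sum_univ_two, mul_comm]

theorem norm_sq_plane (v : Plane) : ‖v‖ ^ 2 = v 0 ^ 2 + v 1 ^ 2 := by
  simp [EuclideanSpace.norm_sq_eq, Fin.sum_univ_two]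

/-- The determinant of two vectors of the plane. -/
noncomputable def cross (v w : Plane) : ℝ := v 0 * w 1 - v 1 * w 0

theorem inner_sq_add_cross_sq (v w : Plane) :
    inner ℝ v w ^ 2 + cross v w ^ 2 = ‖v‖ ^ 2 * ‖w‖ ^ 2 := by
  rw [inner_plane, norm_sq_plane, norm_sq_plane, cross]
  ring

theorem convexHull_triple (A B C : Plane) :
    convexHull ℝ {A, B, C} = (fun p => p - A) ⁻¹' triSet (B - A) (C - A) := by
  apply Set.Subset.antisymm
  · refine convexHull_min ?_ ?_
    · rintro p (rfl | rfl | rfl)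
      · exact ⟨0, 0, le_rfl, le_rfl, by norm_num, by simp⟩
      · exact ⟨1, 0, zero_le_one, le_rfl, by norm_num, by simp⟩
      · exact ⟨0, 1, le_rfl, zero_le_one, by norm_num, by simp⟩
    · rintro p ⟨s, t, hs, ht, hst, hp⟩ q ⟨s', t', hs', ht', hst', hq⟩ a b ha hb hab
      refine ⟨a * s + b * s', a * t + b * t', by positivity, by positivity, ?_, ?_⟩
      · nlinarith
      · have : a • p + b • q - A = a • (p - A) + b • (q - A) := by
          have : b = 1 - a := by linarith
          subst this
          module
        simp only at hp hq ⊢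
        rw [this, hp, hq]
        module
  · rintro p ⟨s, t, hs, ht, hst, hp⟩
    have h := (convex_convexHull ℝ {A, B, C}).sum_mem (t := Finset.univ) (w := ![1 - s - t, s, t])
      (z := ![A, B, C])
      (by intro i _; fin_cases i <;> simp <;> linarith)
      (by simp [Fin.sum_univ_three]; ring)
      (by intro i _; apply subset_convexHull; fin_cases i <;> simp)
    simp only [Fin.sum_univ_three, Matrix.cons_val] at h
    have : p = (1 - s - t) • A + s • B + t • C := by
      have h' : p = (p - A) + A := by simp
      simp only at hp
      rw [h', hp]
      module
    rwa [this]

section Triangle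

variable {A B C : Plane}

theorem inner_eq_dist (A B C : Plane) :
    inner ℝ (B - A) (C - A) = (dist A C ^ 2 + dist A B ^ 2 - dist B C ^ 2) / 2 := by
  rw [real_inner_eq_norm_mul_self_add_norm_mul_self_sub_norm_sub_mul_self_div_two,
    sub_sub_sub_cancel_right, dist_comm A C, dist_comm A B, dist_eq_norm, dist_eq_norm,
    dist_eq_norm]
  ring

theorem angle_eq_lawAngle (A B C : Plane) :
    ∠ B A C = lawAngle (dist B C) (dist A C) (dist A B) := by
  unfold EuclideanGeometry.angle InnerProductGeometry.angle lawAngle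
  rw [vsub_eq_sub, vsub_eq_sub, inner_eq_dist, dist_comm A C, dist_comm A B, dist_eq_norm C,
    dist_eq_norm B A]
  congr 1
  rw [div_div]
  congr 1
  ring

theorem cross_sq_eq (h : IsTri (dist B C) (dist A C) (dist A B)) :
    cross (B - A) (C - A) ^ 2 = 4 * heron (dist B C) (dist A C) (dist A B) ^ 2 := by
  have h1 := inner_sq_add_cross_sq (B - A) (C - A)
  rw [inner_eq_dist, ← dist_eq_norm, ← dist_eq_norm, dist_comm C, dist_comm B A] at h1
  have := h.heron_sq
  linarith

theorem inner_sq_lt (h : IsTri (dist B C) (dist A C) (dist A B)) :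
    inner ℝ (B - A) (C - A) ^ 2 < ‖B - A‖ ^ 2 * ‖C - A‖ ^ 2 := by
  have := cross_sq_eq h
  have := sq_pos_of_pos h.heron_pos
  linarith [inner_sq_add_cross_sq (B - A) (C - A)]

theorem volume_real_preimage_sub (A : Plane) (S : Set Plane) :
    volume.real ((fun p => p - A) ⁻¹' S) = volume.real S := by
  simp only [measureReal_def, sub_eq_add_neg, measure_preimage_add_right]

theorem volume_real_triangle (h : IsTri (dist B C) (dist A C) (dist A B)) :
    volume.real (convexHull ℝ {A, B, C}) = heron (dist B C) (dist A C) (dist A B) := by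
  rw [convexHull_triple, volume_real_preimage_sub, volume_real_tri (inner_sq_lt h),
    ← inner_sq_add_cross_sq, add_sub_cancel_left, cross_sq_eq h]
  have := h.heron_pos
  rw [show 4 * heron (dist B C) (dist A C) (dist A B) ^ 2 =
    (2 * heron (dist B C) (dist A C) (dist A B)) ^ 2 by ring, sqrt_sq (by positivity)]
  ring

theorem corner_subset (A B C : Plane) (r : ℝ) :
    convexHull ℝ {A, B, C} ∩ Metric.closedBall A r ⊆
      (fun p => p - A) ⁻¹' (coneSet (B - A) (C - A) ∩ Metric.closedBall 0 r) := by
  rw [convexHull_triple]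
  rintro p ⟨⟨s, t, hs, ht, -, hp⟩, hr⟩
  exact ⟨⟨s, t, hs, ht, hp⟩, by simpa [dist_eq_norm] using hr⟩

theorem volume_real_sector_eq (h : IsTri (dist B C) (dist A C) (dist A B)) {r : ℝ} (hr : 0 ≤ r) :
    volume.real ((fun p => p - A) ⁻¹' (coneSet (B - A) (C - A) ∩ Metric.closedBall 0 r)) =
      r ^ 2 / 2 * lawAngle (dist B C) (dist A C) (dist A B) := by
  rw [volume_real_preimage_sub, volume_real_cone (inner_sq_lt h) hr, ← angle_eq_lawAngle]
  rfl

/-- The triangle lies in the cone at A. The inequality suffices for arbitrary triangles because the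
covered area enters the excess with a minus sign. -/
theorem volume_real_corner_le (h : IsTri (dist B C) (dist A C) (dist A B)) {r : ℝ} (hr : 0 ≤ r) :
    volume.real (convexHull ℝ {A, B, C} ∩ Metric.closedBall A r) ≤
      r ^ 2 / 2 * lawAngle (dist B C) (dist A C) (dist A B) := by
  rw [← volume_real_sector_eq h hr]
  refine measureReal_mono (corner_subset A B C r) ?_
  rw [Set.preimage_inter]
  refine ((measure_mono (Set.inter_subset_right.trans ?_)).trans_lt
    (measure_closedBall_lt_top (x := A) (r := r))).ne
  intro p hp
  simpa [dist_eq_norm] using hp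

/-- By `hh` the radius is at most the altitude from A, so the sector does not cross the opposite
edge. -/
theorem volume_real_corner_eq (h : IsTri (dist B C) (dist A C) (dist A B)) {r : ℝ} (hr : 0 ≤ r)
    (hh : r * dist B C ≤ 2 * heron (dist B C) (dist A C) (dist A B)) :
    volume.real (convexHull ℝ {A, B, C} ∩ Metric.closedBall A r) =
      r ^ 2 / 2 * lawAngle (dist B C) (dist A C) (dist A B) := by
  rw [← volume_real_sector_eq h hr]
  congr 1
  refine (corner_subset A B C r).antisymm ?_
  rintro p ⟨⟨s, t, hs, ht, hp⟩, hb⟩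
  have hb : ‖p - A‖ ≤ r := by simpa using hb
  refine ⟨?_, by simpa [dist_eq_norm] using hb⟩
  rw [convexHull_triple]
  refine ⟨s, t, hs, ht, ?_, hp⟩
  -- This identity gives (s + t) · 2 area ≤ ‖p − A‖ · BC ≤ r · BC ≤ 2 area, hence s + t ≤ 1.
  have hc : (s + t) * cross (B - A) (C - A) = cross (p - A) (C - B) := by
    simp only at hp
    rw [hp]
    simp [cross]
    ring
  have h1 : cross (p - A) (C - B) ^ 2 ≤ ‖p - A‖ ^ 2 * ‖C - B‖ ^ 2 := by
    rw [← inner_sq_add_cross_sq]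
    exact le_add_of_nonneg_left (sq_nonneg _)
  rw [← hc, mul_pow, cross_sq_eq h, ← dist_eq_norm C, dist_comm C, ← mul_pow] at h1
  have hH := h.heron_pos
  have ha := h.pos
  have h2 : (‖p - A‖ * dist B C) ^ 2 ≤ (2 * heron (dist B C) (dist A C) (dist A B)) ^ 2 := by
    have : ‖p - A‖ * dist B C ≤ r * dist B C := by gcongr
    exact pow_le_pow_left₀ (by positivity) (this.trans hh) 2
  have h3 : (s + t) ^ 2 ≤ 1 := by
    have : 0 < 4 * heron (dist B C) (dist A C) (dist A B) ^ 2 := by positivity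
    refine le_of_mul_le_mul_right ?_ this
    linarith
  nlinarith

theorem aedisjoint_closedBall {x y : ℝ} (h : x + y ≤ dist A B) (S : Set Plane) :
    AEDisjoint volume (S ∩ Metric.closedBall A x) (S ∩ Metric.closedBall B y) := by
  refine measure_mono_null ?_ (Measure.addHaar_sphere volume A x)
  rintro p ⟨⟨-, hA⟩, ⟨-, hB⟩⟩
  rw [Metric.mem_closedBall] at hA hB
  rw [Metric.mem_sphere]
  have := dist_triangle_left A B p
  linarith

end Triangle

/-! ### The covered area -/

/-- The sum of the areas of the three sectors of a triangle. -/
noncomputable def sectors (x y z a b c : ℝ) : ℝ :=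
  x ^ 2 / 2 * lawAngle a b c + y ^ 2 / 2 * lawAngle b a c + z ^ 2 / 2 * lawAngle c a b

theorem cov_eq (a b c : Circle) : cov a b c =
    volume.real (convexHull ℝ {a.center, b.center, c.center} ∩
        Metric.closedBall a.center a.radius ∪
      convexHull ℝ {a.center, b.center, c.center} ∩ Metric.closedBall b.center b.radius ∪
      convexHull ℝ {a.center, b.center, c.center} ∩ Metric.closedBall c.center c.radius) := by
  rw [cov, triangle, Set.inter_union_distrib_left, Set.inter_union_distrib_left]

theorem triple_rotate (A B C : Plane) : ({A, B, C} : Set Plane) = {B, A, C} ∧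
    ({A, B, C} : Set Plane) = {C, A, B} := by
  constructor
  · exact Set.insert_comm A B {C}
  · rw [Set.pair_comm B C, Set.insert_comm]

theorem cov_le {a b c : Circle} (h : IsTri (dist b.center c.center) (dist a.center c.center)
    (dist a.center b.center)) : cov a b c ≤ sectors a.radius b.radius c.radius
      (dist b.center c.center) (dist a.center c.center) (dist a.center b.center) := by
  have hr : ∀ d : Circle, 0 ≤ d.radius := fun d => d.size.radius_pos.le
  have h1 := volume_real_corner_le h (hr a)
  have h2 := volume_real_corner_le (A := b.center) (B := a.center) (C := c.center)
    (by simpa [dist_comm] using h.swap) (hr b)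
  have h3 := volume_real_corner_le (A := c.center) (B := a.center) (C := b.center)
    (by simpa [dist_comm] using h.swap'.swap) (hr c)
  rw [← (triple_rotate _ _ _).1] at h2
  rw [← (triple_rotate _ _ _).2] at h3
  simp only [dist_comm b.center a.center, dist_comm c.center] at h2 h3
  rw [cov_eq, sectors]
  exact (measureReal_union_le _ _).trans
    (add_le_add ((measureReal_union_le _ _).trans (add_le_add h1 h2)) h3)

/-- Equality is needed for tight triangles only, whose covered areas define δ and V. The closed
discs overlap in null sets and no disc crosses the edge opposite to its center. -/
theorem cov_eq_sectors {a b c : Circle} (h : IsTri (dist b.center c.center)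
      (dist a.center c.center) (dist a.center b.center))
    (hab : a.radius + b.radius ≤ dist a.center b.center)
    (hac : a.radius + c.radius ≤ dist a.center c.center)
    (hbc : b.radius + c.radius ≤ dist b.center c.center)
    (ha : a.radius * dist b.center c.center ≤
      2 * heron (dist b.center c.center) (dist a.center c.center) (dist a.center b.center))
    (hb : b.radius * dist a.center c.center ≤
      2 * heron (dist b.center c.center) (dist a.center c.center) (dist a.center b.center))
    (hc : c.radius * dist a.center b.center ≤
      2 * heron (dist b.center c.center) (dist a.center c.center) (dist a.center b.center)) :
    cov a b c = sectors a.radius b.radius c.radius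
      (dist b.center c.center) (dist a.center c.center) (dist a.center b.center) := by
  have hr : ∀ d : Circle, 0 ≤ d.radius := fun d => d.size.radius_pos.le
  have h1 := volume_real_corner_eq h (hr a) ha
  have h2 := volume_real_corner_eq (A := b.center) (B := a.center) (C := c.center)
    (by simpa [dist_comm] using h.swap) (hr b)
    (by rw [dist_comm b.center a.center, heron_swap']; exact hb)
  have h3 := volume_real_corner_eq (A := c.center) (B := a.center) (C := b.center)
    (by simpa [dist_comm] using h.swap'.swap) (hr c)
    (by rw [dist_comm c.center, dist_comm c.center, heron_swap', heron_swap]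
        exact hc)
  rw [← (triple_rotate _ _ _).1] at h2
  rw [← (triple_rotate _ _ _).2] at h3
  simp only [dist_comm b.center a.center, dist_comm c.center] at h2 h3
  set S := convexHull ℝ {a.center, b.center, c.center} with hS
  have hm : MeasurableSet S := ((Set.toFinite _).isCompact_convexHull (𝕜 := ℝ)).measurableSet
  have hfin : ∀ T : Set Plane, volume (S ∩ T) ≠ ⊤ := fun T =>
    ((measure_mono Set.inter_subset_left).trans_lt
      ((Set.toFinite _).isCompact_convexHull (𝕜 := ℝ)).measure_lt_top).ne
  have hmb : ∀ (A : Plane) (r : ℝ), NullMeasurableSet (S ∩ Metric.closedBall A r) volume :=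
    fun A r => (hm.inter Metric.isClosed_closedBall.measurableSet).nullMeasurableSet
  rw [cov_eq, sectors, measureReal_union₀ (hmb _ _)
      ((aedisjoint_closedBall hac S).union_left (aedisjoint_closedBall hbc S))
      (by rw [← Set.inter_union_distrib_left]; exact hfin _) (hfin _),
    measureReal_union₀ (hmb _ _) (aedisjoint_closedBall hab S) (hfin _) (hfin _), h1, h2, h3]

/-! ### The tight triangles -/

theorem radius_mem (x : Size) : x.radius ∈ Set.Icc (0.65 : ℝ) 1 := by
  have h1 := mediumRadius_spec.1
  have h2 := smallRadius_spec.1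
  cases x <;> simp only [Size.radius, Set.mem_Icc] at * <;> constructor <;> norm_num <;>
    norm_num at h1 h2 <;> linarith

/-- In a tight triangle no circle crosses the opposite edge. Squaring turns the claim into a(b − c)²
≤ 4bc(b + c), which holds because the radii lie in [0.65, 1]. -/
theorem radius_mul_le (x y z : Size) :
    x.radius * (y.radius + z.radius) ≤ 2 * tightHeron x y z := by
  have hx := radius_mem x
  have hy := radius_mem y
  have hz := radius_mem z
  set a := x.radius
  set b := y.radius
  set c := z.radius
  have ha0 : 0 < a := x.radius_pos
  have hb0 : 0 < b := y.radius_pos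
  have hc0 : 0 < c := z.radius_pos
  have h2 : 0.65 * 0.65 ≤ b * c := mul_le_mul hy.1 hz.1 (by norm_num) hb0.le
  have h3 : (b - c) ^ 2 ≤ 0.35 ^ 2 := sq_le_sq' (by linarith [hy.1, hz.2]) (by linarith [hy.2, hz.1])
  have h1 : a * (b - c) ^ 2 ≤ 4 * (b * c) * (b + c) := by
    have e1 : a * (b - c) ^ 2 ≤ 1 * 0.35 ^ 2 := mul_le_mul hx.2 h3 (sq_nonneg _) zero_le_one
    have e2 : 4 * (0.65 * 0.65) * 1 ≤ 4 * (b * c) * (b + c) :=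
      mul_le_mul (by linarith) (by linarith [hy.1, hz.1]) zero_le_one (by positivity)
    linarith
  rw [tightHeron, heron_tight, ← sqrt_sq (show 0 ≤ a * (b + c) by positivity),
    show (2 : ℝ) = √(2 ^ 2) by rw [sqrt_sq (by norm_num)], ← sqrt_mul (by norm_num)]
  apply sqrt_le_sqrt
  nlinarith [mul_le_mul_of_nonneg_left h1 ha0.le]

theorem tightHeron_swap (x y z : Size) : tightHeron y x z = tightHeron x y z := by
  unfold tightHeron
  rw [heron_swap', add_comm y.radius x.radius]

theorem tightHeron_swap' (x y z : Size) : tightHeron x z y = tightHeron x y z := by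
  unfold tightHeron
  rw [heron_swap, add_comm z.radius y.radius]

theorem tightSectors_swap (x y z : Size) : tightSectors y x z = tightSectors x y z := by
  unfold tightSectors
  rw [lawAngle_swap (y.radius + x.radius), add_comm y.radius x.radius]
  ring

theorem tightSectors_swap' (x y z : Size) : tightSectors x z y = tightSectors x y z := by
  unfold tightSectors
  rw [lawAngle_swap (z.radius + y.radius), add_comm z.radius y.radius]
  ring

theorem tightArea_eq (x y z : Size) : tightArea x y z = tightHeron x y z := by
  obtain ⟨h1, h2, h3⟩ := tight_tangent x y z
  have h := volume_real_triangle (A := (tightFst x).center) (B := (tightSnd x y).center)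
    (C := (tightThd x y z).center)
    (by rw [h1, h2, h3]; exact isTri_tight x.radius_pos y.radius_pos z.radius_pos)
  rw [h1, h2, h3] at h
  exact h

theorem tightCov_eq (x y z : Size) : tightCov x y z = tightSectors x y z := by
  obtain ⟨h1, h2, h3⟩ := tight_tangent x y z
  have e1 : (tightFst x).radius = x.radius := rfl
  have e2 : (tightSnd x y).radius = y.radius := rfl
  have e3 : (tightThd x y z).radius = z.radius := rfl
  have k1 := radius_mul_le x y z
  have k2 := radius_mul_le y x z
  have k3 := radius_mul_le z x y
  rw [tightHeron_swap] at k2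
  rw [tightHeron_swap, tightHeron_swap'] at k3
  have h := cov_eq_sectors (a := tightFst x) (b := tightSnd x y) (c := tightThd x y z)
    (by rw [h1, h2, h3]; exact isTri_tight x.radius_pos y.radius_pos z.radius_pos)
    (by rw [h1, e1, e2]) (by rw [h2, e1, e3]) (by rw [h3, e2, e3])
    (by rw [h1, h2, h3, e1]; exact k1) (by rw [h1, h2, h3, e2]; exact k2)
    (by rw [h1, h2, h3, e3]; exact k3)
  rw [h1, h2, h3, e1, e2, e3] at h
  rw [tightCov, h, sectors, tightSectors, add_comm z.radius y.radius, add_comm z.radius x.radius,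
    add_comm y.radius x.radius, lawAngle_swap (x.radius + y.radius) (x.radius + z.radius)]
  ring

theorem tightAngle_eq (q x y : Size) : tightAngle q x y =
    lawAngle (x.radius + y.radius) (q.radius + y.radius) (q.radius + x.radius) := by
  obtain ⟨h1, h2, h3⟩ := tight_tangent q x y
  rw [tightAngle, angle_eq_lawAngle, h1, h2, h3]

theorem densityNI_mem_targetDensity : densityNI.Mem targetDensity := by
  have h := densityNI_mem
  rw [← tightArea_eq, ← tightArea_eq, ← tightArea_eq, ← tightCov_eq, ← tightCov_eq,
    ← tightCov_eq] at h
  exact h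

end TernaryPacking

namespace TernaryPacking

open Size Real MeasureTheory EuclideanGeometry

/-! ### The signed distances to the edges -/

theorem cross_sq_le (v w : Plane) : cross v w ^ 2 ≤ (‖v‖ * ‖w‖) ^ 2 := by
  rw [mul_pow, ← inner_sq_add_cross_sq]
  exact le_add_of_nonneg_left (sq_nonneg _)

theorem cross_vsub_of_mem_line {A B p : Plane} (hp : p ∈ line[ℝ, A, B]) (X : Plane) :
    cross (B - A) (X - p) = cross (B - A) (X - A) := by
  obtain ⟨t, rfl⟩ := mem_affineSpan_pair_iff_exists_lineMap_eq.1 hp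
  simp [AffineMap.lineMap_apply, cross]
  ring

theorem exists_mem_line_dist_eq {A B : Plane} (h : A ≠ B) (X : Plane) :
    ∃ p ∈ line[ℝ, A, B], dist X p = |cross (B - A) (X - A)| / dist A B := by
  have hd : 0 < dist A B := dist_pos.2 h
  refine ⟨AffineMap.lineMap A B (inner ℝ (B - A) (X - A) / dist A B ^ 2),
    AffineMap.lineMap_mem_affineSpan_pair _ _ _, ?_⟩
  have hn : ‖B - A‖ = dist A B := by rw [dist_comm, dist_eq_norm]
  rw [← sq_eq_sq₀ dist_nonneg (by positivity), div_pow, sq_abs, eq_div_iff (by positivity)]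
  have h1 := inner_sq_add_cross_sq (B - A) (X - A)
  have h2 : dist X (AffineMap.lineMap A B (inner ℝ (B - A) (X - A) / dist A B ^ 2)) =
      ‖(X - A) - (inner ℝ (B - A) (X - A) / dist A B ^ 2) • (B - A)‖ := by
    rw [dist_eq_norm, AffineMap.lineMap_apply, vsub_eq_sub, vadd_eq_add]
    congr 1
    abel
  rw [h2, norm_sub_sq_real, norm_smul, inner_smul_right, real_inner_comm, mul_pow, norm_div,
    norm_pow, norm_eq_abs, norm_eq_abs, div_pow, sq_abs, ← pow_mul, abs_of_pos hd]
  rw [real_inner_comm] at h1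
  rw [hn] at h1 ⊢
  field_simp
  linear_combination -(dist A B ^ 4) * h1

theorem signedDist_comm (A B C X : Plane) : signedDist A B C X = signedDist B A C X := by
  unfold signedDist
  rw [Set.pair_comm]

/-- In fact the two sides are equal, but the coefficients q are positive and only upper bounds of
the edge potentials are needed. -/
theorem signedDist_le {A B C : Plane} (h : 0 < cross (B - A) (C - A)) (X : Plane) :
    signedDist A B C X ≤ cross (B - A) (X - A) / dist A B := by
  have hAB : A ≠ B := by
    rintro rfl
    simp [cross] at h
  have hd : 0 < dist A B := dist_pos.2 hAB
  unfold signedDist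
  split_ifs with hs
  · obtain ⟨⟨p, hp, q, hq, hr⟩, hX, hC⟩ := hs
    have h1 := cross_vsub_of_mem_line hp X
    have h2 := cross_vsub_of_mem_line hq C
    have hpos : 0 < cross (B - A) (X - A) := by
      rcases hr with hr | hr | ⟨r₁, r₂, hr₁, hr₂, hr⟩
      · rw [vsub_eq_sub, sub_eq_zero] at hr
        exact absurd (hr ▸ hp) hX
      · rw [vsub_eq_sub, sub_eq_zero] at hr
        exact absurd (hr ▸ hq) hC
      · have h3 : r₁ * cross (B - A) (X - p) = r₂ * cross (B - A) (C - q) := by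
          have e0 := congrArg (fun v : Plane => v 0) hr
          have e1 := congrArg (fun v : Plane => v 1) hr
          simp only [vsub_eq_sub, PiLp.smul_apply, smul_eq_mul] at e0 e1
          unfold cross
          linear_combination (B - A) 0 * e1 - (B - A) 1 * e0
        rw [h1, h2] at h3
        exact pos_of_mul_pos_right (h3 ▸ mul_pos hr₂ h) hr₁.le
    obtain ⟨m, hm, hmX⟩ := exists_mem_line_dist_eq hAB X
    rw [abs_of_pos hpos] at hmX
    exact hmX ▸ Metric.infDist_le_dist_of_mem hm
  · rw [neg_le, ← neg_div]
    refine (Metric.le_infDist ⟨A, left_mem_affineSpan_pair _ _ _⟩).2 fun p hp => ?_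
    rw [← cross_vsub_of_mem_line hp X, div_le_iff₀ hd, dist_comm A, dist_eq_norm, dist_eq_norm,
      mul_comm]
    exact (neg_le_abs _).trans (abs_le_of_sq_le_sq (cross_sq_le _ _) (by positivity))

/-! ### The excess and the vertex potentials -/

theorem tightExcess_eq (x y z : Size) :
    tightExcess x y z = targetDensity * tightHeron x y z - tightSectors x y z := by
  rw [← tightArea_eq, ← tightCov_eq]
  rfl

theorem tightExcess_swap (x y z : Size) : tightExcess y x z = tightExcess x y z := by
  rw [tightExcess_eq, tightExcess_eq, tightHeron_swap, tightSectors_swap]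

theorem tightExcess_swap' (x y z : Size) : tightExcess x z y = tightExcess x y z := by
  rw [tightExcess_eq, tightExcess_eq, tightHeron_swap', tightSectors_swap']

theorem tightPotential_sum (x y z : Size) :
    tightPotential y x z + tightPotential x y z + tightPotential x z y = tightExcess x y z := by
  have e1 := tightExcess_swap x y z
  have e2 := tightExcess_swap' x y z
  have e3 := tightExcess_swap' y x z
  have e4 := tightExcess_swap x z y
  have e5 := tightExcess_swap y z x
  cases x <;> cases y <;> cases z <;>
    simp only [tightPotential, reduceCtorEq, if_true, if_false] <;> linarith

/-- The three numbers V sum to δ · `tightHeron` − `tightSectors`, which are the tight terms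
subtracted in `gain`; the rest is `cov_le`. -/
theorem gain_le_excess {a b c : Circle} (h : IsTri (dist b.center c.center)
    (dist a.center c.center) (dist a.center b.center)) :
    gain a.size b.size c.size (dist b.center c.center) (dist a.center c.center)
        (dist a.center b.center) +
      (vertexPotential a b c + vertexPotential b a c + vertexPotential c a b) ≤ excess a b c := by
  have h1 := cov_le h
  have h2 : area a b c = _ := volume_real_triangle h
  have h3 := tightPotential_sum a.size b.size c.size
  rw [tightExcess_eq] at h3
  unfold sectors Circle.radius at h1
  unfold tightSectors at h3
  unfold excess gain vertexPotential vertexTerm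
  rw [h2, angle_eq_lawAngle, angle_eq_lawAngle, angle_eq_lawAngle, tightAngle_eq, tightAngle_eq,
    tightAngle_eq, dist_comm b.center a.center, dist_comm c.center, dist_comm c.center]
  linarith

/-! ### Configurations seen from the center of the support circle -/

/-- Writing i = m cos 2θ and k = m sin 2θ with 0 ≤ θ ≤ π/2, the witnesses are s = sin θ and c = cos
θ. -/
theorem exists_half_angle {m i k : ℝ} (hm : 0 < m) (hk : 0 ≤ k) (h : i ^ 2 + k ^ 2 = m ^ 2) :
    ∃ s c : ℝ, 0 ≤ s ∧ 0 ≤ c ∧ s ^ 2 + c ^ 2 = 1 ∧ i = m * (c ^ 2 - s ^ 2) ∧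
      k = 2 * m * (s * c) := by
  have h1 : i ≤ m := by nlinarith
  have h2 : -m ≤ i := by nlinarith
  have hs : 0 ≤ (m - i) / (2 * m) := div_nonneg (by linarith) (by linarith)
  have hc : 0 ≤ (m + i) / (2 * m) := div_nonneg (by linarith) (by linarith)
  refine ⟨√((m - i) / (2 * m)), √((m + i) / (2 * m)), sqrt_nonneg _, sqrt_nonneg _, ?_, ?_, ?_⟩
  · rw [sq_sqrt hs, sq_sqrt hc]
    field_simp
    ring
  · rw [sq_sqrt hs, sq_sqrt hc]
    field_simp
    ring
  · rw [← sq_eq_sq₀ hk (by positivity), mul_pow, mul_pow, mul_pow, sq_sqrt hs, sq_sqrt hc]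
    field_simp
    linarith

/-- Circles of sizes `x`, `y`, `z` and centers `A`, `B`, `C`, with disjoint interiors and
tangent to the circle of radius `ρ` centered at the origin. -/
structure Support (x y z : Size) (ρ : ℝ) (A B C : Plane) : Prop where
  rho_nonneg : 0 ≤ ρ
  rho_lt : ρ < smallRadius
  norm_a : ‖A‖ = ρ + x.radius
  norm_b : ‖B‖ = ρ + y.radius
  norm_c : ‖C‖ = ρ + z.radius
  le_ab : x.radius + y.radius ≤ dist A B
  le_ac : x.radius + z.radius ≤ dist A C
  le_bc : y.radius + z.radius ≤ dist B C

theorem Support.rotate {x y z : Size} {ρ : ℝ} {A B C : Plane} (h : Support x y z ρ A B C) :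
    Support y z x ρ B C A :=
  ⟨h.rho_nonneg, h.rho_lt, h.norm_b, h.norm_c, h.norm_a, h.le_bc,
    by rw [add_comm, dist_comm]; exact h.le_ab, by rw [add_comm, dist_comm]; exact h.le_ac⟩

theorem Support.swap {x y z : Size} {ρ : ℝ} {A B C : Plane} (h : Support x y z ρ A B C) :
    Support x z y ρ A C B :=
  ⟨h.rho_nonneg, h.rho_lt, h.norm_a, h.norm_c, h.norm_b, h.le_ac, h.le_ab,
    by rw [add_comm, dist_comm]; exact h.le_bc⟩

theorem smallRadius_le (x : Size) : smallRadius ≤ x.radius := by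
  have h1 := mediumRadius_spec.1.1
  have h2 := smallRadius_spec.1.2
  cases x <;> simp only [Size.radius, le_refl] <;> norm_num at * <;> linarith

theorem dist_sq_eq (A B : Plane) : dist A B ^ 2 = ‖A‖ ^ 2 + ‖B‖ ^ 2 - 2 * inner ℝ A B := by
  rw [dist_eq_norm, norm_sub_sq_real]
  ring

/-- Up to a common factor, the cross products are barycentric coordinates of the origin. -/
theorem cross_combination (A B C : Plane) : cross B C • A + cross C A • B + cross A B • C = 0 := by
  ext i
  fin_cases i <;> simp [cross] <;> ring

/-- The bound of the edge terms by the gain, for a counterclockwise triangle. -/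
def EdgeBound (x y z : Size) (A B C : Plane) : Prop :=
  0 < cross A B + cross B C + cross C A ∧
    LongBound x y z (dist B C) (dist A C) (dist A B) (cross B C / dist B C)
      (cross C A / dist A C) (cross A B / dist A B)

theorem edgeTerm_comm (x y : Size) (e d : ℝ) : edgeTerm x y e d = edgeTerm y x e d := by
  cases x <;> cases y <;> rfl

theorem EdgeBound.rotate {x y z : Size} {A B C : Plane} (h : EdgeBound x y z A B C) :
    EdgeBound y z x B C A := by
  refine ⟨by linarith [h.1], ?_⟩
  have h2 := h.2
  unfold LongBound at h2 ⊢
  rw [dist_comm C A, dist_comm B A, edgeTerm_comm z x, edgeTerm_comm y x, gain_swap', gain_swap]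
  linarith

namespace Support

variable {x y z : Size} {ρ : ℝ} {A B C : Plane}

/-- Otherwise, unless all cross products vanish, A lies in the triangle XBC. Then AB + AC ≤ XB + XC
= 2ρ + y + z, while disjointness gives AB + AC ≥ 2x + y + z; this contradicts ρ < s ≤ x. -/
theorem orientation_pos (h : Support x y z ρ A B C) (h1 : 0 ≤ cross A B) (h3 : 0 ≤ cross C A) :
    0 < cross A B + cross B C + cross C A := by
  by_contra hneg
  push Not at hneg
  have hx := x.radius_pos
  have hy := y.radius_pos
  have hz := z.radius_pos
  have hρ := h.rho_nonneg
  have hρx := h.rho_lt.trans_le (smallRadius_le x)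
  rcases lt_or_ge (cross B C) 0 with h2 | h2
  · set p := cross C A / -cross B C with hp
    set q := cross A B / -cross B C with hq
    have hp0 : 0 ≤ p := div_nonneg h3 (by linarith)
    have hq0 : 0 ≤ q := div_nonneg h1 (by linarith)
    have hpq : p + q ≤ 1 := by
      rw [hp, hq, ← add_div, div_le_one (by linarith)]
      linarith
    have hA : A = p • B + q • C := by
      have e := cross_combination A B C
      have : A = (-cross B C)⁻¹ • (cross C A • B + cross A B • C) := by
        rw [eq_inv_smul_iff₀ (by linarith), neg_smul, neg_eq_iff_add_eq_zero, ← add_assoc]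
        exact e
      rw [this, hp, hq, smul_add, smul_smul, smul_smul, div_eq_inv_mul, div_eq_inv_mul]
    have hb : dist A B ≤ q * dist B C + (1 - p - q) * ‖B‖ := by
      have e : A - B = q • (C - B) + (1 - p - q) • (-B) := by
        rw [hA]
        module
      rw [dist_eq_norm, e, dist_comm B, dist_eq_norm]
      refine (norm_add_le _ _).trans_eq ?_
      rw [norm_smul, norm_smul, norm_neg, norm_of_nonneg hq0,
        norm_of_nonneg (show 0 ≤ 1 - p - q by linarith)]
    have hc : dist A C ≤ p * dist B C + (1 - p - q) * ‖C‖ := by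
      have e : A - C = p • (B - C) + (1 - p - q) • (-C) := by
        rw [hA]
        module
      rw [dist_eq_norm, e, dist_eq_norm]
      refine (norm_add_le _ _).trans_eq ?_
      rw [norm_smul, norm_smul, norm_neg, norm_of_nonneg hp0,
        norm_of_nonneg (show 0 ≤ 1 - p - q by linarith)]
    have hbc : dist B C ≤ ‖B‖ + ‖C‖ := by
      rw [dist_eq_norm]
      exact norm_sub_le _ _
    have := mul_le_mul_of_nonneg_left hbc (add_nonneg hp0 hq0)
    rw [h.norm_b, h.norm_c] at *
    linarith [h.le_ab, h.le_ac]
  · have e1 : cross A B = 0 := by linarith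
    have e2 : cross B C = 0 := by linarith
    have e3 : cross C A = 0 := by linarith
    -- Collinear with X, two vertices must lie on opposite sides of X, or their distance would be |x
    -- − y| < x + y. Three vertices cannot be pairwise opposite.
    have hpar : ∀ {x y : Size} {A B : Plane}, ‖A‖ = ρ + x.radius → ‖B‖ = ρ + y.radius →
        x.radius + y.radius ≤ dist A B → cross A B = 0 → inner ℝ A B < 0 := by
      intro x y A B hA hB hd h0
      have hx := x.radius_pos
      have hy := y.radius_pos
      by_contra hi
      push Not at hi
      have h4 := inner_sq_add_cross_sq A B
      rw [h0, zero_pow two_ne_zero, add_zero, ← mul_pow, sq_eq_sq₀ hi (by positivity)] at h4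
      have h5 := dist_sq_eq A B
      rw [h4, hA, hB] at h5
      nlinarith [mul_pos hx hy]
    have i1 := hpar h.norm_a h.norm_b h.le_ab e1
    have i2 := hpar h.norm_b h.norm_c h.le_bc e2
    have i3 := hpar h.norm_c h.norm_a (by rw [add_comm, dist_comm]; exact h.le_ac) e3
    have key : ‖A‖ ^ 2 * inner ℝ B C = inner ℝ A B * inner ℝ C A - cross A B * cross C A := by
      simp only [inner_plane, norm_sq_plane, cross]
      ring
    rw [e1, zero_mul, sub_zero] at key
    nlinarith [mul_pos_of_neg_of_neg i1 i3, mul_nonneg (sq_nonneg ‖A‖) (neg_nonneg.2 i2.le)]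

/-- B is seen from X at angle 2γ counterclockwise from A, and C at angle 2β clockwise. The
identities `k1`, `k2` are addition formulas expressing the angle from B to C by these two. -/
theorem exists_apexConfig (h : Support x y z ρ A B C) (h1 : 0 ≤ cross A B) (h3 : 0 ≤ cross C A)
    (h2 : cross B C ≤ 0 ∨ (‖A‖ * inner ℝ B C ≤ ‖B‖ * inner ℝ A C ∧
      ‖A‖ * inner ℝ B C ≤ ‖C‖ * inner ℝ A B)) :
    ∃ sb cb sc cc, ApexConfig x.radius y.radius z.radius ρ (dist B C) (dist A C) (dist A B)
      (cross B C / dist B C) (cross C A / dist A C) (cross A B / dist A B) sb cb sc cc := by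
  have ht := h.orientation_pos h1 h3
  have hx := x.radius_pos
  have hy := y.radius_pos
  have hz := z.radius_pos
  have hρ := h.rho_nonneg
  have hda : 0 < dist B C := (by positivity : 0 < y.radius + z.radius).trans_le h.le_bc
  have hdb : 0 < dist A C := (by positivity : 0 < x.radius + z.radius).trans_le h.le_ac
  have hdc : 0 < dist A B := (by positivity : 0 < x.radius + y.radius).trans_le h.le_ab
  have qa := dist_sq_eq B C
  have qb := dist_sq_eq A C
  have qc := dist_sq_eq A B
  have ec := inner_sq_add_cross_sq A B
  have eb := inner_sq_add_cross_sq A C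
  have hCA : cross A C = -cross C A := by unfold cross; ring
  have k1 : ‖A‖ ^ 2 * inner ℝ B C = inner ℝ A B * inner ℝ A C - cross A B * cross C A := by
    simp only [inner_plane, norm_sq_plane, cross]
    ring
  have k2 : ‖A‖ ^ 2 * cross B C = -(inner ℝ A B * cross C A + cross A B * inner ℝ A C) := by
    simp only [inner_plane, norm_sq_plane, cross]
    ring
  rw [hCA, neg_sq] at eb
  rw [← mul_pow] at eb ec
  rw [h.norm_a, h.norm_b, h.norm_c] at *
  set u := ρ + x.radius
  set v := ρ + y.radius
  set w := ρ + z.radius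
  have hu0 : 0 < u := by positivity
  have hv0 : 0 < v := by positivity
  have hw0 : 0 < w := by positivity
  obtain ⟨sc, cc, hsc, hcc, huc, ic, xc⟩ := exists_half_angle (by positivity) h1 ec
  obtain ⟨sb, cb, hsb, hcb, hub, ib, xb⟩ := exists_half_angle (by positivity) h3 eb
  have hia : inner ℝ B C = v * w * (2 * (cb * cc - sb * sc) ^ 2 - 1) := by
    refine mul_left_cancel₀ (pow_ne_zero 2 hu0.ne') ?_
    rw [k1, ic, ib, xc, xb]
    linear_combination u ^ 2 * v * w * (-(sc ^ 2 + cc ^ 2) * hub - huc)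
  have hxa : cross B C = -(2 * (v * w) * (sb * cc + cb * sc) * (cb * cc - sb * sc)) := by
    refine mul_left_cancel₀ (pow_ne_zero 2 hu0.ne') ?_
    rw [k2, ic, ib, xc, xb]
    ring
  have hlargest : sb * sc ≤ cb * cc + cb ∧ sb * sc ≤ cb * cc + cc := by
    -- Let C = cos(β + γ). In the first case C ≥ 0, since C < 0 would force sin(β + γ) = 0 and a
    -- degenerate triangle. In the second, angle BXC has cosine 2C² − 1, and comparing cosines gives
    -- C² ≤ cb² and C² ≤ cc².
    rcases h2 with h2 | ⟨h2, h2'⟩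
    · suffices 0 ≤ cb * cc - sb * sc by constructor <;> linarith
      by_contra hC
      push Not at hC
      have hS : 0 ≤ sb * cc + cb * sc := by positivity
      have hS0 : sb * cc + cb * sc = 0 := by
        refine hS.antisymm' ?_
        by_contra hS'
        push Not at hS'
        rw [hxa] at h2
        have := mul_pos (mul_pos hv0 hw0) (mul_pos hS' (neg_pos.2 hC))
        linarith
      have h4 : sb * cc = 0 := by linarith [mul_nonneg hsb hcc, mul_nonneg hcb hsc]
      have h5 : cb * sc = 0 := by linarith [mul_nonneg hsb hcc, mul_nonneg hcb hsc]
      have h6 : 0 < sb * sc := by linarith [mul_nonneg hcb hcc]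
      have h7 : cc = 0 := by
        rcases mul_eq_zero.1 h4 with h4 | h4
        · rw [h4, zero_mul] at h6
          exact absurd h6 (lt_irrefl _)
        · exact h4
      have h8 : cb = 0 := by
        rcases mul_eq_zero.1 h5 with h5 | h5
        · exact h5
        · rw [h5, mul_zero] at h6
          exact absurd h6 (lt_irrefl _)
      rw [xc, xb, h7, h8] at ht
      linarith
    · rw [hia, ib] at h2
      rw [hia, ic] at h2'
      have hm : 0 < u * v * w := by positivity
      have aux : ∀ {C s c : ℝ}, s ^ 2 + c ^ 2 = 1 → 0 ≤ c →
          u * v * w * (2 * C ^ 2 - 1) ≤ u * v * w * (c ^ 2 - s ^ 2) → -c ≤ C := by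
        intro C s c hsc hc hle
        have := le_of_mul_le_mul_left hle hm
        exact (abs_le_of_sq_le_sq' (by linarith) hc).1
      have a1 := aux (C := cb * cc - sb * sc) hub hcb (by linarith)
      have a2 := aux (C := cb * cc - sb * sc) huc hcc (by linarith)
      exact ⟨by linarith, by linarith⟩
  refine ⟨sb, cb, sc, cc, hρ, h.le_bc, h.le_ac, h.le_ab, hsb, hcb, hsc, hcc, hub, huc, ?_, ?_, ?_,
    hlargest.1, hlargest.2, ?_, ?_, ?_⟩
  · rw [qb, ib]
    linear_combination 2 * u * w * hub
  · rw [qc, ic]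
    linear_combination 2 * u * v * huc
  · rw [qa, hia]
    ring
  · rw [div_mul_cancel₀ _ hda.ne', hxa]
  · rw [div_mul_cancel₀ _ hdb.ne', xb]
    ring
  · rw [div_mul_cancel₀ _ hdc.ne', xc]
    ring

theorem edgeBound_of_apex (h : Support x y z ρ A B C) (h1 : 0 ≤ cross A B) (h3 : 0 ≤ cross C A)
    (h2 : cross B C ≤ 0 ∨ (‖A‖ * inner ℝ B C ≤ ‖B‖ * inner ℝ A C ∧
      ‖A‖ * inner ℝ B C ≤ ‖C‖ * inner ℝ A B)) : EdgeBound x y z A B C := by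
  obtain ⟨sb, cb, sc, cc, hc⟩ := h.exists_apexConfig h1 h3 h2
  exact ⟨h.orientation_pos h1 h3,
    longBound_of_typeCheck densityNI_mem_targetDensity (typeCheck_eq_true x y z) hc h.rho_lt.le⟩

/-- If X lies strictly inside, the apex is the vertex opposite to the largest of the three angles at
X; the quantities compared are their cosines times ‖A‖‖B‖‖C‖. -/
theorem edgeBound (h : Support x y z ρ A B C) (h1 : 0 ≤ cross A B) (h3 : 0 ≤ cross C A) :
    EdgeBound x y z A B C := by
  rcases le_or_gt (cross B C) 0 with h2 | h2
  · exact h.edgeBound_of_apex h1 h3 (Or.inl h2)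
  have sAB := real_inner_comm A B
  have sBC := real_inner_comm B C
  have sAC := real_inner_comm A C
  rcases le_total (‖A‖ * inner ℝ B C) (‖B‖ * inner ℝ A C) with hab | hab
  · rcases le_total (‖A‖ * inner ℝ B C) (‖C‖ * inner ℝ A B) with hac | hac
    · exact h.edgeBound_of_apex h1 h3 (Or.inr ⟨hab, hac⟩)
    · refine (h.rotate.rotate.edgeBound_of_apex h3 h2.le (Or.inr ⟨?_, ?_⟩)).rotate
      · rw [sBC]; exact hac
      · rw [sAC]; exact hac.trans hab
  · rcases le_total (‖B‖ * inner ℝ A C) (‖C‖ * inner ℝ A B) with hbc | hbc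
    · refine (h.rotate.edgeBound_of_apex h2.le h1 (Or.inr ⟨?_, ?_⟩)).rotate.rotate
      · rw [sAB, sAC]; exact hbc
      · rw [sAC]; exact hab
    · refine (h.rotate.rotate.edgeBound_of_apex h3 h2.le (Or.inr ⟨?_, ?_⟩)).rotate
      · rw [sBC]; exact hbc.trans hab
      · rw [sAC]; exact hbc

/-- Two of the three cross products have the same sign. The vertex common to the two corresponding
edges can play the part of A, after a reversal of orientation if they are negative. -/
theorem edgeBound_or (h : Support x y z ρ A B C) :
    EdgeBound x y z A B C ∨ EdgeBound x z y A C B := by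
  have e1 : cross B A = -cross A B := by unfold cross; ring
  have e2 : cross C B = -cross B C := by unfold cross; ring
  have e3 : cross A C = -cross C A := by unfold cross; ring
  rcases le_total 0 (cross A B) with h1 | h1 <;> rcases le_total 0 (cross B C) with h2 | h2 <;>
    rcases le_total 0 (cross C A) with h3 | h3
  · exact Or.inl (h.edgeBound h1 h3)
  · exact Or.inl (h.rotate.edgeBound h2 h1).rotate.rotate
  · exact Or.inl (h.edgeBound h1 h3)
  · exact Or.inr (h.swap.rotate.edgeBound (by linarith) (by linarith)).rotate.rotate
  · exact Or.inl (h.rotate.rotate.edgeBound h3 h2).rotate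
  · exact Or.inr (h.swap.edgeBound (by linarith) (by linarith))
  · exact Or.inr (h.swap.rotate.rotate.edgeBound (by linarith) (by linarith)).rotate
  · exact Or.inr (h.swap.edgeBound (by linarith) (by linarith))

end Support

/-- The product in Heron's formula is 4 · cross², hence positive, so none of the weak triangle
inequalities is an equality. -/
theorem isTri_of_cross_ne_zero {A B C : Plane} (h : cross (B - A) (C - A) ≠ 0) :
    IsTri (dist B C) (dist A C) (dist A B) := by
  have h1 := inner_sq_add_cross_sq (B - A) (C - A)
  rw [inner_eq_dist, ← dist_eq_norm, ← dist_eq_norm, dist_comm C, dist_comm B A] at h1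
  have h2 := sq_pos_of_ne_zero h
  have ta := dist_triangle_left B C A
  have tb := dist_triangle A B C
  have tc := dist_triangle_right A B C
  have na : 0 ≤ dist B C := dist_nonneg
  set a := dist B C
  set b := dist A C
  set c := dist A B
  have h3 : (a + b + c) * (b + c - a) * (a + c - b) * (a + b - c) =
      4 * cross (B - A) (C - A) ^ 2 := by
    linear_combination -4 * h1
  refine ⟨?_, ?_, ?_⟩ <;> by_contra hn <;> push Not at hn
  · have : b + c - a = 0 := by linarith
    rw [this] at h3
    linarith
  · have : a + c - b = 0 := by linarith
    rw [this] at h3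
    linarith
  · have : a + b - c = 0 := by linarith
    rw [this] at h3
    linarith

/-! ### From the edge bounds to the triangles of the packing -/

theorem edgePotential_le {a b c : Circle} {X : Plane} {d : ℝ}
    (h : signedDist a.center b.center c.center X ≤ d) :
    edgePotential a b c X ≤ edgeTerm a.size b.size (dist a.center b.center) d := by
  unfold edgePotential edgeTerm
  split_ifs
  · exact le_rfl
  · exact mul_le_mul_of_nonneg_left h (qConst_pos _ _).le

theorem edgePotential_comm (a b c : Circle) (X : Plane) :
    edgePotential a b c X = edgePotential b a c X := by
  unfold edgePotential
  rw [signedDist_comm, dist_comm]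
  cases a.size <;> cases b.size <;> rfl

theorem EdgeBound.le_gain {a b c : Circle} {X : Plane}
    (h : EdgeBound a.size b.size c.size (a.center - X) (b.center - X) (c.center - X)) :
    IsTri (dist b.center c.center) (dist a.center c.center) (dist a.center b.center) ∧
    edgePotential a b c X + edgePotential b c a X + edgePotential a c b X ≤
      gain a.size b.size c.size (dist b.center c.center) (dist a.center c.center)
        (dist a.center b.center) := by
  obtain ⟨h1, h2⟩ := h
  set A := a.center
  set B := b.center
  set C := c.center
  have hcr : ∀ P Q : Plane, cross (Q - P) (X - P) = cross (P - X) (Q - X) := fun P Q => by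
    simp [cross]
    ring
  have tot : ∀ P Q R : Plane, cross (Q - P) (R - P) =
      cross (P - X) (Q - X) + cross (Q - X) (R - X) + cross (R - X) (P - X) := fun P Q R => by
    simp [cross]
    ring
  unfold LongBound at h2
  simp only [dist_sub_right] at h2
  have t1 : 0 < cross (B - A) (C - A) := by rw [tot]; exact h1
  have t2 : 0 < cross (C - B) (A - B) := by rw [tot]; linarith
  have t3 : 0 < cross (A - C) (B - C) := by rw [tot]; linarith
  have e1 := signedDist_le t1 X
  have e2 := signedDist_le t2 X
  have e3 := signedDist_le t3 X
  rw [hcr] at e1 e2 e3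
  rw [signedDist_comm, dist_comm C A] at e3
  exact ⟨isTri_of_cross_ne_zero t1.ne', le_trans (by
    linarith [edgePotential_le (a := a) (b := b) (c := c) e1,
      edgePotential_le (a := b) (b := c) (c := a) e2,
      edgePotential_le (a := a) (b := c) (c := b) e3]) h2⟩

/-- With ρ < 0 the point X would be interior to two circles of the packing; with ρ ≥ s a small
circle centered at X could be added. -/
theorem support_of_isFMTriangle {P : Set Circle} (hP : IsPacking P) (hsat : IsSaturated P)
    {a b c : Circle} {X : Plane} (hT : IsFMTriangle P a b c X) :
    Support a.size b.size c.size (a.distTo X) (a.center - X) (b.center - X) (c.center - X) := by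
  obtain ⟨⟨hXa, hXb⟩, hXc⟩ := hT.center_mem
  have eb : a.distTo X = b.distTo X := le_antisymm (hXa b hT.mem_b) (hXb a hT.mem_a)
  have ec : a.distTo X = c.distTo X := le_antisymm (hXa c hT.mem_c) (hXc a hT.mem_a)
  have hn : ∀ d : Circle, ‖d.center - X‖ = d.distTo X + d.size.radius := fun d => by
    rw [Circle.distTo, Circle.radius, dist_comm, dist_eq_norm]
    ring
  have hd : ∀ {d e : Circle}, d ∈ P → e ∈ P → d ≠ e →
      d.size.radius + e.size.radius ≤ dist (d.center - X) (e.center - X) := fun hd he hne => by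
    rw [dist_sub_right]
    exact (disjoint_ball_ball_iff (Size.radius_pos _) (Size.radius_pos _)).1 (hP hd he hne)
  refine ⟨?_, ?_, hn a, eb ▸ hn b, ec ▸ hn c, hd hT.mem_a hT.mem_b hT.ne_ab,
    hd hT.mem_a hT.mem_c hT.ne_ac, hd hT.mem_b hT.mem_c hT.ne_bc⟩
  · by_contra hneg
    push Not at hneg
    have ha : X ∈ Metric.ball a.center a.radius := by
      rw [Metric.mem_ball]
      unfold Circle.distTo at hneg
      linarith
    have hb : X ∈ Metric.ball b.center b.radius := by
      rw [Metric.mem_ball]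
      rw [eb] at hneg
      unfold Circle.distTo at hneg
      linarith
    exact Set.disjoint_left.1 (hP hT.mem_a hT.mem_b hT.ne_ab) ha hb
  · obtain ⟨d, hdP, hdX⟩ := hsat X
    have h1 := hXa d hdP
    have h2 : dist X d.center < smallRadius + d.radius := by
      by_contra h3
      exact hdX (Metric.ball_disjoint_ball (not_lt.1 h3))
    refine h1.trans_lt ?_
    unfold Circle.distTo
    linarith

end TernaryPacking

theorem mainTheorem5 (P : Set TernaryPacking.Circle) (hP : TernaryPacking.IsPacking P)
    (hsat : TernaryPacking.IsSaturated P) (a b c : TernaryPacking.Circle)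
    (X : TernaryPacking.Plane) (hT : TernaryPacking.IsFMTriangle P a b c X) :
    TernaryPacking.excess a b c ≥ TernaryPacking.potential a b c X := by
  open TernaryPacking in
  have h : IsTri (dist b.center c.center) (dist a.center c.center) (dist a.center b.center) ∧
      edgePotential a b c X + edgePotential b c a X + edgePotential a c b X ≤
        gain a.size b.size c.size (dist b.center c.center) (dist a.center c.center)
          (dist a.center b.center) := by
    rcases (support_of_isFMTriangle hP hsat hT).edgeBound_or with h | h
    · exact h.le_gain
    · obtain ⟨h1, h2⟩ := h.le_gain
      rw [dist_comm c.center b.center] at h1 h2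
      rw [gain_swap', edgePotential_comm c b a] at h2
      exact ⟨h1.swap', by linarith⟩
  have hg := TernaryPacking.gain_le_excess h.1
  have he := h.2
  unfold TernaryPacking.potential
  linarith
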